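/- **Setting.** Let $R$ be a commutative ring with $1$ and let $\mathfrak L$ be a finite locally geometric poset: a finite poset with a least element $\mathbf 0$ such that every interval $[\mathbf 0,q]$ is a geometric lattice. Write $r$ for the rank, $q\lessdot p$ for "$p$ covers $q$", and $p\mathring\vee q$ for the set of minimal upper bounds of $p$ and $q$. For $p\in\mathfrak L$ the poset $[p,\infty)=\{q\in\mathfrak L: q\ge p\}$ is again locally geometric, with least element $p$ and its own rank function. *Orlik–Solomon algebras.* For $q\in\mathfrak L$, $A^*([\mathbf 0,q])$ is the exterior $R$-algebra on generators $e_a$ ($a$ an atom, $a\le q$) modulo the two-sided ideal generated by all $\partial e_S$ with $S$ a set of atoms below $q$ with $r(\bigvee S)<|S|$; here $e_S$ is the product of the $e_a$, $a\in S$, and $\partial$ is the derivation with $\partial e_a=1$. It is the direct sum of its homogeneous parts $A^*([\mathbf 0,q])_t$, $t\le q$, spanned by the $e_S$ with $\bigvee S=t$. For $t\le s$ let $i_s:A^*([\mathbf 0,t])\to A^*([\mathbf 0,s])$ be the embedding $e_a\mapsto e_a$; it identifies $A^*([\mathbf 0,t])_t$ with $A^*([\mathbf 0,s])_t$. *Monoidal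 presheaves of DGAs.* A presheaf of cochain complexes $\mathcal C$ on $\mathfrak L$ assigns to each $q$ a cochain complex of $R$-modules $\mathcal C_q=\bigoplus_{i\in\mathbb Z}\mathcal C_q^i$ with differential $\delta$ of degree $+1$, and to each $q\le p$ a cochain map $f_{p,q}:\mathcal C_p\to\mathcal C_q$, functorially. It is a monoidal presheaf of DGAs if $\bigoplus_q\mathcal C_q$ carries an associative (not necessarily unital) $R$-bilinear product, additive in degrees, such that $\mathcal C_p\cdot\mathcal C_q\subseteq\bigoplus_{s\in p\mathring\vee q}\mathcal C_s$; $\delta(c_1c_2)=\delta(c_1)c_2+(-1)^{i}c_1\delta(c_2)$ for $c_1\in\mathcal C_p^i$, $c_2\in\mathcal C_q$; and, for $q\le p$, $a\in\mathcal C_p$, $b\in\mathcal C_s$, the elements $f_{p,q}(a)\cdot b$ and $b\cdot f_{p,q}(a)$ are the images of $a\cdot b$ and $b\cdot a$ under the map $\bigoplus_{k\in p\mathring\vee s}\mathcal C_k\to\bigoplus_{t\in q\mathring\vee s}\mathcal C_t$ that on $\mathcal C_k$ is $f_{k,t}$ for the unique $t\in q\mathring\vee s$ with $t\le k$. Restrictions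 of $\mathcal C$ to $[p,\infty)$, and the cohomology presheaf $H^*(\mathcal C): q\mapsto H^*(\mathcal C_q,\delta)$ with zero differential and the induced products, are again monoidal presheaves of DGAs. *The algebra with coefficients.* Put $A^*(\mathfrak L,\mathcal C)=\bigoplus_{q\in\mathfrak L}A^*([\mathbf 0,q])_q\otimes_R\mathcal C_q$, where $A^*([\mathbf 0,q])_q\otimes\mathcal C_q^i$ has total degree $i-r(q)$, with the product $$(x\otimes c_1)(y\otimes c_2)=(-1)^{\deg(c_1)\,r(q)}\sum_{s\in p\mathring\vee q}(i_sx\cdot i_sy)\otimes j_s(c_1c_2)$$ for $x\in A^*([\mathbf 0,p])_p$, $y\in A^*([\mathbf 0,q])_q$, $c_1\in\mathcal C_p$, $c_2\in\mathcal C_q$ ($j_s$ is the projection to $\mathcal C_s$), and the differentials $\delta(x\otimes c)=(-1)^{r(p)}x\otimes\delta c$ and $\partial(x\otimes c)=\sum_{t\lessdot p}x_t\otimes f_{p,t}(c)$, where $\partial x=\sum_{t\lessdot p}x_t$ with $x_t$ of order $t$. Both are derivations, they anticommute, and $\mathrm{Tot}(A^*(\mathfrak L,\mathcal C))$ denotes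 the algebra with the differential $\partial+\delta$. It is filtered by $\tau^{-k}=\bigoplus_{r(q)\le k}A^*([\mathbf 0,q])_q\otimes\mathcal C_q$, a decreasing multiplicative filtration; let $(E_r^{k,j},d_r)$, $d_r:E_r^{k,j}\to E_r^{k+r,j-r+1}$, be the associated multiplicative spectral sequence, $E_r^{k,j}$ being a subquotient of the part of filtration $k$ and total degree $k+j$. Let $H^{-i}(A^*(\mathfrak L,\mathcal C),\partial)$ be the homology at $\bigoplus_{r(q)=i}A^*([\mathbf 0,q])_q\otimes\mathcal C_q$. Write $A^*([p,\infty),\mathcal C)$ for the same construction applied to the poset $[p,\infty)$ and the restriction of $\mathcal C$. **Theorem.** Let $\mathcal C$ be a monoidal presheaf of DGAs on $\mathfrak L$ and $p\in\mathfrak L$. Suppose that the $R$-algebra $H^{-*}(A^*([p,\infty),H^*(\mathcal C)),\partial)$ is generated by $H^{0}$ and $H^{-1}$. Then the spectral sequence of the filtration $\tau$ of $\mathrm{Tot}(A^*([p,\infty),\mathcal C))$ collapses at $E_2$, that is, $d_r=0$ for all $r\ge 2$. Moreover there are isomorphisms of bigraded algebras $$H^{-i}(A^*([p,\infty),H^{j}(\mathcal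 C)),\partial)\;\cong\;E_2^{-i,j}\qquad\text{and}\qquad E_2^{-i,j}\;\cong\;Gr_\tau^{-i}H^{-i+j}(\mathrm{Tot}(A^*([p,\infty),\mathcal C))),$$ where $Gr_\tau$ is the graded algebra of the filtration of the cohomology by the images of the cohomology of the $\tau^{-k}$. -/

import Mathlib

universe u v w

open scoped TensorProduct

noncomputable section

namespace OrlikSolomon

/-! ## Geometric lattices and locally geometric posets -/

section Poset

/-- A geometric lattice: any two elements have a join and a meet, all maximal chains between two
elements have the same length, the rank function (`Order.height`, the length of a longest chain
from `⊥`) is semimodular, and every element other than `⊥` is the join of a set of atoms. -/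
structure IsGeometricLattice (L : Type u) [PartialOrder L] [OrderBot L] : Prop where
  exists_isLUB : ∀ x y : L, ∃ s, IsLUB {x, y} s
  exists_isGLB : ∀ x y : L, ∃ i, IsGLB {x, y} i
  ranked : ∀ c c' : RelSeries {(a, b) : L × L | a ⋖ b},
    c.head = c'.head → c.last = c'.last → c.length = c'.length
  semimodular : ∀ x y i s : L, IsGLB {x, y} i → IsLUB {x, y} s →
    Order.height i + Order.height s ≤ Order.height x + Order.height y
  atomistic : ∀ x : L, x ≠ ⊥ → ∃ A : Set L, (∀ a ∈ A, IsAtom a) ∧ IsLUB A x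

/-- A poset with least element is locally geometric if every interval `[⊥, p]` is a geometric
lattice. -/
class LocallyGeometric (P : Type u) [PartialOrder P] [OrderBot P] : Prop where
  isGeometricLattice : ∀ p : P, IsGeometricLattice (Set.Iic p)

/-- The rank of an element: the length of a longest chain from the bottom to it. -/
def rk {P : Type u} [PartialOrder P] (x : P) : ℕ := (Order.height x).toNat

/-- `s` is the join of `S` in the interval `[⊥, p]`. -/
def IsJoinIn {P : Type u} [PartialOrder P] (p : P) (S : Set P) (s : P) : Prop :=
  IsLeast {u | u ≤ p ∧ ∀ a ∈ S, a ≤ u} s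

/-- The global join of `p` and `q`: the set of all minimal upper bounds. -/
def joins {P : Type u} [PartialOrder P] (p q : P) : Set P :=
  {s | Minimal (fun u => p ≤ u ∧ q ≤ u) s}

variable {P : Type u} [PartialOrder P]

theorem height_Iic {p : P} (x : Set.Iic p) : Order.height x = Order.height (x : P) := by
  apply Order.height_eq_of_strictMono (fun y : Set.Iic p => (y : P)) (fun _ _ h => h)
  intro y z hz
  exact ⟨⟨z, hz.le.trans y.2⟩, hz, rfl⟩

theorem height_eq_rk [Finite P] (x : P) : Order.height x = (rk x : ℕ∞) := by
  have : Order.height x ≠ ⊤ := by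
    obtain ⟨n, hn⟩ : ∃ n : ℕ, Order.height x ≤ n := by
      have := Fintype.ofFinite P
      refine ⟨Fintype.card P, Order.height_le fun c _ => ?_⟩
      have := Fintype.card_le_of_injective c c.strictMono.injective
      rw [Fintype.card_fin] at this
      exact_mod_cast (by omega : c.length ≤ Fintype.card P)
    exact (lt_of_le_of_lt hn (ENat.natCast_lt_top n)).ne
  exact (ENat.natCast_toNat this).symm

theorem rk_lt [Finite P] {x y : P} (h : x < y) : rk x < rk y := by
  have := Order.height_strictMono h (by rw [height_eq_rk]; exact ENat.natCast_lt_top _)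
  rw [height_eq_rk, height_eq_rk] at this
  exact_mod_cast this

theorem rk_le [Finite P] {x y : P} (h : x ≤ y) : rk x ≤ rk y := by
  rcases h.eq_or_lt with rfl | h
  · exact le_rfl
  · exact (rk_lt h).le

theorem eq_of_le_of_rk_le [Finite P] {x y : P} (h : x ≤ y) (h' : rk y ≤ rk x) : x = y := by
  rcases h.eq_or_lt with h | h
  · exact h
  · exact absurd (rk_lt h) (by omega)

theorem rk_bot [OrderBot P] : rk (⊥ : P) = 0 := by simp [rk]

theorem rk_atom_le [OrderBot P] [Finite P] {a : P} (h : IsAtom a) : rk a ≤ 1 := by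
  have : Order.height a ≤ 1 := by
    apply Order.height_le
    intro c hc
    by_contra hlt
    push Not at hlt
    have hl : 1 < c.length := by exact_mod_cast hlt
    have h1 : c ⟨1, by omega⟩ < c ⟨c.length, by omega⟩ := c.strictMono (by simpa using hl)
    have h2 : c ⟨0, by omega⟩ < c ⟨1, by omega⟩ := c.strictMono (by simp [Fin.lt_def])
    have h3 : c ⟨c.length, by omega⟩ = a := hc
    rw [h3] at h1
    rw [h.2 _ h1] at h2
    exact not_lt_bot h2
  rw [height_eq_rk] at this
  exact_mod_cast this

theorem IsJoinIn.unique {p : P} {S : Set P} {s t : P} (h : IsJoinIn p S s) (h' : IsJoinIn p S t) :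
    s = t := IsLeast.unique h h'

theorem isLUB_Iic {p : P} {x y s : Set.Iic p} :
    IsLUB {x, y} s ↔ IsJoinIn p {(x : P), (y : P)} (s : P) := by
  constructor
  · intro h
    refine ⟨⟨s.2, ?_⟩, ?_⟩
    · rintro a (rfl | rfl)
      · exact h.1 (by simp)
      · exact h.1 (by simp)
    · rintro u ⟨hu, hu'⟩
      refine h.2 (show (⟨u, hu⟩ : Set.Iic p) ∈ _ from ?_)
      rintro a (rfl | rfl)
      · exact hu' _ (by simp)
      · exact hu' _ (by simp)
  · intro h
    refine ⟨?_, ?_⟩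
    · rintro a (rfl | rfl)
      · exact h.1.2 _ (by simp)
      · exact h.1.2 _ (by simp)
    · intro u hu
      refine h.2 ⟨u.2, ?_⟩
      rintro a (rfl | rfl)
      · exact hu (by simp)
      · exact hu (by simp)


theorem exists_join₂ [OrderBot P] [LocallyGeometric P] {p x y : P} (hx : x ≤ p) (hy : y ≤ p) : ∃ s, IsJoinIn p {x, y} s := by
  obtain ⟨s, hs⟩ := (LocallyGeometric.isGeometricLattice p).exists_isLUB ⟨x, hx⟩ ⟨y, hy⟩
  exact ⟨s, isLUB_Iic.1 hs⟩

theorem exists_meet₂ [OrderBot P] [LocallyGeometric P] {p x y : P} (hx : x ≤ p) (hy : y ≤ p) :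
    ∃ i : Set.Iic p, IsGLB {(⟨x, hx⟩ : Set.Iic p), ⟨y, hy⟩} i :=
  (LocallyGeometric.isGeometricLattice p).exists_isGLB ⟨x, hx⟩ ⟨y, hy⟩

theorem rk_join₂_le [OrderBot P] [LocallyGeometric P] [Finite P] {p x y s : P} (hx : x ≤ p) (hy : y ≤ p) (h : IsJoinIn p {x, y} s) :
    rk s ≤ rk x + rk y := by
  obtain ⟨i, hi⟩ := exists_meet₂ hx hy
  have := (LocallyGeometric.isGeometricLattice p).semimodular ⟨x, hx⟩ ⟨y, hy⟩ i ⟨s, h.1.1⟩ hi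
    (isLUB_Iic.2 h)
  rw [height_Iic, height_Iic, height_Iic, height_Iic] at this
  simp only [height_eq_rk] at this
  have h2 : rk (i : P) + rk s ≤ rk x + rk y := by exact_mod_cast this
  omega

theorem exists_joinIn [OrderBot P] [LocallyGeometric P] {p : P} (l : List P) (hl : ∀ a ∈ l, a ≤ p) :
    ∃ s, IsJoinIn p {a | a ∈ l} s := by
  induction l with
  | nil => exact ⟨⊥, ⟨bot_le, by simp⟩, fun _ _ => bot_le⟩
  | cons a l ih =>
    obtain ⟨t, ht⟩ := ih (fun b hb => hl b (by simp [hb]))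
    obtain ⟨s, hs⟩ := exists_join₂ (hl a (by simp)) ht.1.1
    refine ⟨s, ⟨hs.1.1, ?_⟩, ?_⟩
    · intro b hb
      rcases List.mem_cons.1 hb with rfl | hb
      · exact hs.1.2 _ (by simp)
      · exact (ht.1.2 b hb).trans (hs.1.2 _ (by simp))
    · rintro u ⟨hu, hu'⟩
      refine hs.2 ⟨hu, ?_⟩
      rintro b (rfl | rfl)
      · exact hu' _ (by simp)
      · exact ht.2 ⟨hu, fun c hc => hu' c (List.mem_cons_of_mem _ hc)⟩

theorem IsJoinIn.mono [OrderBot P] [LocallyGeometric P] {p s : P} (hps : p ≤ s) {S : Set P} {x : P} (h : IsJoinIn p S x) :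
    IsJoinIn s S x := by
  refine ⟨⟨h.1.1.trans hps, h.1.2⟩, ?_⟩
  rintro u ⟨hu, hu'⟩
  obtain ⟨g, hg⟩ := exists_meet₂ hu hps
  have h1 : x ≤ (g : P) := by
    refine h.2 ⟨hg.1 (by simp : (⟨p, hps⟩ : Set.Iic s) ∈ _), fun a ha => ?_⟩
    have : (⟨a, (hu' a ha).trans hu⟩ : Set.Iic s) ≤ g := by
      apply hg.2
      rintro b (rfl | rfl)
      · exact hu' a ha
      · exact (h.1.2 a ha).trans h.1.1
    exact this
  exact h1.trans (hg.1 (by simp : (⟨u, hu⟩ : Set.Iic s) ∈ _))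

theorem IsJoinIn.restrict {p s : P} (hps : p ≤ s) {S : Set P} {x : P} (hS : ∀ a ∈ S, a ≤ p)
    (h : IsJoinIn s S x) : IsJoinIn p S x :=
  ⟨⟨h.2 ⟨hps, hS⟩, h.1.2⟩, fun _ hu => h.2 ⟨hu.1.trans hps, hu.2⟩⟩

theorem rk_join_append_le [OrderBot P] [LocallyGeometric P] [Finite P] {p x y s : P} {l m : List P}
    (hx : IsJoinIn p {a | a ∈ l} x) (hy : IsJoinIn p {a | a ∈ m} y)
    (h : IsJoinIn p {a | a ∈ l ++ m} s) : rk s ≤ rk x + rk y := by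
  obtain ⟨t, ht⟩ := exists_join₂ hx.1.1 hy.1.1
  refine le_trans (rk_le (h.2 ⟨ht.1.1, fun a ha => ?_⟩)) (rk_join₂_le hx.1.1 hy.1.1 ht)
  rcases List.mem_append.1 ha with ha | ha
  · exact (hx.1.2 a ha).trans (ht.1.2 _ (by simp))
  · exact (hy.1.2 a ha).trans (ht.1.2 _ (by simp))

theorem rk_join_singleton_le [OrderBot P] [Finite P] {p a x : P} (ha : IsAtom a) (hap : a ≤ p)
    (h : IsJoinIn p {b | b ∈ [a]} x) : rk x ≤ 1 :=
  (rk_le (h.2 ⟨hap, by simp⟩)).trans (rk_atom_le ha)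

theorem rk_join_le_length [OrderBot P] [LocallyGeometric P] [Finite P] {p : P} (l : List P) (hl : ∀ a ∈ l, IsAtom a ∧ a ≤ p) {x : P}
    (h : IsJoinIn p {a | a ∈ l} x) : rk x ≤ l.length := by
  induction l generalizing x with
  | nil =>
    have : x = ⊥ := le_bot_iff.1 (h.2 ⟨bot_le, by simp⟩)
    simp [this, rk_bot]
  | cons a l ih =>
    have hl' : ∀ b ∈ l, IsAtom b ∧ b ≤ p := fun b hb => hl b (by simp [hb])
    obtain ⟨y, hy⟩ := exists_joinIn l (fun b hb => (hl' b hb).2)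
    have ha := hl a (by simp)
    obtain ⟨z, hz⟩ := exists_joinIn [a] (p := p) (by simpa using ha.2)
    have h1 := rk_join_singleton_le ha.1 ha.2 hz
    have h2 := ih hl' hy
    have h3 := rk_join_append_le hz hy (by simpa using h)
    simp only [List.length_cons]
    omega

theorem rk_covBy [OrderBot P] [LocallyGeometric P] [Finite P] {x y : P} (h : x ⋖ y) : rk y = rk x + 1 := by
  have hne : (⟨y, le_rfl⟩ : Set.Iic y) ≠ ⊥ := by
    intro h'
    have h2 : y = ⊥ := congrArg Subtype.val h'
    have := h.lt
    rw [h2] at this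
    exact not_lt_bot this
  obtain ⟨A, hA, hlub⟩ := (LocallyGeometric.isGeometricLattice y).atomistic _ hne
  have : ∃ a ∈ A, ¬ (a : P) ≤ x := by
    by_contra hcon
    push Not at hcon
    have : (⟨y, le_rfl⟩ : Set.Iic y) ≤ ⟨x, h.le⟩ := hlub.2 (fun a ha => hcon a ha)
    exact absurd this (not_le_of_gt h.lt)
  obtain ⟨a, haA, hax⟩ := this
  obtain ⟨s, hs⟩ := exists_join₂ h.le a.2
  have hxs : x < s := lt_of_le_of_ne (hs.1.2 _ (by simp)) (by
    rintro rfl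
    exact hax (hs.1.2 _ (by simp)))
  have hsy : s = y := by
    by_contra hne
    exact h.2 hxs (lt_of_le_of_ne hs.1.1 hne)
  have h1 := rk_join₂_le h.le a.2 hs
  have ha : IsAtom (a : P) := by
    have := hA a haA
    refine ⟨fun h => this.1 (Subtype.ext h), fun b hb => ?_⟩
    exact congrArg Subtype.val (this.2 ⟨b, hb.le.trans a.2⟩ hb)
  have h2 := rk_atom_le ha
  have h3 := rk_lt h.lt
  subst hsy
  omega

theorem covBy_of_lt_of_rk [Finite P] {x y : P} (h : x < y) (hr : rk y ≤ rk x + 1) : x ⋖ y :=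
  ⟨h, fun _ h1 h2 => by have := rk_lt h1; have := rk_lt h2; omega⟩

theorem mem_joins_of_isJoinIn {p q s : P} (h : IsJoinIn s {p, q} s) : s ∈ joins p q := by
  refine ⟨⟨h.1.2 _ (by simp), h.1.2 _ (by simp)⟩, fun u hu hus => h.2 ⟨hus, ?_⟩⟩
  rintro a (rfl | rfl)
  · exact hu.1
  · exact hu.2

theorem isJoinIn_of_mem_joins [OrderBot P] [LocallyGeometric P] {p q s : P} (h : s ∈ joins p q) : IsJoinIn s {p, q} s := by
  obtain ⟨t, ht⟩ := exists_join₂ h.1.1 h.1.2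
  have : s ≤ t := h.2 ⟨ht.1.2 _ (by simp), ht.1.2 _ (by simp)⟩ ht.1.1
  rwa [← le_antisymm this ht.1.1] at ht

theorem rk_joins_le [OrderBot P] [LocallyGeometric P] [Finite P] {p q s : P} (h : s ∈ joins p q) : rk s ≤ rk p + rk q :=
  rk_join₂_le h.1.1 h.1.2 (isJoinIn_of_mem_joins h)

/-- Below an upper bound `k` of `p` and `q` there is exactly one minimal upper bound. -/
theorem exists_joins_le [OrderBot P] [LocallyGeometric P] {p q k : P} (hp : p ≤ k) (hq : q ≤ k) :
    ∃ t ∈ joins p q, t ≤ k ∧ ∀ u ≤ k, p ≤ u → q ≤ u → t ≤ u := by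
  obtain ⟨t, ht⟩ := exists_join₂ hp hq
  refine ⟨t, mem_joins_of_isJoinIn (ht.restrict ht.1.1 ht.1.2), ht.1.1, fun u hu h1 h2 => ?_⟩
  refine ht.2 ⟨hu, ?_⟩
  rintro a (rfl | rfl)
  · exact h1
  · exact h2


/-! ### The poset `[p, ∞)` -/

theorem coe_lt_Ici {a : P} {x y : Set.Ici a} : (x : P) < y ↔ x < y := Iff.rfl

theorem rk_chain_Ici [Finite P] {a : P} {x : Set.Ici a} : rk x + rk a ≤ rk (x : P) := by
  have h : Order.height x ≤ ((rk (x : P) - rk a : ℕ) : ℕ∞) := by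
    refine Order.height_le fun c hc => ?_
    have key : ∀ i : ℕ, ∀ hi : i ≤ c.length, rk a + i ≤ rk (c ⟨i, by omega⟩ : P) := by
      intro i
      induction i with
      | zero => intro _; exact rk_le (c _).2
      | succ i ih =>
        intro hi
        have h1 := ih (by omega)
        have h2 : c ⟨i, by omega⟩ < c ⟨i + 1, by omega⟩ := c.strictMono (by simp [Fin.lt_def])
        have := rk_lt (coe_lt_Ici.2 h2)
        omega
    have h1 := key c.length le_rfl
    have h2 : c ⟨c.length, by omega⟩ = x := hc
    rw [h2] at h1
    exact_mod_cast (by omega : c.length ≤ rk (x : P) - rk a)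
  rw [height_eq_rk] at h
  have h1 : rk x ≤ rk (x : P) - rk a := by exact_mod_cast h
  have := rk_le x.2
  omega

theorem rk_Ici [OrderBot P] [LocallyGeometric P] [Finite P] {a : P} (x : Set.Ici a) :
    rk x + rk a = rk (x : P) := by
  refine le_antisymm rk_chain_Ici ?_
  induction hn : rk (x : P) using Nat.strong_induction_on generalizing x with
  | _ n ih =>
    subst hn
    by_cases hx : (x : P) = a
    · rw [hx]; omega
    · have hlt : a < x := lt_of_le_of_ne x.2 (Ne.symm hx)
      obtain ⟨y, hay, hyx⟩ : ∃ y, a ≤ y ∧ y ⋖ (x : P) := by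
        obtain ⟨y, hy⟩ := Set.Finite.exists_maximal (Set.toFinite {y : P | a ≤ y ∧ y < x})
          (show Set.Nonempty _ from ⟨a, show a ≤ a ∧ a < (x : P) from ⟨le_rfl, hlt⟩⟩)
        have hy' : a ≤ y ∧ y < x := hy.prop
        refine ⟨y, hy'.1, hy'.2, fun z hz hzx => ?_⟩
        have hz' : a ≤ z ∧ z < x := ⟨hy'.1.trans hz.le, hzx⟩
        exact absurd (hy.le_of_ge hz' hz.le) (not_le_of_gt hz)
      have h1 := ih _ (rk_lt hyx.lt) ⟨y, hay⟩ rfl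
      have h2 := rk_covBy hyx
      have h3 : rk (⟨y, hay⟩ : Set.Ici a) < rk x := rk_lt (show (⟨y, hay⟩ : Set.Ici a) < x from hyx.lt)
      omega

instance [OrderBot P] [LocallyGeometric P] [Finite P] (a : P) : LocallyGeometric (Set.Ici a) where
  isGeometricLattice p := by
    -- passing to the interval `[⊥, p]` of `P`
    let em : Set.Iic p → Set.Iic (p : P) := fun x => ⟨x.1.1, x.2⟩
    have hem : ∀ x y, em x ≤ em y ↔ x ≤ y := fun x y => Iff.rfl
    have hlub : ∀ {x y s : Set.Iic p}, IsLUB {x, y} s → IsLUB {em x, em y} (em s) := by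
      intro x y s h
      refine ⟨?_, ?_⟩
      · rintro _ (rfl | rfl)
        · exact h.1 (by simp)
        · exact h.1 (by simp)
      · intro u hu
        have hxu : em x ≤ u := hu (by simp)
        have hyu : em y ≤ u := hu (by simp)
        suffices h' : (⟨⟨u.1, x.1.2.trans hxu⟩, u.2⟩ : Set.Iic p) ∈ upperBounds {x, y} from h.2 h'
        rintro _ (rfl | rfl)
        · exact hxu
        · exact hyu
    have hglb : ∀ {x y s : Set.Iic p}, IsGLB {x, y} s → IsGLB {em x, em y} (em s) := by
      intro x y s h
      refine ⟨?_, ?_⟩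
      · rintro _ (rfl | rfl)
        · exact h.1 (by simp)
        · exact h.1 (by simp)
      · intro u hu
        have hxu : u ≤ em x := hu (by simp)
        have hyu : u ≤ em y := hu (by simp)
        obtain ⟨v, hv⟩ := exists_join₂ u.2 (show a ≤ (p : P) from p.2)
        have hav : a ≤ v := hv.1.2 _ (by simp)
        have huv : u.1 ≤ v := hv.1.2 _ (by simp)
        have : (⟨⟨v, hav⟩, hv.1.1⟩ : Set.Iic p) ≤ s := by
          refine h.2 ?_
          rintro _ (rfl | rfl)
          · refine hv.2 ⟨(em _).2, ?_⟩
            rintro _ (rfl | rfl)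
            · exact hxu
            · exact Subtype.prop _
          · refine hv.2 ⟨(em _).2, ?_⟩
            rintro _ (rfl | rfl)
            · exact hyu
            · exact Subtype.prop _
        exact huv.trans this
    have hrk : ∀ x : Set.Iic p, Order.height x = (rk x.1 : ℕ∞) := fun x => by
      rw [height_Iic, height_eq_rk]
    refine ⟨?_, ?_, ?_, ?_, ?_⟩
    · intro x y
      obtain ⟨s, hs⟩ := exists_join₂ (show x.1.1 ≤ p.1 from x.2) (show y.1.1 ≤ p.1 from y.2)
      have has : a ≤ s := x.1.2.trans (hs.1.2 _ (by simp))
      refine ⟨⟨⟨s, has⟩, hs.1.1⟩, ?_, ?_⟩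
      · rintro _ (rfl | rfl)
        · exact hs.1.2 _ (by simp)
        · exact hs.1.2 _ (by simp)
      · intro u hu
        refine hs.2 ⟨u.2, ?_⟩
        rintro _ (rfl | rfl)
        · exact hu (by simp)
        · exact hu (by simp)
    · intro x y
      obtain ⟨s, hs⟩ := exists_meet₂ (show x.1.1 ≤ p.1 from x.2) (show y.1.1 ≤ p.1 from y.2)
      have has : (⟨a, p.2⟩ : Set.Iic (p : P)) ≤ s := by
        refine hs.2 ?_
        rintro _ (rfl | rfl)
        · exact x.1.2
        · exact y.1.2
      refine ⟨⟨⟨s, has⟩, s.2⟩, ?_, ?_⟩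
      · rintro _ (rfl | rfl)
        · exact hs.1 (Set.mem_insert _ _)
        · exact hs.1 (Set.mem_insert_of_mem _ rfl)
      · intro u hu
        have : em u ≤ s := by
          refine hs.2 ?_
          rintro _ (rfl | rfl)
          · exact hu (by simp)
          · exact hu (by simp)
        exact this
    · have hcov : ∀ {x y : Set.Iic p}, x ⋖ y → (x.1.1 : P) ⋖ y.1.1 := by
        intro x y h
        refine ⟨h.lt, fun z hz hz' => ?_⟩
        exact h.2 (c := ⟨⟨z, x.1.2.trans hz.le⟩, hz'.le.trans y.2⟩) hz hz'
      have key : ∀ c : RelSeries {(x, y) : Set.Iic p × Set.Iic p | x ⋖ y},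
          rk c.last.1.1 = rk c.head.1.1 + c.length := by
        intro c
        have : ∀ i : ℕ, ∀ hi : i ≤ c.length, rk (c ⟨i, by omega⟩).1.1 = rk c.head.1.1 + i := by
          intro i
          induction i with
          | zero => intro _; rfl
          | succ i ih =>
            intro hi
            have h1 := rk_covBy (hcov (c.step ⟨i, by omega⟩))
            have h2 := ih (by omega)
            simp only [Fin.succ_mk, Fin.castSucc_mk] at h1
            omega
        exact this c.length le_rfl
      intro c c' h h'
      have h1 := key c
      have h2 := key c'
      rw [h, h'] at h1
      omega
    · intro x y i s hi hs
      have := (LocallyGeometric.isGeometricLattice (p : P)).semimodular _ _ _ _ (hglb hi) (hlub hs)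
      rw [height_Iic, height_Iic, height_Iic, height_Iic] at this
      simp only [height_eq_rk, em] at this
      rw [← rk_Ici x.1, ← rk_Ici y.1, ← rk_Ici i.1, ← rk_Ici s.1] at this
      have h2 : rk i.1 + rk a + (rk s.1 + rk a) ≤ rk x.1 + rk a + (rk y.1 + rk a) := by
        exact_mod_cast this
      simp only [hrk]
      exact_mod_cast (by omega : rk i.1 + rk s.1 ≤ rk x.1 + rk y.1)
    · intro x hx
      have hax : a < x.1.1 := by
        refine lt_of_le_of_ne x.1.2 (fun h => hx ?_)
        exact Subtype.ext (Subtype.ext h.symm)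
      obtain ⟨B, hB, hBx⟩ := (LocallyGeometric.isGeometricLattice (p : P)).atomistic (em x) (by
        intro h
        have h2 : x.1.1 = ⊥ := congrArg Subtype.val h
        rw [h2] at hax
        exact not_lt_bot hax)
      refine ⟨{b | IsAtom b ∧ b ≤ x}, fun b hb => hb.1, fun b hb => hb.2, fun u hu => ?_⟩
      have : em x ≤ em u := by
        refine hBx.2 fun b hb => ?_
        by_cases hba : b.1 ≤ a
        · exact hba.trans u.1.2
        · obtain ⟨j, hj⟩ := exists_join₂ (show a ≤ (p : P) from p.2) b.2
          have haj : a ≤ j := hj.1.2 _ (by simp)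
          have hbj : b.1 ≤ j := hj.1.2 _ (by simp)
          have hlt : a < j := lt_of_le_of_ne haj (by rintro rfl; exact hba hbj)
          have hb1 : IsAtom b.1 := by
            have h1 := hB b hb
            refine ⟨fun h => h1.1 (Subtype.ext h), fun c hc => ?_⟩
            exact congrArg Subtype.val (h1.2 ⟨c, hc.le.trans b.2⟩ hc)
          have hr := rk_join₂_le p.2 b.2 hj
          have hr2 := rk_atom_le hb1
          have hcov : a ⋖ j := covBy_of_lt_of_rk hlt (by omega)
          have hjx : j ≤ x.1.1 := hj.2 ⟨x.2, by
            rintro _ (rfl | rfl)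
            · exact hax.le
            · exact hBx.1 hb⟩
          have hju : (⟨⟨j, haj⟩, hj.1.1⟩ : Set.Iic p) ≤ u := by
            refine hu ⟨⟨?_, ?_⟩, hjx⟩
            · intro h
              have : j = a := congrArg (fun z : Set.Iic p => z.1.1) h
              exact hlt.ne' this
            · intro c hc
              by_contra hne
              have : a < c.1.1 := lt_of_le_of_ne c.1.2 (fun h => hne (Subtype.ext (Subtype.ext h.symm)))
              exact hcov.2 this hc
          exact hbj.trans hju
      exact this

end Poset

/-! ## The Orlik–Solomon algebra of an interval `[⊥, p]` -/

section OSAlgebra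

variable (R : Type v) [CommRing R] {P : Type u} [PartialOrder P] [OrderBot P]

/-- The atoms of the interval `[⊥, p]`. -/
abbrev AtomsBelow (p : P) : Type u := {a : P // IsAtom a ∧ a ≤ p}

/-- The exterior `R`-algebra on generators `e_a`, `a` an atom of `[⊥, p]`. -/
abbrev Ext (p : P) : Type (max u v) := ExteriorAlgebra R (AtomsBelow p →₀ R)

open Classical in
/-- The generator `e_a` (zero if `a` is not an atom of `[⊥, p]`). -/
def extGen (p a : P) : Ext R p :=
  if h : IsAtom a ∧ a ≤ p then ExteriorAlgebra.ι R (Finsupp.single ⟨a, h⟩ 1) else 0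

/-- The monomial `e_{a₁} ⋯ e_{aₖ}`. -/
def extMon (p : P) (l : List P) : Ext R p := (l.map (extGen R p)).prod

/-- The derivation `∂` of the exterior algebra with `∂ e_a = 1` for all atoms `a`, i.e.
`∂ (e_{a₁} ⋯ e_{aₖ}) = ∑ⱼ (-1)^(j-1) e_{a₁} ⋯ ê_{aⱼ} ⋯ e_{aₖ}`. -/
def extBdry (p : P) : Ext R p →ₗ[R] Ext R p :=
  CliffordAlgebra.contractLeft (Finsupp.linearCombination R fun _ : AtomsBelow p => (1 : R))

/-- A set of atoms of `[⊥, p]` (listed without repetition) is dependent if the rank of its join is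
smaller than its cardinality. -/
def IsDependent (p : P) (l : List P) : Prop :=
  l.Nodup ∧ (∀ a ∈ l, IsAtom a ∧ a ≤ p) ∧ ∃ s, IsJoinIn p {a | a ∈ l} s ∧ rk s < l.length

/-- The Orlik–Solomon ideal, the two-sided ideal generated by all `∂ e_S`, `S` dependent (it is
written as the left ideal generated by the right multiples of these elements). -/
def osIdeal (p : P) : Ideal (Ext R p) :=
  Ideal.span {z | ∃ l, IsDependent p l ∧ ∃ y, z = extBdry R p (extMon R p l) * y}

instance (p : P) : (osIdeal R p).IsTwoSided where
  mul_mem_of_left {a} b ha := by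
    refine Submodule.span_induction (p := fun a _ => a * b ∈ osIdeal R p) ?_ ?_ ?_ ?_ ha
    · rintro _ ⟨l, hl, y, rfl⟩
      exact Ideal.subset_span ⟨l, hl, y * b, by rw [mul_assoc]⟩
    · simp
    · intro x y _ _ hx hy
      rw [add_mul]
      exact add_mem hx hy
    · intro c x _ hx
      rw [smul_eq_mul, mul_assoc]
      exact Ideal.mul_mem_left _ _ hx

/-- The Orlik–Solomon algebra `A*([⊥, p])`. -/
def OS (p : P) : Type (max u v) := Ext R p ⧸ osIdeal R p

instance (p : P) : Ring (OS R p) := inferInstanceAs (Ring (Ext R p ⧸ osIdeal R p))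

instance (p : P) : Algebra R (OS R p) := inferInstanceAs (Algebra R (Ext R p ⧸ osIdeal R p))

/-- The quotient map from the exterior algebra. -/
def osMk (p : P) : Ext R p →ₐ[R] OS R p := Ideal.Quotient.mkₐ R (osIdeal R p)

/-- The image of the generator `e_a` in the Orlik–Solomon algebra. -/
def osGen (p a : P) : OS R p := osMk R p (extGen R p a)

/-- The image of the monomial `e_{a₁} ⋯ e_{aₖ}` in the Orlik–Solomon algebra. -/
def osMon (p : P) (l : List P) : OS R p := osMk R p (extMon R p l)

variable {R}

theorem osMk_eq_iff {p : P} {x y : Ext R p} : osMk R p x = osMk R p y ↔ x - y ∈ osIdeal R p :=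
  Ideal.Quotient.eq

theorem osMk_eq_zero {p : P} {x : Ext R p} (h : x ∈ osIdeal R p) : osMk R p x = 0 :=
  Ideal.Quotient.eq_zero_iff_mem.2 h

theorem osMk_surjective (p : P) : Function.Surjective (osMk R p) :=
  Ideal.Quotient.mk_surjective

theorem extGen_of_not {p a : P} (h : ¬ (IsAtom a ∧ a ≤ p)) : extGen R p a = 0 := by
  simp [extGen, h]

theorem extMon_cons (p a : P) (l : List P) :
    extMon R p (a :: l) = extGen R p a * extMon R p l := by simp [extMon]

theorem extMon_append (p : P) (l m : List P) :
    extMon R p (l ++ m) = extMon R p l * extMon R p m := by simp [extMon]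

theorem extMon_of_not {p : P} {l : List P} {a : P} (ha : a ∈ l) (h : ¬ (IsAtom a ∧ a ≤ p)) :
    extMon R p l = 0 := by
  induction l with
  | nil => simp at ha
  | cons b l ih =>
    rw [extMon_cons]
    rcases List.mem_cons.1 ha with rfl | ha
    · rw [extGen_of_not h, zero_mul]
    · rw [ih ha, mul_zero]

theorem extGen_sq (p a : P) : extGen R p a * extGen R p a = 0 := by
  unfold extGen
  split_ifs
  · exact ExteriorAlgebra.ι_sq_zero _
  · simp

theorem extGen_anticomm (p a b : P) :
    extGen R p a * extGen R p b = - (extGen R p b * extGen R p a) := by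
  unfold extGen
  split_ifs
  · exact eq_neg_of_add_eq_zero_left (ExteriorAlgebra.ι_add_mul_swap _ _)
  all_goals simp

theorem extGen_mul_extMon_of_mem {p a : P} {l : List P} (ha : a ∈ l) :
    extGen R p a * extMon R p l = 0 := by
  induction l with
  | nil => simp at ha
  | cons b l ih =>
    rw [extMon_cons, ← mul_assoc]
    rcases List.mem_cons.1 ha with rfl | ha
    · rw [extGen_sq, zero_mul]
    · rw [extGen_anticomm, neg_mul, mul_assoc, ih ha, mul_zero, neg_zero]

theorem extMon_of_not_nodup {p : P} {l : List P} (h : ¬ l.Nodup) : extMon R p l = 0 := by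
  induction l with
  | nil => simp at h
  | cons b l ih =>
    rw [extMon_cons]
    by_cases hb : b ∈ l
    · exact extGen_mul_extMon_of_mem hb
    · rw [ih (fun hl => h (List.nodup_cons.2 ⟨hb, hl⟩)), mul_zero]

theorem extBdry_nil (p : P) : extBdry R p (extMon R p []) = 0 := by
  simp only [extMon, List.map_nil, List.prod_nil, extBdry]
  exact CliffordAlgebra.contractLeft_one (d := _) (Q := (0 : QuadraticForm R (AtomsBelow p →₀ R)))

theorem extBdry_gen_mul {p a : P} (h : IsAtom a ∧ a ≤ p) (x : Ext R p) :
    extBdry R p (extGen R p a * x) = x - extGen R p a * extBdry R p x := by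
  have := CliffordAlgebra.contractLeft_ι_mul
    (d := Finsupp.linearCombination R fun _ : AtomsBelow p => (1 : R)) (Q := 0)
    (Finsupp.single ⟨a, h⟩ 1) x
  simp only [Finsupp.linearCombination_single, smul_eq_mul, mul_one, one_smul] at this
  simpa [extGen, h, extBdry] using this

theorem extBdry_bdry (p : P) (x : Ext R p) : extBdry R p (extBdry R p x) = 0 :=
  CliffordAlgebra.contractLeft_contractLeft _ x

/-- The grading involution. -/
def extInv (p : P) : Ext R p →ₐ[R] Ext R p := CliffordAlgebra.involute

theorem extBdry_mul (p : P) (x y : Ext R p) :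
    extBdry R p (x * y) = extBdry R p x * y + extInv p x * extBdry R p y := by
  induction x using CliffordAlgebra.left_induction with
  | algebraMap r =>
    have h1 := CliffordAlgebra.contractLeft_algebraMap_mul
      (d := Finsupp.linearCombination R fun _ : AtomsBelow p => (1 : R)) (Q := 0) r y
    have h2 := CliffordAlgebra.contractLeft_algebraMap
      (d := Finsupp.linearCombination R fun _ : AtomsBelow p => (1 : R)) (Q := 0) r
    have h3 : extInv p (algebraMap R (Ext R p) r) = algebraMap R _ r := AlgHom.commutes _ _
    simp only [extBdry]
    rw [h3]
    erw [h1, h2]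
    simp
  | add x z hx hz => simp only [add_mul, map_add, hx, hz]; abel
  | ι_mul x m hx =>
    have h1 := CliffordAlgebra.contractLeft_ι_mul
      (d := Finsupp.linearCombination R fun _ : AtomsBelow p => (1 : R)) (Q := 0) m
    have h3 : extInv p (CliffordAlgebra.ι 0 m : Ext R p) = - CliffordAlgebra.ι 0 m :=
      CliffordAlgebra.involute_ι m
    have h4 : ∀ z : Ext R p, extBdry R p (CliffordAlgebra.ι 0 m * z) =
        (Finsupp.linearCombination R fun _ : AtomsBelow p => (1 : R)) m • z -
          CliffordAlgebra.ι 0 m * extBdry R p z := h1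
    rw [map_mul (extInv p), h3, mul_assoc, h4, hx, h4]
    simp only [sub_mul, mul_add, smul_mul_assoc, neg_mul, mul_assoc]
    abel

theorem extInv_extGen (p a : P) : extInv p (extGen R p a) = - extGen R p a := by
  unfold extGen
  split_ifs
  · exact CliffordAlgebra.involute_ι _
  · simp

theorem extInv_extMon (p : P) (l : List P) :
    extInv p (extMon R p l) = (-1 : R) ^ l.length • extMon R p l := by
  induction l with
  | nil => simp [extMon]
  | cons a l ih =>
    rw [extMon_cons, map_mul, ih, extInv_extGen, List.length_cons, pow_succ]
    simp

theorem extInv_bdry (p : P) (l : List P) : extInv p (extBdry R p (extMon R p l)) =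
    - ((-1 : R) ^ l.length • extBdry R p (extMon R p l)) := by
  induction l with
  | nil => simp [extBdry_nil]
  | cons a l ih =>
    by_cases h : IsAtom a ∧ a ≤ p
    · rw [extMon_cons, extBdry_gen_mul h, map_sub, map_mul, ih, extInv_extMon, extInv_extGen,
        List.length_cons, pow_succ]
      simp only [mul_neg, neg_mul, mul_one, neg_smul, smul_sub, mul_smul_comm, smul_neg]
      abel
    · rw [extMon_of_not (List.mem_cons_self) h]
      simp

theorem extBdry_mem {p : P} {x : Ext R p} (hx : x ∈ osIdeal R p) :
    extBdry R p x ∈ osIdeal R p := by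
  refine Submodule.span_induction (p := fun x _ => extBdry R p x ∈ osIdeal R p) ?_ ?_ ?_ ?_ hx
  · rintro _ ⟨l, hl, y, rfl⟩
    rw [extBdry_mul, extBdry_bdry, zero_mul, zero_add, extInv_bdry, neg_mul, smul_mul_assoc,
      Algebra.smul_def]
    exact neg_mem (Ideal.mul_mem_left _ _ (Ideal.subset_span ⟨l, hl, _, rfl⟩))
  · simp
  · intro x y _ _ hx hy
    rw [map_add]
    exact add_mem hx hy
  · intro c x hx hx'
    rw [smul_eq_mul, extBdry_mul]
    exact add_mem (Ideal.mul_mem_left _ _ hx) (Ideal.mul_mem_left _ _ hx')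

/-- The monomial of a dependent set lies in the Orlik–Solomon ideal. -/
theorem extMon_mem {p : P} {l : List P} (hl : ∀ a ∈ l, IsAtom a ∧ a ≤ p) {s : P}
    (hs : IsJoinIn p {a | a ∈ l} s) (hr : rk s < l.length) : extMon R p l ∈ osIdeal R p := by
  by_cases hn : l.Nodup
  · cases l with
    | nil => simp at hr
    | cons a l =>
      have h1 : extBdry R p (extMon R p (a :: l)) ∈ osIdeal R p :=
        Ideal.subset_span ⟨a :: l, ⟨hn, hl, s, hs, hr⟩, 1, (mul_one _).symm⟩
      have h2 := Ideal.mul_mem_left _ (extGen R p a) h1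
      rw [extMon_cons, extBdry_gen_mul (hl a (by simp)), mul_sub, ← mul_assoc, extGen_sq,
        zero_mul, sub_zero] at h2
      rwa [extMon_cons]
  · rw [extMon_of_not_nodup hn]
    exact zero_mem _

variable (R)

/-- The derivation `∂` of the Orlik–Solomon algebra. -/
def osBdry (p : P) : OS R p →ₗ[R] OS R p where
  toFun := Quotient.lift (s := Submodule.quotientRel (osIdeal R p))
    (fun x => osMk R p (extBdry R p x)) (fun a b h => by
      rw [osMk_eq_iff, ← map_sub]
      exact extBdry_mem ((Submodule.quotientRel_def _).1 h))
  map_add' := by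
    rintro ⟨x⟩ ⟨y⟩
    exact (congrArg (osMk R p) (map_add (extBdry R p) x y)).trans (map_add (osMk R p) _ _)
  map_smul' := by
    rintro r ⟨x⟩
    exact (congrArg (osMk R p) (map_smul (extBdry R p) r x)).trans (map_smul (osMk R p) _ _)

open Classical in
/-- The map of generators `e_a ↦ e_a` if `a ≤ s` and `e_a ↦ 0` otherwise. -/
def extMap (p s : P) : Ext R p →ₐ[R] Ext R s :=
  ExteriorAlgebra.map (Finsupp.linearCombination R fun a : AtomsBelow p =>
    if h : a.1 ≤ s then Finsupp.single (⟨a.1, a.2.1, h⟩ : AtomsBelow s) (1 : R) else 0)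

variable {R}

theorem osBdry_mk (p : P) (x : Ext R p) :
    osBdry R p (osMk R p x) = osMk R p (extBdry R p x) := rfl

theorem extMap_gen {p s a : P} (h : a ≤ p) :
    extMap R p s (extGen R p a) = extGen R s a := by
  unfold extGen
  by_cases h1 : IsAtom a ∧ a ≤ p
  · rw [dif_pos h1]
    by_cases h2 : a ≤ s
    · rw [dif_pos ⟨h1.1, h2⟩, extMap, ExteriorAlgebra.map_apply_ι]
      simp [h2]
    · rw [dif_neg (fun h => h2 h.2), extMap, ExteriorAlgebra.map_apply_ι]
      simp [h2]
  · rw [dif_neg h1, dif_neg (fun h2 => h1 ⟨h2.1, h⟩), map_zero]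

theorem extMap_mon {p s : P} {l : List P} (hl : ∀ a ∈ l, IsAtom a ∧ a ≤ p) :
    extMap R p s (extMon R p l) = extMon R s l := by
  induction l with
  | nil => simp [extMon]
  | cons a l ih =>
    rw [extMon_cons, extMon_cons, map_mul, ih (fun b hb => hl b (by simp [hb])),
      extMap_gen (hl a (by simp)).2]

theorem extMap_bdry_of_le {p s : P} {l : List P} (hl : ∀ a ∈ l, IsAtom a ∧ a ≤ p)
    (hls : ∀ a ∈ l, a ≤ s) :
    extMap R p s (extBdry R p (extMon R p l)) = extBdry R s (extMon R s l) := by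
  induction l with
  | nil => simp [extBdry_nil]
  | cons a l ih =>
    have ha := hl a (by simp)
    have hl' : ∀ b ∈ l, IsAtom b ∧ b ≤ p := fun b hb => hl b (by simp [hb])
    rw [extMon_cons, extMon_cons, extBdry_gen_mul ha, extBdry_gen_mul ⟨ha.1, hls a (by simp)⟩,
      map_sub, map_mul, ih hl' (fun b hb => hls b (by simp [hb])), extMap_mon hl',
      extMap_gen ha.2]

theorem extMap_bdry_of_not {p s b : P} {l m : List P}
    (hl : ∀ a ∈ l ++ b :: m, IsAtom a ∧ a ≤ p) (hb : ¬ b ≤ s) :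
    extMap R p s (extBdry R p (extMon R p (l ++ b :: m))) = (-1 : R) ^ l.length •
      extMon R s (l ++ m) := by
  have hgb : extGen R s b = 0 := extGen_of_not (fun h => hb h.2)
  induction l with
  | nil =>
    have hb' := hl b (by simp)
    rw [List.nil_append, extMon_cons, extBdry_gen_mul hb', map_sub, map_mul,
      extMap_gen hb'.2, hgb, extMap_mon (fun a ha => hl a (by simp [ha]))]
    simp
  | cons a l ih =>
    have ha := hl a (by simp)
    have hl' : ∀ c ∈ l ++ b :: m, IsAtom c ∧ c ≤ p :=
      fun c hc => hl c (List.mem_cons_of_mem _ hc)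
    rw [List.cons_append, extMon_cons, extBdry_gen_mul ha, map_sub, map_mul, ih hl',
      extMap_mon hl', extMap_gen ha.2, List.cons_append, extMon_cons,
      extMon_of_not (a := b) (by simp) (fun h => hb h.2), List.length_cons, pow_succ]
    simp

theorem extMap_mem [Finite P] [LocallyGeometric P] {p s : P} (h : p ≤ s ∨ s ≤ p) {x : Ext R p}
    (hx : x ∈ osIdeal R p) : extMap R p s x ∈ osIdeal R s := by
  refine Submodule.span_induction (p := fun x _ => extMap R p s x ∈ osIdeal R s) ?_ ?_ ?_ ?_ hx
  · rintro _ ⟨l, ⟨hn, hl, t, ht, hr⟩, y, rfl⟩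
    rw [map_mul]
    refine Ideal.mul_mem_right _ _ ?_
    by_cases hls : ∀ a ∈ l, a ≤ s
    · have hd : IsDependent s l := by
        refine ⟨hn, fun a ha => ⟨(hl a ha).1, hls a ha⟩, t, ?_, hr⟩
        rcases h with h | h
        · exact ht.mono h
        · exact ht.restrict h hls
      have hmem : extBdry R s (extMon R s l) ∈ osIdeal R s :=
        Ideal.subset_span ⟨l, hd, 1, (mul_one _).symm⟩
      rwa [extMap_bdry_of_le hl hls]
    · push Not at hls
      obtain ⟨b, hbl, hbs⟩ := hls
      have hsp : s ≤ p := h.resolve_left (fun h => hbs ((hl b hbl).2.trans h))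
      obtain ⟨l₁, l₂, rfl⟩ := List.append_of_mem hbl
      rw [extMap_bdry_of_not hl hbs, Algebra.smul_def]
      refine Ideal.mul_mem_left _ _ ?_
      by_cases hls : ∀ a ∈ l₁ ++ l₂, a ≤ s
      · have hl' : ∀ a ∈ l₁ ++ l₂, IsAtom a ∧ a ≤ s := fun a ha => by
          refine ⟨(hl a ?_).1, hls a ha⟩
          rcases List.mem_append.1 ha with ha | ha <;> simp [ha]
        obtain ⟨j, hj⟩ := exists_joinIn _ hls
        refine extMon_mem hl' hj ?_
        have hjt : j < t := by
          refine lt_of_le_of_ne ((hj.mono hsp).2 ⟨ht.1.1, fun a ha => ht.1.2 a ?_⟩) ?_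
          · rcases List.mem_append.1 ha with ha | ha <;> simp [ha]
          · rintro rfl
            exact hbs ((ht.1.2 b hbl).trans hj.1.1)
        have := rk_lt hjt
        simp only [List.length_append, List.length_cons] at hr ⊢
        omega
      · push Not at hls
        obtain ⟨c, hc, hcs⟩ := hls
        rw [extMon_of_not hc (fun h => hcs h.2)]
        exact zero_mem _
  · simp
  · intro x y _ _ hx hy
    rw [map_add]
    exact add_mem hx hy
  · intro c x _ hx
    rw [smul_eq_mul, map_mul]
    exact Ideal.mul_mem_left _ _ hx

variable (R) in
/-- For comparable `p` and `s`, the algebra map `A*([⊥, p]) → A*([⊥, s])` sending `e_a` to `e_a` if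
`a ≤ s` and to `0` otherwise. If `p ≤ s` it is the natural embedding `i_s`; if `s ≤ p` it is the
projection onto the subalgebra `A*([⊥, s])`, a left inverse of the embedding. -/
def osMap [Finite P] [LocallyGeometric P] {p s : P} (h : p ≤ s ∨ s ≤ p) : OS R p →ₐ[R] OS R s :=
  Ideal.quotientMapₐ (osIdeal R s) (extMap R p s) (fun _ hx => extMap_mem h hx)

variable (R) in
/-- The homogeneous part `A*([⊥, p])_p` of order `p`: the span of the monomials `e_S` with
`⋁ S = p`. -/
def top (p : P) : Submodule R (OS R p) :=
  Submodule.span R {x | ∃ l : List P, (∀ a ∈ l, IsAtom a ∧ a ≤ p) ∧ IsJoinIn p {a | a ∈ l} p ∧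
    x = osMon R p l}

end OSAlgebra

/-! ## Products and derivations of the top homogeneous parts -/

section Top

variable {R : Type v} [CommRing R] {P : Type u} [PartialOrder P] [OrderBot P]

theorem osMon_of_not {p : P} {l : List P} {a : P} (ha : a ∈ l) (h : ¬ (IsAtom a ∧ a ≤ p)) :
    osMon R p l = 0 := by
  rw [osMon, extMon_of_not ha h, map_zero]

theorem osMon_append (p : P) (l m : List P) :
    osMon R p (l ++ m) = osMon R p l * osMon R p m := by
  simp [osMon, extMon_append]

theorem osMon_eq_zero {p : P} {l : List P} (hl : ∀ a ∈ l, IsAtom a ∧ a ≤ p) {s : P}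
    (hs : IsJoinIn p {a | a ∈ l} s) (hr : rk s < l.length) : osMon R p l = 0 :=
  osMk_eq_zero (extMon_mem hl hs hr)

theorem osBdry_osBdry (p : P) (x : OS R p) : osBdry R p (osBdry R p x) = 0 := by
  obtain ⟨x, rfl⟩ := osMk_surjective p x
  rw [osBdry_mk, osBdry_mk, extBdry_bdry, map_zero]

theorem osBdry_mon_mul (p : P) (l : List P) (y : OS R p) :
    osBdry R p (osMon R p l * y) =
      osBdry R p (osMon R p l) * y + (-1 : R) ^ l.length • (osMon R p l * osBdry R p y) := by
  obtain ⟨y, rfl⟩ := osMk_surjective p y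
  rw [osMon, ← map_mul, osBdry_mk, osBdry_mk, osBdry_mk, extBdry_mul, extInv_extMon, map_add,
    map_mul, smul_mul_assoc]
  rfl

theorem osBdry_mon_mem {p : P} {l : List P} (hl : ∀ a ∈ l, IsAtom a ∧ a ≤ p) :
    osBdry R p (osMon R p l) ∈ Submodule.span R
      {x | ∃ l₁ a l₂, l = l₁ ++ a :: l₂ ∧ x = osMon R p (l₁ ++ l₂)} := by
  induction l with
  | nil => simp [osMon, osBdry_mk, extBdry_nil]
  | cons a l ih =>
    have h1 : osBdry R p (osMon R p (a :: l)) =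
        osMon R p l - osGen R p a * osBdry R p (osMon R p l) := by
      rw [osMon, extMon_cons, osBdry_mk, extBdry_gen_mul (hl a (by simp))]
      simp [osMon, osGen, osBdry_mk]
    rw [h1]
    refine sub_mem (Submodule.subset_span ⟨[], a, l, rfl, rfl⟩) ?_
    have h2 := Submodule.mem_map_of_mem (f := LinearMap.mulLeft R (osGen R p a))
      (ih (fun b hb => hl b (by simp [hb])))
    rw [Submodule.map_span] at h2
    refine Submodule.span_mono ?_ h2
    rintro _ ⟨_, ⟨l₁, b, l₂, rfl, rfl⟩, rfl⟩
    refine ⟨a :: l₁, b, l₂, rfl, ?_⟩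
    simp [osMon, osGen, extMon_cons]

variable [LocallyGeometric P]

theorem osMon_eq_zero_of_not_le {q t : P} {l : List P}
    (hj : IsJoinIn q {a | a ∈ l} q) {p : P} (hq : q ≤ p) (ht : t ≤ p) (hqt : ¬ q ≤ t) :
    osMon R t l = 0 := by
  have : ∃ a ∈ l, ¬ a ≤ t := by
    by_contra hcon
    push Not at hcon
    exact hqt ((hj.mono hq).2 ⟨ht, hcon⟩)
  obtain ⟨a, ha, hat⟩ := this
  exact osMon_of_not ha (fun h => hat h.2)

variable [Finite P]

theorem osMap_mon {p s : P} (h : p ≤ s ∨ s ≤ p) {l : List P} (hl : ∀ a ∈ l, IsAtom a ∧ a ≤ p) :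
    osMap R h (osMon R p l) = osMon R s l :=
  congrArg (osMk R s) (extMap_mon hl)

/-- On the part of order `p`, the derivation lowers the order by one step. -/
theorem osBdry_mem_of_mem_top {p : P} {x : OS R p} (hx : x ∈ top R p) :
    osBdry R p x ∈ Submodule.span R {y | ∃ t, t ⋖ p ∧ ∃ l : List P, (∀ a ∈ l, IsAtom a ∧ a ≤ t) ∧
      IsJoinIn t {a | a ∈ l} t ∧ y = osMon R p l} := by
  induction hx using Submodule.span_induction with
  | zero => simp
  | add x y _ _ hx hy => rw [map_add]; exact add_mem hx hy
  | smul r x _ hx => rw [map_smul]; exact Submodule.smul_mem _ _ hx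
  | mem x hx =>
    obtain ⟨l, hl, hj, rfl⟩ := hx
    by_cases hr : rk p < l.length
    · rw [osMon_eq_zero hl hj hr, map_zero]
      exact zero_mem _
    refine Submodule.span_mono ?_ (osBdry_mon_mem hl)
    rintro _ ⟨l₁, a, l₂, rfl, rfl⟩
    have hl' : ∀ b ∈ l₁ ++ l₂, IsAtom b ∧ b ≤ p := fun b hb => by
      apply hl
      rcases List.mem_append.1 hb with hb | hb <;> simp [hb]
    obtain ⟨t, ht⟩ := exists_joinIn _ (fun b hb => (hl' b hb).2)
    have ha := hl a (by simp)
    obtain ⟨z, hz⟩ := exists_joinIn [a] (p := p) (by simpa using ha.2)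
    have hset : {b | b ∈ l₁ ++ a :: l₂} = {b | b ∈ [a] ++ (l₁ ++ l₂)} := by
      ext b; simp only [Set.mem_ofPred_eq, List.mem_append, List.mem_cons, List.not_mem_nil]; tauto
    have h1 := rk_join_singleton_le ha.1 ha.2 hz
    have h2 := rk_join_append_le hz ht (hset ▸ hj)
    have h3 := rk_join_le_length _ hl' ht
    simp only [List.length_append, List.length_cons] at hr h3
    have htp : t < p := lt_of_le_of_ne ht.1.1 (by rintro rfl; omega)
    exact ⟨t, covBy_of_lt_of_rk htp (by omega), _, fun b hb => ⟨(hl' b hb).1, ht.1.2 b hb⟩,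
      ht.restrict ht.1.1 ht.1.2, rfl⟩

variable (R) in
open Classical in
/-- The map `osMap` as a linear map, set to zero on incomparable elements. -/
def osTo (p s : P) : OS R p →ₗ[R] OS R s :=
  if h : p ≤ s ∨ s ≤ p then (osMap R h).toLinearMap else 0

theorem osTo_apply {p s : P} (h : p ≤ s ∨ s ≤ p) (x : OS R p) : osTo R p s x = osMap R h x := by
  simp [osTo, h]

theorem osTo_mul {p s : P} (h : p ≤ s ∨ s ≤ p) (x y : OS R p) :
    osTo R p s (x * y) = osTo R p s x * osTo R p s y := by
  simp only [osTo_apply h, map_mul]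

theorem osTo_mon {p s : P} (h : p ≤ s ∨ s ≤ p) {l : List P} (hl : ∀ a ∈ l, IsAtom a ∧ a ≤ p) :
    osTo R p s (osMon R p l) = osMon R s l := by
  rw [osTo_apply h, osMap_mon h hl]

theorem osTo_self {p : P} {x : OS R p} (hx : x ∈ top R p) : osTo R p p x = x := by
  induction hx using Submodule.span_induction with
  | zero => simp
  | add x y _ _ hx hy => rw [map_add, hx, hy]
  | smul r x _ hx => rw [map_smul, hx]
  | mem x hx =>
    obtain ⟨l, hl, hj, rfl⟩ := hx
    exact osTo_mon (Or.inl le_rfl) hl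

theorem osTo_osTo {p q t : P} (hq : q ≤ p) (ht : t ≤ p) {x : OS R q} (hx : x ∈ top R q)
    (hqt : q ≤ t) : osTo R p t (osTo R q p x) = osTo R q t x := by
  induction hx using Submodule.span_induction with
  | zero => simp
  | add x y _ _ hx hy => simp only [map_add, hx, hy]
  | smul r x _ hx => simp only [map_smul, hx]
  | mem x hx =>
    obtain ⟨l, hl, hj, rfl⟩ := hx
    rw [osTo_mon (Or.inl hq) hl, osTo_mon (Or.inl hqt) hl,
      osTo_mon (Or.inr ht) (fun a ha => ⟨(hl a ha).1, (hl a ha).2.trans hq⟩)]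

theorem osTo_osTo_up {a b k : P} (hba : b ≤ a) (hak : a ≤ k) {z : OS R b} (hz : z ∈ top R b) :
    osTo R a k (osTo R b a z) = osTo R b k z := by
  induction hz using Submodule.span_induction with
  | zero => simp
  | add x y _ _ hx hy => simp only [map_add, hx, hy]
  | smul r x _ hx => simp only [map_smul, hx]
  | mem z hz =>
    obtain ⟨l, hl, hj, rfl⟩ := hz
    rw [osTo_mon (Or.inl hba) hl, osTo_mon (Or.inl (hba.trans hak)) hl,
      osTo_mon (Or.inl hak) (fun a ha => ⟨(hl a ha).1, (hl a ha).2.trans hba⟩)]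

theorem osTo_osTo_zero {p q t : P} (hq : q ≤ p) (ht : t ≤ p) {x : OS R q} (hx : x ∈ top R q)
    (hqt : ¬ q ≤ t) : osTo R p t (osTo R q p x) = 0 := by
  induction hx using Submodule.span_induction with
  | zero => simp
  | add x y _ _ hx hy => simp only [map_add, hx, hy, add_zero]
  | smul r x _ hx => simp only [map_smul, hx, smul_zero]
  | mem x hx =>
    obtain ⟨l, hl, hj, rfl⟩ := hx
    rw [osTo_mon (Or.inl hq) hl,
      osTo_mon (Or.inr ht) (fun a ha => ⟨(hl a ha).1, (hl a ha).2.trans hq⟩)]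
    exact osMon_eq_zero_of_not_le hj hq ht hqt

theorem osBdry_osTo {p s : P} (h : p ≤ s) {x : OS R p} (hx : x ∈ top R p) :
    osBdry R s (osTo R p s x) = osTo R p s (osBdry R p x) := by
  induction hx using Submodule.span_induction with
  | zero => simp
  | add x y _ _ hx hy => simp only [map_add, hx, hy]
  | smul r x _ hx => simp only [map_smul, hx]
  | mem x hx =>
    obtain ⟨l, hl, hj, rfl⟩ := hx
    rw [osTo_mon (Or.inl h) hl, osTo_apply (Or.inl h), osMon, osMon, osBdry_mk, osBdry_mk,
      ← extMap_bdry_of_le hl (fun a ha => (hl a ha).2.trans h)]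
    rfl

theorem osBdry_osTo_mul {p s : P} (h : p ≤ s) {x : OS R p} (hx : x ∈ top R p) (y : OS R s) :
    osBdry R s (osTo R p s x * y) = osBdry R s (osTo R p s x) * y +
      (-1 : R) ^ rk p • (osTo R p s x * osBdry R s y) := by
  induction hx using Submodule.span_induction with
  | zero => simp
  | add x y _ _ hx hy => simp only [map_add, add_mul, hx, hy, smul_add]; abel
  | smul r x _ hx => simp only [map_smul, smul_mul_assoc, hx, smul_add, smul_comm r]
  | mem x hx =>
    obtain ⟨l, hl, hj, rfl⟩ := hx
    by_cases hr : rk p < l.length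
    · simp [osMon_eq_zero hl hj hr]
    have : rk p = l.length := le_antisymm (rk_join_le_length _ hl hj) (not_lt.1 hr)
    rw [osTo_mon (Or.inl h) hl, osBdry_mon_mul, this]

/-- Products of homogeneous elements of dependent orders vanish. -/
theorem osTo_mul_eq_zero {p q s t : P} (ht : t ∈ joins p q) (hts : t ≤ s)
    (hr : rk t < rk p + rk q) {x : OS R p} (hx : x ∈ top R p) {y : OS R q} (hy : y ∈ top R q) :
    osTo R p s x * osTo R q s y = 0 := by
  induction hx using Submodule.span_induction with
  | zero => simp
  | add x y _ _ hx hy => simp only [map_add, add_mul, hx, hy, add_zero]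
  | smul r x _ hx => simp only [map_smul, smul_mul_assoc, hx, smul_zero]
  | mem x hx =>
    obtain ⟨l, hl, hj, rfl⟩ := hx
    induction hy using Submodule.span_induction with
    | zero => simp
    | add x y _ _ hx hy => simp only [map_add, mul_add, hx, hy, add_zero]
    | smul r x _ hx => simp only [map_smul, mul_smul_comm, hx, smul_zero]
    | mem y hy =>
      obtain ⟨m, hm, hj', rfl⟩ := hy
      have hps := ht.1.1.trans hts
      have hqs := ht.1.2.trans hts
      rw [osTo_mon (Or.inl hps) hl, osTo_mon (Or.inl hqs) hm, ← osMon_append]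
      have hlm : ∀ a ∈ l ++ m, IsAtom a ∧ a ≤ s := by
        intro a ha
        rcases List.mem_append.1 ha with ha | ha
        · exact ⟨(hl a ha).1, (hl a ha).2.trans hps⟩
        · exact ⟨(hm a ha).1, (hm a ha).2.trans hqs⟩
      obtain ⟨j, hjj⟩ := exists_joinIn _ (fun a ha => (hlm a ha).2)
      refine osMon_eq_zero hlm hjj ?_
      have h1 : j ≤ t := hjj.2 ⟨hts, fun a ha => by
        rcases List.mem_append.1 ha with ha | ha
        · exact (hl a ha).2.trans ht.1.1
        · exact (hm a ha).2.trans ht.1.2⟩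
      have h2 := rk_le h1
      have h3 := rk_join_le_length _ hl hj
      have h4 := rk_join_le_length _ hm hj'
      rw [List.length_append]
      omega

theorem osTo_mul_mem_top {p q s : P} (hs : s ∈ joins p q) {x : OS R p} (hx : x ∈ top R p)
    {y : OS R q} (hy : y ∈ top R q) : osTo R p s x * osTo R q s y ∈ top R s := by
  induction hx using Submodule.span_induction with
  | zero => simp
  | add x y _ _ hx hy => simp only [map_add, add_mul]; exact add_mem hx hy
  | smul r x _ hx => simp only [map_smul, smul_mul_assoc]; exact Submodule.smul_mem _ _ hx
  | mem x hx =>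
    obtain ⟨l, hl, hj, rfl⟩ := hx
    induction hy using Submodule.span_induction with
    | zero => simp
    | add x y _ _ hx hy => simp only [map_add, mul_add]; exact add_mem hx hy
    | smul r x _ hx => simp only [map_smul, mul_smul_comm]; exact Submodule.smul_mem _ _ hx
    | mem y hy =>
      obtain ⟨m, hm, hj', rfl⟩ := hy
      rw [osTo_mon (Or.inl hs.1.1) hl, osTo_mon (Or.inl hs.1.2) hm, ← osMon_append]
      refine Submodule.subset_span ⟨l ++ m, ?_, ⟨⟨le_rfl, ?_⟩, ?_⟩, rfl⟩
      · intro a ha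
        rcases List.mem_append.1 ha with ha | ha
        · exact ⟨(hl a ha).1, (hl a ha).2.trans hs.1.1⟩
        · exact ⟨(hm a ha).1, (hm a ha).2.trans hs.1.2⟩
      · intro a ha
        rcases List.mem_append.1 ha with ha | ha
        · exact (hl a ha).2.trans hs.1.1
        · exact (hm a ha).2.trans hs.1.2
      · rintro u ⟨hu, hu'⟩
        refine hs.2 ⟨(hj.mono hs.1.1).2 ⟨hu, fun a ha => hu' a (List.mem_append_left _ ha)⟩,
          (hj'.mono hs.1.2).2 ⟨hu, fun a ha => hu' a (List.mem_append_right _ ha)⟩⟩ hu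

theorem osTo_bdry_mem_top {p q : P} (h : q ⋖ p) {x : OS R p} (hx : x ∈ top R p) :
    osTo R p q (osBdry R p x) ∈ top R q := by
  have := Submodule.mem_map_of_mem (f := osTo R p q) (osBdry_mem_of_mem_top hx)
  rw [Submodule.map_span] at this
  refine Submodule.span_le.2 ?_ this
  rintro _ ⟨_, ⟨t, ht, l, hl, hj, rfl⟩, rfl⟩
  rw [osTo_mon (Or.inr h.le) (fun a ha => ⟨(hl a ha).1, (hl a ha).2.trans ht.le⟩)]
  by_cases htq : t ≤ q
  · obtain rfl : t = q := by
      rcases htq.eq_or_lt with h' | h'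
      · exact h'
      · exact absurd h.lt (ht.2 h')
    exact Submodule.subset_span ⟨l, hl, hj, rfl⟩
  · rw [osMon_eq_zero_of_not_le hj ht.le h.le htq]
    exact zero_mem _

theorem osTo_bdry_eq_zero {p q : P} (h : q < p) (h' : ¬ q ⋖ p) {x : OS R p} (hx : x ∈ top R p) :
    osTo R p q (osBdry R p x) = 0 := by
  have := Submodule.mem_map_of_mem (f := osTo R p q) (osBdry_mem_of_mem_top hx)
  rw [Submodule.map_span] at this
  refine (Submodule.mem_bot R).1 (Submodule.span_le.2 ?_ this)
  rintro _ ⟨_, ⟨t, ht, l, hl, hj, rfl⟩, rfl⟩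
  rw [osTo_mon (Or.inr h.le) (fun a ha => ⟨(hl a ha).1, (hl a ha).2.trans ht.le⟩)]
  refine osMon_eq_zero_of_not_le hj ht.le h.le (fun htq => ?_)
  rcases htq.eq_or_lt with rfl | h2
  · exact h' ht
  · exact absurd h (ht.2 h2)

variable (R) in
open Classical in
/-- For `s ∈ p ∨ q`, the product `A*([⊥,p])_p × A*([⊥,q])_q → A*([⊥,s])_s`, `(x, y) ↦ i_s x · i_s y`
(and zero if `s` is not a minimal upper bound of `p` and `q`). -/
def topMul (p q s : P) : top R p →ₗ[R] top R q →ₗ[R] top R s :=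
  if h : s ∈ joins p q then
    LinearMap.mk₂ R (fun x y => ⟨osTo R p s x * osTo R q s y, osTo_mul_mem_top h x.2 y.2⟩)
      (fun _ _ _ => Subtype.ext (by simp [add_mul])) (fun _ _ _ => Subtype.ext (by simp))
      (fun _ _ _ => Subtype.ext (by simp [mul_add])) (fun _ _ _ => Subtype.ext (by simp))
  else 0

variable (R) in
open Classical in
/-- The component `A*([⊥,p])_p → A*([⊥,q])_q` of the derivation `∂` for `q` covered by `p` (zero
otherwise); see `osBdry_eq_sum`. -/
def topBdry (p q : P) : top R p →ₗ[R] top R q :=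
  if h : q ⋖ p then (osTo R p q ∘ₗ osBdry R p).restrict (fun _ hx => osTo_bdry_mem_top h hx) else 0

theorem topMul_coe {p q s : P} (h : s ∈ joins p q) (x : top R p) (y : top R q) :
    (topMul R p q s x y : OS R s) = osTo R p s x * osTo R q s y := by
  simp [topMul, h]

theorem topMul_of_notMem {p q s : P} (h : s ∉ joins p q) : topMul R p q s = 0 := by
  simp [topMul, h]

theorem topBdry_of_not {p q : P} (h : ¬ q ⋖ p) : topBdry R p q = 0 := by simp [topBdry, h]

theorem topBdry_coe {p q : P} (h : q < p) (x : top R p) :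
    (topBdry R p q x : OS R q) = osTo R p q (osBdry R p x) := by
  by_cases h' : q ⋖ p
  · simp [topBdry, h', LinearMap.restrict_apply]
  · simp [topBdry, h', osTo_bdry_eq_zero h h' x.2]

/-- `∂ x = ∑_{q <: p} x_q` with `x_q = topBdry R p q x` of order `q`. -/
theorem osBdry_eq_sum [Fintype P] {p : P} (x : top R p) :
    osBdry R p (x : OS R p) = ∑ q, osTo R q p (topBdry R p q x : OS R q) := by
  classical
  have h1 : ∀ q, osTo R q p (topBdry R p q x : OS R q) =
      (if q ⋖ p then osTo R q p ∘ₗ osTo R p q else 0) (osBdry R p (x : OS R p)) := by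
    intro q
    by_cases h : q ⋖ p
    · simp [h, topBdry_coe h.lt]
    · simp [h, topBdry_of_not]
  simp only [h1]
  have hmem := osBdry_mem_of_mem_top x.2
  generalize osBdry R p (x : OS R p) = y at hmem
  induction hmem using Submodule.span_induction with
  | zero => simp
  | add x y _ _ hx hy =>
    simp only [map_add, Finset.sum_add_distrib]
    rw [← hx, ← hy]
  | smul r x _ hx =>
    simp only [map_smul, ← Finset.smul_sum]
    rw [← hx]
  | mem x hx =>
    obtain ⟨t, ht, l, hl, hj, rfl⟩ := hx
    have hlp : ∀ a ∈ l, IsAtom a ∧ a ≤ p := fun a ha => ⟨(hl a ha).1, (hl a ha).2.trans ht.le⟩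
    rw [Finset.sum_eq_single t]
    · rw [if_pos ht, LinearMap.comp_apply, osTo_mon (Or.inr ht.le) hlp, osTo_mon (Or.inl ht.le) hl]
    · intro q _ hqt
      by_cases hq : q ⋖ p
      · rw [if_pos hq, LinearMap.comp_apply, osTo_mon (Or.inr hq.le) hlp,
          osMon_eq_zero_of_not_le hj ht.le hq.le, map_zero]
        intro h
        rcases h.eq_or_lt with rfl | h
        · exact hqt rfl
        · exact ht.2 h hq.lt
      · simp [hq]
    · simp

theorem topBdry_topBdry [Fintype P] (p t : P) (x : top R p) :
    ∑ q, topBdry R q t (topBdry R p q x) = 0 := by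
  by_cases hc : rk t + 2 = rk p ∧ t ≤ p
  swap
  · refine Finset.sum_eq_zero fun q _ => ?_
    by_cases h1 : q ⋖ p
    · by_cases h2 : t ⋖ q
      · exact absurd ⟨by rw [rk_covBy h1, rk_covBy h2], h2.le.trans h1.le⟩ hc
      · simp [topBdry_of_not h2]
    · simp [topBdry_of_not h1]
  obtain ⟨hr, htp⟩ := hc
  apply Subtype.ext
  have h0 := congrArg (osTo R p t) (osBdry_osBdry p (x : OS R p))
  rw [map_zero, osBdry_eq_sum, map_sum, map_sum] at h0
  rw [Submodule.coe_sum, ZeroMemClass.coe_zero, ← h0]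
  refine Finset.sum_congr rfl fun q _ => ?_
  by_cases hq : q ⋖ p
  swap
  · simp [topBdry_of_not hq]
  rw [osBdry_osTo hq.le (topBdry R p q x).2, osBdry_eq_sum, map_sum, map_sum, Finset.sum_eq_single t]
  · by_cases htq : t ⋖ q
    · rw [osTo_osTo_up htq.le hq.le (topBdry R q t (topBdry R p q x)).2, osTo_osTo htp htp (topBdry R q t (topBdry R p q x)).2 le_rfl,
        osTo_self (topBdry R q t (topBdry R p q x)).2]
    · simp [topBdry_of_not htq]
  · intro u _ hut
    by_cases huq : u ⋖ q
    · rw [osTo_osTo_up huq.le hq.le (topBdry R q u (topBdry R p q x)).2, osTo_osTo_zero (huq.le.trans hq.le) htp (topBdry R q u (topBdry R p q x)).2]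
      intro hle
      refine hut (eq_of_le_of_rk_le hle ?_)
      have := rk_covBy hq
      have := rk_covBy huq
      omega
    · simp [topBdry_of_not huq]
  · simp

theorem topMul_coe_eq {a b k t : P} (htk : t ≤ k) (x : top R a) (y : top R b) (hak : a ≤ k)
    (hbk : b ≤ k) (hr : rk t ≤ rk a + rk b) : (topMul R a b t x y : OS R t) =
      osTo R k t (osTo R a k (x : OS R a) * osTo R b k (y : OS R b)) := by
  rw [osTo_mul (Or.inr htk)]
  by_cases hat : a ≤ t
  · by_cases hbt : b ≤ t
    · rw [osTo_osTo hak htk x.2 hat, osTo_osTo hbk htk y.2 hbt]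
      by_cases hj : t ∈ joins a b
      · rw [topMul_coe hj]
      · rw [topMul_of_notMem hj]
        obtain ⟨s, hs, hst, -⟩ := exists_joins_le hat hbt
        have hlt : s < t := lt_of_le_of_ne hst (by rintro rfl; exact hj hs)
        have := rk_lt hlt
        rw [osTo_mul_eq_zero hs hst (by omega) x.2 y.2]
        simp
    · rw [osTo_osTo_zero hbk htk y.2 hbt, mul_zero, topMul_of_notMem (fun h => hbt h.1.2)]
      simp
  · rw [osTo_osTo_zero hak htk x.2 hat, zero_mul, topMul_of_notMem (fun h => hat h.1.1)]
    simp

/-- The Leibniz rule for the components of the product and of the derivation. -/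
theorem topBdry_topMul [Fintype P] {p q k t : P} (hk : k ∈ joins p q) (htk : t ≤ k)
    (x : top R p) (y : top R q) :
    topBdry R k t (topMul R p q k x y) = ∑ u, topMul R u q t (topBdry R p u x) y +
      (-1 : R) ^ rk p • ∑ v, topMul R p v t x (topBdry R q v y) := by
  have hkr := rk_joins_le hk
  by_cases hbad : t = k ∧ rk k = rk p + rk q
  · obtain ⟨rfl, hr⟩ := hbad
    rw [topBdry_of_not (fun h => h.lt.false), Finset.sum_eq_zero, Finset.sum_eq_zero]
    · simp
    · intro v _
      by_cases hv : v ⋖ q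
      · rw [topMul_of_notMem (fun h => ?_)]
        · simp
        · have := rk_joins_le h
          have := rk_covBy hv
          omega
      · simp [topBdry_of_not hv]
    · intro v _
      by_cases hv : v ⋖ p
      · rw [topMul_of_notMem (fun h => ?_)]
        · simp
        · have := rk_joins_le h
          have := rk_covBy hv
          omega
      · simp [topBdry_of_not hv]
  have hgood : rk t + 1 ≤ rk p + rk q := by
    rcases htk.eq_or_lt with rfl | h
    · have : rk t ≠ rk p + rk q := fun h => hbad ⟨rfl, h⟩
      omega
    · have := rk_lt h
      omega
  have hpk := hk.1.1
  have hqk := hk.1.2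
  have hL : (topBdry R k t (topMul R p q k x y) : OS R t) =
      osTo R k t (osBdry R k (osTo R p k (x : OS R p) * osTo R q k (y : OS R q))) := by
    rcases htk.eq_or_lt with rfl | h
    · rw [osTo_mul_eq_zero hk le_rfl (by omega) x.2 y.2, topBdry_of_not (fun h => h.lt.false)]
      simp
    · rw [topBdry_coe h, topMul_coe hk]
  apply Subtype.ext
  rw [hL, osBdry_osTo_mul hpk x.2, osBdry_osTo hpk x.2, osBdry_osTo hqk y.2, osBdry_eq_sum,
    osBdry_eq_sum]
  simp only [Submodule.coe_add, Submodule.coe_smul, Submodule.coe_sum, map_add, map_smul, map_sum,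
    Finset.sum_mul, Finset.mul_sum]
  congr 1
  · refine Finset.sum_congr rfl fun u _ => ?_
    by_cases hu : u ⋖ p
    · rw [osTo_osTo_up hu.le hpk (topBdry R p u x).2, topMul_coe_eq htk _ _ (hu.le.trans hpk) hqk]
      have := rk_covBy hu
      omega
    · simp only [topBdry_of_not hu, LinearMap.zero_apply, map_zero, ZeroMemClass.coe_zero,
        zero_mul]
  · congr 1
    refine Finset.sum_congr rfl fun u _ => ?_
    by_cases hu : u ⋖ q
    · rw [osTo_osTo_up hu.le hqk (topBdry R q u y).2, topMul_coe_eq htk _ _ hpk (hu.le.trans hqk)]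
      have := rk_covBy hu
      omega
    · simp only [topBdry_of_not hu, LinearMap.zero_apply, map_zero, ZeroMemClass.coe_zero,
        mul_zero]

variable (R) in
/-- The homogeneous part `A*([⊥, p])_p` as a module of its own. -/
def TopMod (p : P) : Type (max u v) := top R p

instance (p : P) : AddCommGroup (TopMod R p) := inferInstanceAs (AddCommGroup (top R p))

instance (p : P) : Module R (TopMod R p) := inferInstanceAs (Module R (top R p))

variable (R) in
/-- The product `topMul`. -/
def tMul (p q s : P) : TopMod R p →ₗ[R] TopMod R q →ₗ[R] TopMod R s := topMul R p q s

variable (R) in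
/-- The component `topBdry` of the derivation. -/
def tBdry (p q : P) : TopMod R p →ₗ[R] TopMod R q := topBdry R p q

theorem tMul_of_notMem {p q s : P} (h : s ∉ joins p q) : tMul R p q s = 0 := topMul_of_notMem h

theorem tMul_of_rk {p q s : P} (h : rk s ≠ rk p + rk q) : tMul R p q s = 0 := by
  by_cases hs : s ∈ joins p q
  · refine LinearMap.ext fun x => LinearMap.ext fun y => Subtype.ext ?_
    refine (topMul_coe hs x y).trans ?_
    exact osTo_mul_eq_zero hs le_rfl (lt_of_le_of_ne (rk_joins_le hs) h) x.2 y.2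
  · exact tMul_of_notMem hs

theorem tBdry_of_not {p q : P} (h : ¬ q ⋖ p) : tBdry R p q = 0 := topBdry_of_not h

theorem tBdry_tBdry [Fintype P] (p t : P) (x : TopMod R p) :
    ∑ q, tBdry R q t (tBdry R p q x) = 0 := topBdry_topBdry p t x

theorem tBdry_tMul [Fintype P] {p q k t : P} (hk : k ∈ joins p q) (htk : t ≤ k)
    (x : TopMod R p) (y : TopMod R q) :
    tBdry R k t (tMul R p q k x y) = ∑ u, tMul R u q t (tBdry R p u x) y +
      (-1 : R) ^ rk p • ∑ v, tMul R p v t x (tBdry R q v y) := topBdry_topMul hk htk x y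

end Top

/-! ## Subquotients -/

section SubQ

variable {R : Type v} [CommRing R] {M N K : Type*} [AddCommGroup M] [Module R M]
  [AddCommGroup N] [Module R N] [AddCommGroup K] [Module R K]

/-- The subquotient `N / (D ∩ N)` of a module. -/
abbrev SubQ (N D : Submodule R M) : Type _ := ↥N ⧸ D.submoduleOf N

/-- The class of an element in a subquotient. -/
def SubQ.mk {N D : Submodule R M} (x : M) (hx : x ∈ N) : SubQ N D :=
  (D.submoduleOf N).mkQ ⟨x, hx⟩

/-- A linear map that respects numerators and denominators induces a map of subquotients. -/
def SubQ.map {N₁ D₁ : Submodule R M} {N₂ D₂ : Submodule R N} (f : M →ₗ[R] N)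
    (hN : ∀ x ∈ N₁, f x ∈ N₂) (hD : ∀ x ∈ N₁, x ∈ D₁ → f x ∈ D₂) : SubQ N₁ D₁ →ₗ[R] SubQ N₂ D₂ :=
  (D₁.submoduleOf N₁).mapQ (D₂.submoduleOf N₂) (f.restrict hN) (fun x hx => hD x.1 x.2 hx)

/-- A bilinear map that respects numerators and denominators induces a bilinear map of
subquotients. -/
def SubQ.map₂ {N₁ D₁ : Submodule R M} {N₂ D₂ : Submodule R N} {N₃ D₃ : Submodule R K}
    (B : M →ₗ[R] N →ₗ[R] K) (hN : ∀ x ∈ N₁, ∀ y ∈ N₂, B x y ∈ N₃)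
    (hD : ∀ x ∈ N₁, x ∈ D₁ → ∀ y ∈ N₂, B x y ∈ D₃)
    (hD' : ∀ x ∈ N₁, ∀ y ∈ N₂, y ∈ D₂ → B x y ∈ D₃) :
    SubQ N₁ D₁ →ₗ[R] SubQ N₂ D₂ →ₗ[R] SubQ N₃ D₃ :=
  (D₁.submoduleOf N₁).liftQ
    { toFun := fun x => (D₂.submoduleOf N₂).liftQ
        ((D₃.submoduleOf N₃).mkQ ∘ₗ (((B x.1).domRestrict N₂).codRestrict N₃
          (fun y => hN x.1 x.2 y.1 y.2)))
        (fun y hy => by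
          rw [LinearMap.mem_ker, LinearMap.comp_apply, Submodule.mkQ_apply,
            Submodule.Quotient.mk_eq_zero]
          exact hD' x.1 x.2 y.1 y.2 hy)
      map_add' := fun x x' => by
        refine Submodule.linearMap_qext _ (LinearMap.ext fun y => ?_)
        refine (congrArg ((D₃.submoduleOf N₃).mkQ) (Subtype.ext ?_)).trans (map_add _ _ _)
        exact congrArg (fun l : N →ₗ[R] K => l y.1) (map_add B x.1 x'.1)
      map_smul' := fun r x => by
        refine Submodule.linearMap_qext _ (LinearMap.ext fun y => ?_)
        refine (congrArg ((D₃.submoduleOf N₃).mkQ) (Subtype.ext ?_)).trans (map_smul _ r _)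
        exact congrArg (fun l : N →ₗ[R] K => l y.1) (map_smul B r x.1) }
    (fun x hx => by
      rw [LinearMap.mem_ker]
      refine Submodule.linearMap_qext _ (LinearMap.ext fun y => ?_)
      refine (Submodule.Quotient.mk_eq_zero _).2 ?_
      exact hD x.1 x.2 hx y.1 y.2)

theorem SubQ.map_mk {N₁ D₁ : Submodule R M} {N₂ D₂ : Submodule R N} (f : M →ₗ[R] N)
    (hN : ∀ x ∈ N₁, f x ∈ N₂) (hD : ∀ x ∈ N₁, x ∈ D₁ → f x ∈ D₂) (x : M) (hx : x ∈ N₁) :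
    SubQ.map f hN hD (SubQ.mk x hx) = SubQ.mk (f x) (hN x hx) := rfl

theorem SubQ.map₂_mk {N₁ D₁ : Submodule R M} {N₂ D₂ : Submodule R N} {N₃ D₃ : Submodule R K}
    (B : M →ₗ[R] N →ₗ[R] K) (hN : ∀ x ∈ N₁, ∀ y ∈ N₂, B x y ∈ N₃)
    (hD : ∀ x ∈ N₁, x ∈ D₁ → ∀ y ∈ N₂, B x y ∈ D₃)
    (hD' : ∀ x ∈ N₁, ∀ y ∈ N₂, y ∈ D₂ → B x y ∈ D₃) (x : M) (hx : x ∈ N₁) (y : N) (hy : y ∈ N₂) :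
    SubQ.map₂ B hN hD hD' (SubQ.mk x hx) (SubQ.mk y hy) = SubQ.mk (B x y) (hN x hx y hy) := rfl

theorem SubQ.ind {N D : Submodule R M} {motive : SubQ N D → Prop}
    (h : ∀ x (hx : x ∈ N), motive (SubQ.mk x hx)) (a : SubQ N D) : motive a := by
  obtain ⟨⟨x, hx⟩, rfl⟩ := Submodule.mkQ_surjective _ a
  exact h x hx

theorem SubQ.mk_add {N D : Submodule R M} {x y : M} (hx : x ∈ N) (hy : y ∈ N) :
    (SubQ.mk (x + y) (add_mem hx hy) : SubQ N D) = SubQ.mk x hx + SubQ.mk y hy := rfl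

theorem SubQ.mk_sum {ι : Type*} (s : Finset ι) {N D : Submodule R M} {x : ι → M}
    (hx : ∀ i, x i ∈ N) :
    (SubQ.mk (∑ i ∈ s, x i) (sum_mem fun i _ => hx i) : SubQ N D) = ∑ i ∈ s, SubQ.mk (x i) (hx i) :=
  by
    have := map_sum ((D.submoduleOf N).mkQ) (fun i => (⟨x i, hx i⟩ : N)) s
    refine Eq.trans ?_ this
    exact congrArg (D.submoduleOf N).mkQ (Subtype.ext (by simp))

theorem SubQ.mk_eq_mk {N D : Submodule R M} {x y : M} {hx : x ∈ N} {hy : y ∈ N} :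
    (SubQ.mk x hx : SubQ N D) = SubQ.mk y hy ↔ x - y ∈ D :=
  Submodule.Quotient.eq _

theorem SubQ.mk_eq_zero {N D : Submodule R M} {x : M} {hx : x ∈ N} :
    (SubQ.mk x hx : SubQ N D) = 0 ↔ x ∈ D :=
  Submodule.Quotient.mk_eq_zero _

end SubQ

/-! ## Presheaves of cochain complexes and monoidal presheaves of DGAs -/

section Presheaf

/-- A presheaf of cochain complexes on a poset `P`: for each `p` a cochain complex
`obj p = ⨁ᵢ gr p i` of `R`-modules with differential `δ`, and for `q ≤ p` a cochain map
`res : obj p → obj q`, functorially. -/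
structure CochainPresheaf (R : Type v) [CommRing R] (P : Type u) [PartialOrder P] where
  obj : P → Type w
  [addCommGroup : ∀ p, AddCommGroup (obj p)]
  [module : ∀ p, Module R (obj p)]
  gr : ∀ p, ℤ → Submodule R (obj p)
  isInternal : ∀ p, DirectSum.IsInternal (gr p)
  δ : ∀ p, obj p →ₗ[R] obj p
  δ_mem : ∀ p i c, c ∈ gr p i → δ p c ∈ gr p (i + 1)
  δ_δ : ∀ p c, δ p (δ p c) = 0
  res : ∀ {p q}, q ≤ p → obj p →ₗ[R] obj q
  res_mem : ∀ {p q} (h : q ≤ p) i c, c ∈ gr p i → res h c ∈ gr q i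
  res_δ : ∀ {p q} (h : q ≤ p) c, res h (δ p c) = δ q (res h c)
  res_self : ∀ p (c : obj p), res (le_refl p) c = c
  res_res : ∀ {p q r} (h : q ≤ p) (h' : r ≤ q) c, res h' (res h c) = res (h'.trans h) c

attribute [instance] CochainPresheaf.addCommGroup CochainPresheaf.module

open Classical in
/-- The presheaf map `C_p → C_q` if `q ≤ p`, and zero otherwise. -/
def CochainPresheaf.resTo {R : Type v} [CommRing R] {P : Type u} [PartialOrder P]
    (C : CochainPresheaf.{u, v, w} R P) (p q : P) : C.obj p →ₗ[R] C.obj q :=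
  if h : q ≤ p then C.res h else 0

/-- A monoidal presheaf of DGAs on a finite poset. The bilinear product on `⨁ₚ obj p` is given by
its components `mul p q s : obj p × obj q → obj s`; the condition `C_p · C_q ⊆ ⨁_{s ∈ p ∨ q} C_s`
says that the component at `s` vanishes unless `s` is a minimal upper bound of `p` and `q`. The
product is associative, additive in degrees, satisfies the Leibniz rule, and is compatible with the
presheaf maps: for `q ≤ p`, `f_{p,q}(a) · b` is the image of `a · b` under the map
`⨁_{k ∈ p ∨ s} C_k → ⨁_{t ∈ q ∨ s} C_t` that sends `C_k` to `C_t` for the unique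
`t ∈ q ∨ s` with `t ≤ k`; similarly on the other side. -/
structure MonoidalDGAPresheaf (R : Type v) [CommRing R] (P : Type u) [PartialOrder P] [Fintype P]
    extends CochainPresheaf.{u, v, w} R P where
  mul : ∀ p q s, obj p →ₗ[R] obj q →ₗ[R] obj s
  mul_eq_zero : ∀ p q s, s ∉ joins p q → ∀ a b, mul p q s a b = 0
  mul_mem : ∀ p q s i j a b, a ∈ gr p i → b ∈ gr q j → mul p q s a b ∈ gr s (i + j)
  mul_assoc : ∀ p q r t (a : obj p) (b : obj q) (c : obj r),
    ∑ s, mul s r t (mul p q s a b) c = ∑ s, mul p s t a (mul q r s b c)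
  leibniz : ∀ p q s i (a : obj p) (b : obj q), a ∈ gr p i →
    δ s (mul p q s a b) = mul p q s (δ p a) b + (i.negOnePow : ℤ) • mul p q s a (δ q b)
  res_mul : ∀ {p q} (h : q ≤ p) s t, t ∈ joins q s → ∀ (a : obj p) (b : obj s),
    mul q s t (res h a) b = ∑ k, toCochainPresheaf.resTo k t (mul p s k a b)
  mul_res : ∀ {p q} (h : q ≤ p) s t, t ∈ joins s q → ∀ (a : obj p) (b : obj s),
    mul s q t b (res h a) = ∑ k, toCochainPresheaf.resTo k t (mul s p k b a)


namespace CochainPresheaf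

variable {R : Type v} [CommRing R] {P : Type u} [PartialOrder P] (C : CochainPresheaf.{u, v, w} R P)

theorem resTo_of_le {p q : P} (h : q ≤ p) : C.resTo p q = C.res h := by simp [resTo, h]

theorem resTo_of_not {p q : P} (h : ¬ q ≤ p) : C.resTo p q = 0 := by simp [resTo, h]

theorem resTo_δ (p q : P) (c : C.obj p) : C.resTo p q (C.δ p c) = C.δ q (C.resTo p q c) := by
  by_cases h : q ≤ p
  · simp [C.resTo_of_le h, C.res_δ]
  · simp [C.resTo_of_not h]

theorem resTo_mem (p q : P) {i : ℤ} {c : C.obj p} (hc : c ∈ C.gr p i) :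
    C.resTo p q c ∈ C.gr q i := by
  by_cases h : q ≤ p
  · rw [C.resTo_of_le h]; exact C.res_mem h i c hc
  · simp [C.resTo_of_not h]

/-- The sign operator `c ↦ (-1)^(deg c) c`. -/
def sgn (p : P) : C.obj p →ₗ[R] C.obj p :=
  DirectSum.toModule R ℤ (C.obj p) (fun i => (i.negOnePow : ℤ) • (C.gr p i).subtype) ∘ₗ
    (LinearEquiv.ofBijective (DirectSum.coeLinearMap (C.gr p)) (C.isInternal p)).symm.toLinearMap

theorem sgn_of_mem {p : P} {i : ℤ} {c : C.obj p} (hc : c ∈ C.gr p i) :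
    C.sgn p c = (i.negOnePow : ℤ) • c := by
  have h : (LinearEquiv.ofBijective (DirectSum.coeLinearMap (C.gr p)) (C.isInternal p)).symm c =
      DirectSum.lof R ℤ (fun i => C.gr p i) i ⟨c, hc⟩ := by
    apply (LinearEquiv.ofBijective (DirectSum.coeLinearMap (C.gr p)) (C.isInternal p)).injective
    rw [LinearEquiv.apply_symm_apply]
    exact (DirectSum.coeLinearMap_lof (C.gr p) i ⟨c, hc⟩).symm
  rw [sgn, LinearMap.comp_apply, LinearEquiv.coe_coe, h, DirectSum.toModule_lof]
  rfl

theorem iSup_gr (p : P) : ⨆ i, C.gr p i = ⊤ := (C.isInternal p).submodule_iSup_eq_top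

@[elab_as_elim]
theorem gr_induction {p : P} {motive : C.obj p → Prop} (c : C.obj p)
    (mem : ∀ i, ∀ c ∈ C.gr p i, motive c) (zero : motive 0)
    (add : ∀ c c', motive c → motive c' → motive (c + c')) : motive c := by
  have hc : c ∈ ⨆ i, C.gr p i := by rw [C.iSup_gr]; trivial
  exact Submodule.iSup_induction (C.gr p) (motive := motive) hc mem zero add

theorem sgn_sgn (p : P) (c : C.obj p) : C.sgn p (C.sgn p c) = c := by
  refine C.gr_induction c (fun i c hc => ?_) (by simp) (fun c c' h h' => by simp [h, h'])
  rw [C.sgn_of_mem hc, map_zsmul, C.sgn_of_mem hc, smul_smul, ← Units.val_mul, ← Int.negOnePow_add,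
    Int.negOnePow_even _ ⟨i, rfl⟩]
  simp

theorem sgn_δ (p : P) (c : C.obj p) : C.sgn p (C.δ p c) = - C.δ p (C.sgn p c) := by
  refine C.gr_induction c (fun i c hc => ?_) (by simp) (fun c c' h h' => by simp [h, h', add_comm])
  rw [C.sgn_of_mem hc, C.sgn_of_mem (C.δ_mem p i c hc), Int.negOnePow_succ]
  simp

theorem sgn_resTo (p q : P) (c : C.obj p) : C.sgn q (C.resTo p q c) = C.resTo p q (C.sgn p c) := by
  refine C.gr_induction c (fun i c hc => ?_) (by simp) (fun c c' h h' => by simp [h, h'])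
  rw [C.sgn_of_mem hc, C.sgn_of_mem (C.resTo_mem p q hc), map_zsmul]

theorem sgn_mem {p : P} {i : ℤ} {c : C.obj p} (hc : c ∈ C.gr p i) : C.sgn p c ∈ C.gr p i := by
  rw [C.sgn_of_mem hc]
  exact zsmul_mem hc _

end CochainPresheaf

namespace MonoidalDGAPresheaf

variable {R : Type v} [CommRing R] {P : Type u} [PartialOrder P] [Fintype P]
  (C : MonoidalDGAPresheaf.{u, v, w} R P)

theorem δ_mul (p q s : P) (a : C.obj p) (b : C.obj q) : C.δ s (C.mul p q s a b) =
    C.mul p q s (C.δ p a) b + C.mul p q s (C.sgn p a) (C.δ q b) := by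
  refine C.gr_induction a (fun i c hc => ?_) (by simp) (fun c c' h h' => ?_)
  · rw [C.leibniz p q s i c b hc, C.sgn_of_mem hc, map_zsmul, LinearMap.smul_apply]
  · simp only [map_add, LinearMap.add_apply, h, h']
    abel

theorem resTo_mul {p q : P} (h : q ≤ p) {s t : P} (ht : t ∈ joins q s) (a : C.obj p) (b : C.obj s) :
    C.mul q s t (C.resTo p q a) b = ∑ k, C.resTo k t (C.mul p s k a b) := by
  rw [C.resTo_of_le h, C.res_mul h s t ht]

theorem mul_resTo {p q : P} (h : q ≤ p) {s t : P} (ht : t ∈ joins s q) (a : C.obj p) (b : C.obj s) :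
    C.mul s q t b (C.resTo p q a) = ∑ k, C.resTo k t (C.mul s p k b a) := by
  rw [C.resTo_of_le h, C.mul_res h s t ht]

theorem sum_Ici (p₀ : P) [Fintype (Set.Ici p₀)] {M : Type*} [AddCommMonoid M] (f : P → M)
    (hf : ∀ s, ¬ p₀ ≤ s → f s = 0) : ∑ s, f s = ∑ s : Set.Ici p₀, f s := by
  have h1 : ∑ s : Set.Ici p₀, f s =
      ∑ s ∈ Finset.univ.map (Function.Embedding.subtype (· ∈ Set.Ici p₀)), f s := by
    rw [Finset.sum_map]; rfl
  rw [h1]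
  refine (Finset.sum_subset (Finset.subset_univ _) fun s _ hs => hf s fun hle => hs ?_).symm
  exact Finset.mem_map.2 ⟨⟨s, hle⟩, Finset.mem_univ _, rfl⟩

/-- The restriction of a monoidal presheaf of DGAs to `[p, ∞)`. -/
def restrict (p₀ : P) [Fintype (Set.Ici p₀)] : MonoidalDGAPresheaf.{u, v, w} R (Set.Ici p₀) where
  obj p := C.obj p
  gr p := C.gr p
  isInternal p := C.isInternal p
  δ p := C.δ p
  δ_mem p := C.δ_mem p
  δ_δ p := C.δ_δ p
  res h := C.res h
  res_mem h := C.res_mem h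
  res_δ h := C.res_δ h
  res_self p := C.res_self p
  res_res h h' := C.res_res h h'
  mul p q s := C.mul p q s
  mul_eq_zero p q s hs := C.mul_eq_zero p q s (fun h => hs ⟨h.1, fun _ hu hus => h.2 hu hus⟩)
  mul_mem p q s := C.mul_mem p q s
  mul_assoc p q r t a b c := by
    have h := C.mul_assoc p q r t a b c
    rw [sum_Ici p₀, sum_Ici p₀] at h
    · exact h
    · intro s hs
      rw [C.mul_eq_zero q r s (fun h' => hs (le_trans q.2 h'.1.1)), map_zero]
    · intro s hs
      rw [C.mul_eq_zero p q s (fun h' => hs (le_trans p.2 h'.1.1)), map_zero, LinearMap.zero_apply]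
  leibniz p q s := C.leibniz p q s
  res_mul {p q} h s t ht a b := by
    have h1 := C.res_mul h s t ⟨ht.1, fun u hu hut => ht.2 (y := ⟨u, le_trans q.2 hu.1⟩) hu hut⟩ a b
    rw [sum_Ici p₀] at h1
    · exact h1
    · intro k hk
      rw [C.mul_eq_zero p s k (fun h' => hk (le_trans p.2 h'.1.1)), map_zero]
  mul_res {p q} h s t ht a b := by
    have h1 := C.mul_res h s t ⟨ht.1, fun u hu hut => ht.2 (y := ⟨u, le_trans q.2 hu.2⟩) hu hut⟩ a b
    rw [sum_Ici p₀] at h1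
    · exact h1
    · intro k hk
      rw [C.mul_eq_zero s p k (fun h' => hk (le_trans p.2 h'.1.2)), map_zero]

/-- The cohomology `H^*(C_p)` of the cochain complex `C_p`. -/
abbrev coh (C : CochainPresheaf.{u, v, w} R P) (p : P) : Type w :=
  SubQ (LinearMap.ker (C.δ p)) (LinearMap.range (C.δ p))

/-- The part `H^i(C_p)` of degree `i`: the classes of the cocycles of degree `i`. -/
def cohGr (C : CochainPresheaf.{u, v, w} R P) (p : P) (i : ℤ) : Submodule R (coh C p) :=
  ((C.gr p i).submoduleOf (LinearMap.ker (C.δ p))).map (Submodule.mkQ _)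

theorem mem_cohGr {p : P} {i : ℤ} {α : coh C.toCochainPresheaf p} :
    α ∈ cohGr C.toCochainPresheaf p i ↔ ∃ c, ∃ hc : c ∈ LinearMap.ker (C.δ p), c ∈ C.gr p i ∧
      SubQ.mk c hc = α := by
  constructor
  · rintro ⟨⟨c, hc⟩, hci, rfl⟩
    exact ⟨c, hc, hci, rfl⟩
  · rintro ⟨c, hc, hci, rfl⟩
    exact ⟨⟨c, hc⟩, hci, rfl⟩

/-- The map induced by a presheaf map on cohomology. -/
def cohRes (C : CochainPresheaf.{u, v, w} R P) {p q : P} (h : q ≤ p) : coh C p →ₗ[R] coh C q :=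
  SubQ.map (C.res h)
    (fun c hc => by
      rw [LinearMap.mem_ker] at hc ⊢
      rw [← C.res_δ, hc, map_zero])
    (fun c _ hc => by
      obtain ⟨b, rfl⟩ := hc
      exact ⟨C.res h b, (C.res_δ h b).symm⟩)

theorem mul_mem_ker {p q s : P} {a : C.obj p} (ha : a ∈ LinearMap.ker (C.δ p)) {b : C.obj q}
    (hb : b ∈ LinearMap.ker (C.δ q)) : C.mul p q s a b ∈ LinearMap.ker (C.δ s) := by
  rw [LinearMap.mem_ker] at ha hb ⊢
  rw [C.δ_mul, ha, hb]
  simp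

theorem resTo_mem_ker {p q : P} {c : C.obj p} (hc : c ∈ LinearMap.ker (C.δ p)) :
    C.resTo p q c ∈ LinearMap.ker (C.δ q) := by
  rw [LinearMap.mem_ker] at hc ⊢
  rw [← C.resTo_δ, hc, map_zero]

/-- The products induced on cohomology. -/
def cohMul (p q s : P) : coh C.toCochainPresheaf p →ₗ[R] coh C.toCochainPresheaf q →ₗ[R]
    coh C.toCochainPresheaf s :=
  SubQ.map₂ (C.mul p q s)
    (fun a ha b hb => C.mul_mem_ker ha hb)
    (fun a _ ha b hb => by
      obtain ⟨c, rfl⟩ := ha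
      rw [LinearMap.mem_ker] at hb
      exact ⟨C.mul p q s c b, by rw [C.δ_mul, hb, map_zero, add_zero]⟩)
    (fun a ha b _ hb => by
      obtain ⟨c, rfl⟩ := hb
      rw [LinearMap.mem_ker] at ha
      refine ⟨C.mul p q s (C.sgn p a) c, ?_⟩
      have h0 : C.δ p (C.sgn p a) = 0 := by
        rw [← neg_eq_zero, ← C.sgn_δ, ha, map_zero]
      rw [C.δ_mul, h0, C.sgn_sgn]
      simp)

theorem cohGr_isInternal (p : P) : DirectSum.IsInternal (cohGr C.toCochainPresheaf p) := by
  classical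
  -- the homogeneous components of a cocycle are cocycles
  let e := (LinearEquiv.ofBijective (DirectSum.coeLinearMap (C.gr p)) (C.isInternal p)).symm
  let pr : ℤ → C.obj p →ₗ[R] C.obj p := fun i =>
    (C.gr p i).subtype ∘ₗ DirectSum.component R ℤ (fun i => C.gr p i) i ∘ₗ e.toLinearMap
  have he : ∀ i c (hc : c ∈ C.gr p i), e c = DirectSum.lof R ℤ (fun i => C.gr p i) i ⟨c, hc⟩ := by
    intro i c hc
    apply e.symm.injective
    rw [LinearEquiv.symm_apply_apply]
    exact (DirectSum.coeLinearMap_lof (C.gr p) i ⟨c, hc⟩).symm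
  have pr_self : ∀ i c, c ∈ C.gr p i → pr i c = c := by
    intro i c hc
    simp only [pr, LinearMap.comp_apply, LinearEquiv.coe_coe, he i c hc, DirectSum.component.lof_self,
      Submodule.subtype_apply]
  have pr_ne : ∀ i j c, c ∈ C.gr p j → i ≠ j → pr i c = 0 := by
    intro i j c hc hij
    simp only [pr, LinearMap.comp_apply, LinearEquiv.coe_coe, he j c hc, DirectSum.component.of,
      dif_neg hij.symm, map_zero]
  have pr_mem : ∀ i c, pr i c ∈ C.gr p i := fun i c => Subtype.prop _
  have pr_δ : ∀ i c, pr (i + 1) (C.δ p c) = C.δ p (pr i c) := by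
    intro i c
    refine C.gr_induction c (fun j c hc => ?_) (by simp) (fun c c' h h' => by simp [h, h'])
    by_cases hij : i = j
    · subst hij
      rw [pr_self _ _ hc, pr_self _ _ (C.δ_mem p i c hc)]
    · rw [pr_ne _ _ _ hc hij, pr_ne _ _ _ (C.δ_mem p j c hc) (by omega), map_zero]
  have pr_ker : ∀ i, ∀ c ∈ LinearMap.ker (C.δ p), pr i c ∈ LinearMap.ker (C.δ p) := by
    intro i c hc
    rw [LinearMap.mem_ker] at hc ⊢
    rw [← pr_δ, hc, map_zero]
  have pr_range : ∀ i, ∀ c ∈ LinearMap.ker (C.δ p), c ∈ LinearMap.range (C.δ p) →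
      pr i c ∈ LinearMap.range (C.δ p) := by
    rintro i _ - ⟨b, rfl⟩
    refine ⟨pr (i - 1) b, ?_⟩
    rw [← pr_δ, sub_add_cancel]
  let Pr : ℤ → coh C.toCochainPresheaf p →ₗ[R] coh C.toCochainPresheaf p := fun i =>
    SubQ.map (pr i) (pr_ker i) (pr_range i)
  rw [DirectSum.isInternal_submodule_iff_iSupIndep_and_iSup_eq_top]
  constructor
  · intro i
    rw [Submodule.disjoint_def]
    intro α hα hα'
    have h1 : Pr i α = α := by
      obtain ⟨c, hc, hci, rfl⟩ := C.mem_cohGr.1 hα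
      have h3 : pr i c - c ∈ LinearMap.range (C.δ p) := by
        rw [pr_self i c hci, sub_self]; exact zero_mem _
      exact SubQ.mk_eq_mk.2 h3
    have h2 : (⨆ j, ⨆ (_ : j ≠ i), cohGr C.toCochainPresheaf p j) ≤ LinearMap.ker (Pr i) := by
      refine iSup₂_le fun j hj α hα => ?_
      obtain ⟨c, hc, hci, rfl⟩ := C.mem_cohGr.1 hα
      have h3 : pr i c ∈ LinearMap.range (C.δ p) := by
        rw [pr_ne i j c hci hj.symm]; exact zero_mem _
      exact SubQ.mk_eq_zero.2 h3
    rw [← h1]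
    exact h2 hα'
  · rw [eq_top_iff]
    rintro α -
    induction α using SubQ.ind with
    | h c hc =>
      have hsum : c = ∑ i ∈ (e c).support, pr i c := by
        have := DirectSum.sum_support_of (e c)
        have h3 := congrArg e.symm this
        rw [LinearEquiv.symm_apply_apply, map_sum] at h3
        rw [← h3]
        refine Finset.sum_congr ?_ fun i _ => ?_
        · rw [h3]
        · rw [h3]
          exact DirectSum.coeLinearMap_lof (C.gr p) i _
      have h4 : (SubQ.mk c hc : coh C.toCochainPresheaf p) =
          ∑ i ∈ (e c).support, SubQ.mk (pr i c) (pr_ker i c hc) := by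
        rw [← SubQ.mk_sum (e c).support (fun i => pr_ker i c hc), SubQ.mk_eq_mk, ← hsum, sub_self]
        exact zero_mem _
      rw [h4]
      refine sum_mem fun i _ => ?_
      exact Submodule.mem_iSup_of_mem i (C.mem_cohGr.2 ⟨_, _, pr_mem i c, rfl⟩)

/-- The presheaf of cochain complexes `p ↦ H^*(C_p)` with zero differential. -/
def cohPresheaf : CochainPresheaf.{u, v, w} R P where
  obj := coh C.toCochainPresheaf
  gr := cohGr C.toCochainPresheaf
  isInternal := C.cohGr_isInternal
  δ _ := 0
  δ_mem _ _ _ _ := zero_mem _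
  δ_δ _ _ := rfl
  res h := cohRes C.toCochainPresheaf h
  res_mem {p q} h i α hα := by
    obtain ⟨c, hc, hci, rfl⟩ := C.mem_cohGr.1 hα
    exact C.mem_cohGr.2 ⟨C.res h c, _, C.res_mem h i c hci, rfl⟩
  res_δ h α := map_zero _
  res_self p α := by
    induction α using SubQ.ind with
    | h c hc =>
      have h3 : C.res (le_refl p) c - c ∈ LinearMap.range (C.δ p) := by
        rw [C.res_self, sub_self]; exact zero_mem _
      exact SubQ.mk_eq_mk.2 h3
  res_res {p q r} h h' α := by
    induction α using SubQ.ind with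
    | h c hc =>
      have h3 : C.res h' (C.res h c) - C.res (h'.trans h) c ∈ LinearMap.range (C.δ r) := by
        rw [C.res_res, sub_self]; exact zero_mem _
      exact SubQ.mk_eq_mk.2 h3

theorem cohPresheaf_resTo (p q : P) (c : C.obj p) (hc : c ∈ LinearMap.ker (C.δ p)) :
    C.cohPresheaf.resTo p q (SubQ.mk c hc) = SubQ.mk (C.resTo p q c) (C.resTo_mem_ker hc) := by
  by_cases h : q ≤ p
  · simp only [C.cohPresheaf.resTo_of_le h, C.resTo_of_le h]
    rfl
  · simp only [C.cohPresheaf.resTo_of_not h, C.resTo_of_not h]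
    exact (SubQ.mk_eq_zero.2 (zero_mem _)).symm

/-- The cohomology presheaf `p ↦ H^*(C_p)` of a monoidal presheaf of DGAs, with the induced
products and zero differential. -/
def cohomology : MonoidalDGAPresheaf.{u, v, w} R P where
  toCochainPresheaf := C.cohPresheaf
  mul p q s := C.cohMul p q s
  mul_eq_zero p q s hs α β := by
    induction α using SubQ.ind with
    | h a ha =>
      induction β using SubQ.ind with
      | h b hb =>
        have h3 : C.mul p q s a b ∈ LinearMap.range (C.δ s) := by
          rw [C.mul_eq_zero p q s hs]; exact zero_mem _
        exact SubQ.mk_eq_zero.2 h3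
  mul_mem p q s i j α β hα hβ := by
    obtain ⟨a, ha, hai, rfl⟩ := C.mem_cohGr.1 hα
    obtain ⟨b, hb, hbi, rfl⟩ := C.mem_cohGr.1 hβ
    exact C.mem_cohGr.2 ⟨_, _, C.mul_mem p q s i j a b hai hbi, rfl⟩
  mul_assoc p q r t α β γ := by
    induction α using SubQ.ind with
    | h a ha =>
      induction β using SubQ.ind with
      | h b hb =>
        induction γ using SubQ.ind with
        | h c hc =>
          refine (SubQ.mk_sum Finset.univ (x := fun s => C.mul s r t (C.mul p q s a b) c)
            (fun s => C.mul_mem_ker (C.mul_mem_ker ha hb) hc)).symm.trans (Eq.trans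
            (SubQ.mk_eq_mk.2 ?_) (SubQ.mk_sum Finset.univ
              (x := fun s => C.mul p s t a (C.mul q r s b c))
              (fun s => C.mul_mem_ker ha (C.mul_mem_ker hb hc))))
          rw [C.mul_assoc, sub_self]
          exact zero_mem _
  leibniz p q s i α β _ := by
    have h1 : C.cohMul p q s 0 β = 0 := by rw [map_zero]; rfl
    have h2 : C.cohMul p q s α 0 = 0 := map_zero _
    change (0 : coh C.toCochainPresheaf s) = C.cohMul p q s 0 β +
      (i.negOnePow : ℤ) • C.cohMul p q s α 0
    rw [h1, h2, smul_zero, add_zero]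
  res_mul {p q} h s t ht α β := by
    induction α using SubQ.ind with
    | h a ha =>
      induction β using SubQ.ind with
      | h b hb =>
        have h3 : C.mul q s t (C.res h a) b - ∑ k, C.resTo k t (C.mul p s k a b) ∈
            LinearMap.range (C.δ t) := by
          rw [C.res_mul h s t ht, sub_self]; exact zero_mem _
        refine Eq.trans (SubQ.mk_eq_mk.2 h3) ((SubQ.mk_sum Finset.univ
          (fun k => C.resTo_mem_ker (C.mul_mem_ker ha hb))).trans ?_)
        exact Finset.sum_congr rfl fun k _ => (C.cohPresheaf_resTo k t _ _).symm
  mul_res {p q} h s t ht α β := by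
    induction α using SubQ.ind with
    | h a ha =>
      induction β using SubQ.ind with
      | h b hb =>
        have h3 : C.mul s q t b (C.res h a) - ∑ k, C.resTo k t (C.mul s p k b a) ∈
            LinearMap.range (C.δ t) := by
          rw [C.mul_res h s t ht, sub_self]; exact zero_mem _
        refine Eq.trans (SubQ.mk_eq_mk.2 h3) ((SubQ.mk_sum Finset.univ
          (fun k => C.resTo_mem_ker (C.mul_mem_ker hb ha))).trans ?_)
        exact Finset.sum_congr rfl fun k _ => (C.cohPresheaf_resTo k t _ _).symm

end MonoidalDGAPresheaf

end Presheaf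

/-! ## The double complex `A*(P, C)` -/

section DoubleComplex

variable {R : Type v} [CommRing R] {P : Type u} [PartialOrder P] [OrderBot P] [Fintype P]
  [LocallyGeometric P] (C : MonoidalDGAPresheaf.{u, v, w} R P)

/-- The Orlik–Solomon algebra with coefficients, `A*(P, C) = ⨁ₚ A*([⊥, p])_p ⊗ C_p` (a finite direct
sum, written as a product). -/
abbrev OSC (C : MonoidalDGAPresheaf.{u, v, w} R P) : Type (max u v w) :=
  ∀ p : P, TopMod R p ⊗[R] C.obj p

namespace OSC

set_option linter.unusedSectionVars false

/-- The component `A*_p ⊗ C_p → A*_t ⊗ C_t` of `∂`. -/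
def pdComp (p t : P) : TopMod R p ⊗[R] C.obj p →ₗ[R] TopMod R t ⊗[R] C.obj t :=
  TensorProduct.map (tBdry R p t) (C.resTo p t)

/-- The differential `∂ (x ⊗ c) = ∑ₜ x_t ⊗ f_{p,t} c`, where `∂ x = ∑ₜ x_t` with `x_t` of order `t`
and `p` covering `t`. -/
def pd : OSC C →ₗ[R] OSC C :=
  LinearMap.pi fun t => ∑ p, pdComp C p t ∘ₗ LinearMap.proj p

/-- The differential `δ (x ⊗ c) = (-1)^(r(p)) x ⊗ δ c`. -/
def dl : OSC C →ₗ[R] OSC C :=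
  LinearMap.pi fun p => ((-1 : R) ^ rk p • (C.δ p).lTensor (TopMod R p)) ∘ₗ LinearMap.proj p

/-- The sign operator of the total degree: `x ⊗ c ↦ (-1)^(deg c - r(p)) x ⊗ c`. -/
def sgnTot : OSC C →ₗ[R] OSC C :=
  LinearMap.pi fun p => ((-1 : R) ^ rk p • (C.sgn p).lTensor (TopMod R p)) ∘ₗ LinearMap.proj p

/-- The component at `s` of the product of the summands at `p` and `q`:
`(x ⊗ c₁, y ⊗ c₂) ↦ (-1)^(deg(c₁) r(q)) (i_s x · i_s y) ⊗ j_s (c₁ · c₂)`. -/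
def mulComp (p q s : P) : TopMod R p ⊗[R] C.obj p →ₗ[R] TopMod R q ⊗[R] C.obj q →ₗ[R]
    TopMod R s ⊗[R] C.obj s :=
  TensorProduct.map₂ (tMul R p q s) (C.mul p q s ∘ₗ (C.sgn p) ^ rk q)

/-- The product of `A*(P, C)`:
`(x ⊗ c₁) · (y ⊗ c₂) = (-1)^(deg(c₁) r(q)) ∑_{s ∈ p ∨ q} (i_s x · i_s y) ⊗ j_s (c₁ · c₂)`. -/
def mul : OSC C →ₗ[R] OSC C →ₗ[R] OSC C :=
  LinearMap.mk₂ R (fun f g s => ∑ p, ∑ q, mulComp C p q s (f p) (g q))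
    (fun f f' g => by
      funext s
      simp only [Pi.add_apply, map_add, LinearMap.add_apply, Finset.sum_add_distrib])
    (fun r f g => by
      funext s
      simp only [Pi.smul_apply, map_smul, LinearMap.smul_apply, Finset.smul_sum])
    (fun f g g' => by
      funext s
      simp only [Pi.add_apply, map_add, Finset.sum_add_distrib])
    (fun r f g => by
      funext s
      simp only [Pi.smul_apply, map_smul, Finset.smul_sum])

theorem pd_apply (f : OSC C) (t : P) : pd C f t = ∑ p, pdComp C p t (f p) := by
  simp [pd]

theorem dl_apply (f : OSC C) (p : P) :
    dl C f p = (-1 : R) ^ rk p • (C.δ p).lTensor (TopMod R p) (f p) := rfl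

theorem sgnTot_apply (f : OSC C) (p : P) :
    sgnTot C f p = (-1 : R) ^ rk p • (C.sgn p).lTensor (TopMod R p) (f p) := rfl

theorem mul_apply (f g : OSC C) (s : P) :
    mul C f g s = ∑ p, ∑ q, mulComp C p q s (f p) (g q) := rfl

theorem pdComp_of_not {p t : P} (h : ¬ t ⋖ p) : pdComp C p t = 0 := by
  rw [pdComp, tBdry_of_not h, TensorProduct.map_zero_left]

theorem mulComp_of_rk {p q s : P} (h : rk s ≠ rk p + rk q) : mulComp C p q s = 0 := by
  have h0 : tMul R p q s = 0 := tMul_of_rk h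
  refine TensorProduct.ext' fun x c => TensorProduct.ext' fun y b => ?_
  simp [mulComp, h0]

theorem lTensor_lTensor {p : P} (f g : C.obj p →ₗ[R] C.obj p) (X : TopMod R p ⊗[R] C.obj p) :
    f.lTensor (TopMod R p) (g.lTensor (TopMod R p) X) = (f ∘ₗ g).lTensor (TopMod R p) X := by
  rw [LinearMap.lTensor_comp]; rfl

theorem neg_one_pow_smul_smul {M : Type*} [AddCommGroup M] [Module R M] (n : ℕ) (x : M) :
    (-1 : R) ^ n • (-1 : R) ^ n • x = x := by
  rw [smul_smul, ← mul_pow]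
  simp

theorem pd_pd (f : OSC C) : pd C (pd C f) = 0 := by
  funext t
  simp only [pd_apply, map_sum, Pi.zero_apply]
  rw [Finset.sum_comm]
  refine Finset.sum_eq_zero fun p _ => ?_
  induction f p using TensorProduct.induction_on with
  | zero => simp
  | add X Y hX hY => simp only [map_add, Finset.sum_add_distrib, hX, hY, add_zero]
  | tmul x c =>
    have h1 : ∀ q, pdComp C q t (pdComp C p q (x ⊗ₜ c)) =
        tBdry R q t (tBdry R p q x) ⊗ₜ C.resTo p t c := by
      intro q
      by_cases h : t ⋖ q ∧ q ⋖ p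
      · simp only [pdComp, TensorProduct.map_tmul, C.resTo_of_le h.1.le, C.resTo_of_le h.2.le,
          C.resTo_of_le (h.1.le.trans h.2.le), C.res_res]
      · have : tBdry R q t (tBdry R p q x) = 0 := by
          rcases not_and_or.1 h with h | h
          · rw [tBdry_of_not h]; rfl
          · rw [tBdry_of_not h]; simp
        simp only [pdComp, TensorProduct.map_tmul, this, TensorProduct.zero_tmul]
    simp only [h1]
    rw [← TensorProduct.sum_tmul, tBdry_tBdry, TensorProduct.zero_tmul]

theorem dl_dl (f : OSC C) : dl C (dl C f) = 0 := by
  funext p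
  rw [dl_apply, dl_apply, map_smul, lTensor_lTensor, neg_one_pow_smul_smul]
  have : C.δ p ∘ₗ C.δ p = 0 := LinearMap.ext (C.δ_δ p)
  rw [this]
  simp

theorem sgnTot_sgnTot (f : OSC C) : sgnTot C (sgnTot C f) = f := by
  funext p
  rw [sgnTot_apply, sgnTot_apply, map_smul, lTensor_lTensor, neg_one_pow_smul_smul]
  have : C.sgn p ∘ₗ C.sgn p = LinearMap.id := LinearMap.ext (C.sgn_sgn p)
  rw [this]
  simp

theorem sgnTot_dl (f : OSC C) : sgnTot C (dl C f) = - dl C (sgnTot C f) := by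
  funext p
  rw [Pi.neg_apply, sgnTot_apply, dl_apply, dl_apply, sgnTot_apply, map_smul, map_smul,
    lTensor_lTensor, lTensor_lTensor, neg_one_pow_smul_smul, neg_one_pow_smul_smul]
  have : C.sgn p ∘ₗ C.δ p = - (C.δ p ∘ₗ C.sgn p) := LinearMap.ext (C.sgn_δ p)
  rw [this]
  simp

/-- An operator given by `(-1)^(r(p))` times a degreewise operator compatible with the presheaf
maps anticommutes with `∂`. -/
theorem pd_anticomm (φ : ∀ p, C.obj p →ₗ[R] C.obj p)
    (hφ : ∀ p t c, C.resTo p t (φ p c) = φ t (C.resTo p t c)) (f : OSC C) (t : P) :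
    ∑ p, pdComp C p t ((-1 : R) ^ rk p • (φ p).lTensor (TopMod R p) (f p)) =
      - ((-1 : R) ^ rk t • (φ t).lTensor (TopMod R t) (∑ p, pdComp C p t (f p))) := by
  rw [map_sum, Finset.smul_sum, ← Finset.sum_neg_distrib]
  refine Finset.sum_congr rfl fun p _ => ?_
  by_cases h : t ⋖ p
  · have h1 : (φ t).lTensor (TopMod R t) (pdComp C p t (f p)) =
        pdComp C p t ((φ p).lTensor (TopMod R p) (f p)) := by
      induction f p using TensorProduct.induction_on with
      | zero => simp
      | add X Y hX hY => simp only [map_add, hX, hY]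
      | tmul x c => simp [pdComp, hφ]
    rw [h1, map_smul, rk_covBy h, pow_succ]
    simp
  · simp [pdComp_of_not C h]

theorem sgnTot_pd (f : OSC C) : sgnTot C (pd C f) = - pd C (sgnTot C f) := by
  funext t
  rw [Pi.neg_apply, pd_apply, sgnTot_apply, pd_apply]
  have := pd_anticomm C (fun p => C.sgn p) (fun p t c => (C.sgn_resTo p t c).symm) f t
  simp only [sgnTot_apply]
  rw [this, neg_neg]

theorem dl_pd (f : OSC C) : dl C (pd C f) = - pd C (dl C f) := by
  funext t
  rw [Pi.neg_apply, pd_apply, dl_apply, pd_apply]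
  have := pd_anticomm C (fun p => C.δ p) (fun p t c => C.resTo_δ p t c) f t
  simp only [dl_apply]
  rw [this, neg_neg]

theorem sgn_pow_δ (p : P) (n : ℕ) (c : C.obj p) :
    ((C.sgn p) ^ n) (C.δ p c) = (-1 : R) ^ n • C.δ p (((C.sgn p) ^ n) c) := by
  induction n generalizing c with
  | zero => simp
  | succ n ih =>
    rw [pow_succ', Module.End.mul_apply, Module.End.mul_apply, ih, map_smul, C.sgn_δ, pow_succ]
    simp

theorem sgn_pow_resTo (p q : P) (n : ℕ) (c : C.obj p) :
    ((C.sgn q) ^ n) (C.resTo p q c) = C.resTo p q (((C.sgn p) ^ n) c) := by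
  induction n with
  | zero => simp
  | succ n ih =>
    rw [pow_succ', Module.End.mul_apply, ih, C.sgn_resTo, pow_succ', Module.End.mul_apply]

theorem mulComp_tmul {p q s : P} (x : TopMod R p) (a : C.obj p) (y : TopMod R q) (b : C.obj q) :
    mulComp C p q s (x ⊗ₜ a) (y ⊗ₜ b) =
      tMul R p q s x y ⊗ₜ C.mul p q s (((C.sgn p) ^ rk q) a) b := by
  simp [mulComp]

theorem pdComp_mulComp (p q t : P) (X : TopMod R p ⊗[R] C.obj p) (Y : TopMod R q ⊗[R] C.obj q) :
    ∑ k, pdComp C k t (mulComp C p q k X Y) = ∑ u, mulComp C u q t (pdComp C p u X) Y +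
      ∑ v, mulComp C p v t ((-1 : R) ^ rk p • (C.sgn p).lTensor (TopMod R p) X) (pdComp C q v Y) := by
  induction X using TensorProduct.induction_on with
  | zero => simp
  | add X X' hX hX' =>
    simp only [map_add, LinearMap.add_apply, Finset.sum_add_distrib, smul_add, hX, hX']
    abel
  | tmul x a =>
    induction Y using TensorProduct.induction_on with
    | zero => simp
    | add Y Y' hY hY' =>
      simp only [map_add, Finset.sum_add_distrib, hY, hY']
      abel
    | tmul y b =>
      set a' := ((C.sgn p) ^ rk q) a with ha'
      have h1 : ∀ k, pdComp C k t (mulComp C p q k (x ⊗ₜ a) (y ⊗ₜ b)) =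
          ∑ u, tMul R u q t (tBdry R p u x) y ⊗ₜ C.resTo k t (C.mul p q k a' b) +
          (-1 : R) ^ rk p •
            ∑ v, tMul R p v t x (tBdry R q v y) ⊗ₜ C.resTo k t (C.mul p q k a' b) := by
        intro k
        rw [mulComp_tmul, pdComp, TensorProduct.map_tmul, ← TensorProduct.sum_tmul,
          ← TensorProduct.sum_tmul, TensorProduct.smul_tmul', ← TensorProduct.add_tmul]
        by_cases hk : k ∈ joins p q
        · by_cases htk : t ≤ k
          · rw [tBdry_tMul hk htk]
          · simp [C.resTo_of_not htk]
        · simp [C.mul_eq_zero p q k hk]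
      have h2 : ∀ u, mulComp C u q t (pdComp C p u (x ⊗ₜ a)) (y ⊗ₜ b) =
          ∑ k, tMul R u q t (tBdry R p u x) y ⊗ₜ C.resTo k t (C.mul p q k a' b) := by
        intro u
        rw [pdComp, TensorProduct.map_tmul, mulComp_tmul, sgn_pow_resTo, ← TensorProduct.tmul_sum]
        by_cases hu : u ⋖ p
        · by_cases ht : t ∈ joins u q
          · rw [C.resTo_mul hu.le ht]
          · simp [tMul_of_notMem ht]
        · simp [tBdry_of_not hu]
      have h3 : ∀ z, mulComp C p z t ((-1 : R) ^ rk p • (C.sgn p).lTensor (TopMod R p) (x ⊗ₜ a))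
          (pdComp C q z (y ⊗ₜ b)) = (-1 : R) ^ rk p •
          ∑ k, tMul R p z t x (tBdry R q z y) ⊗ₜ C.resTo k t (C.mul p q k a' b) := by
        intro z
        rw [pdComp, TensorProduct.map_tmul, map_smul, LinearMap.smul_apply,
          LinearMap.lTensor_tmul, mulComp_tmul, ← TensorProduct.tmul_sum]
        congr 1
        by_cases hz : z ⋖ q
        · by_cases ht : t ∈ joins p z
          · rw [C.mul_resTo hz.le ht] 
            rw [ha', rk_covBy hz, pow_succ, Module.End.mul_apply]
          · simp [tMul_of_notMem ht]
        · simp [tBdry_of_not hz]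
      simp only [h1, h2, h3]
      rw [Finset.sum_add_distrib, Finset.sum_comm, ← Finset.smul_sum, ← Finset.smul_sum]
      congr 2
      exact Finset.sum_comm

theorem pd_mul (f g : OSC C) :
    pd C (mul C f g) = mul C (pd C f) g + mul C (sgnTot C f) (pd C g) := by
  funext t
  rw [Pi.add_apply, pd_apply]
  simp only [mul_apply, map_sum]
  rw [Finset.sum_comm]
  have h1 : ∀ p, ∑ k, ∑ q, pdComp C k t (mulComp C p q k (f p) (g q)) =
      ∑ q, (∑ u, mulComp C u q t (pdComp C p u (f p)) (g q) +
        ∑ v, mulComp C p v t (sgnTot C f p) (pdComp C q v (g q))) := by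
    intro p
    rw [Finset.sum_comm]
    exact Finset.sum_congr rfl fun q _ => pdComp_mulComp C p q t (f p) (g q)
  simp only [h1, Finset.sum_add_distrib]
  congr 1
  · simp only [pd_apply, map_sum, LinearMap.sum_apply]
    rw [Finset.sum_comm]
    conv_rhs => rw [Finset.sum_comm]
    refine Finset.sum_congr rfl fun q _ => ?_
    rw [Finset.sum_comm]
  · simp only [pd_apply, map_sum]
    refine Finset.sum_congr rfl fun p _ => ?_
    rw [Finset.sum_comm]

theorem dl_mulComp (p q s : P) (X : TopMod R p ⊗[R] C.obj p) (Y : TopMod R q ⊗[R] C.obj q) :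
    (-1 : R) ^ rk s • (C.δ s).lTensor (TopMod R s) (mulComp C p q s X Y) =
      mulComp C p q s ((-1 : R) ^ rk p • (C.δ p).lTensor (TopMod R p) X) Y +
      mulComp C p q s ((-1 : R) ^ rk p • (C.sgn p).lTensor (TopMod R p) X)
        ((-1 : R) ^ rk q • (C.δ q).lTensor (TopMod R q) Y) := by
  by_cases hr : rk s = rk p + rk q
  swap
  · simp [mulComp_of_rk C hr]
  induction X using TensorProduct.induction_on with
  | zero => simp
  | add X X' hX hX' =>
    simp only [map_add, LinearMap.add_apply, smul_add, hX, hX']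
    abel
  | tmul x a =>
    induction Y using TensorProduct.induction_on with
    | zero => simp
    | add Y Y' hY hY' =>
      simp only [map_add, smul_add, hY, hY']
      abel
    | tmul y b =>
      simp only [map_smul, LinearMap.smul_apply, LinearMap.lTensor_tmul, mulComp_tmul, sgn_pow_δ,
        C.δ_mul, TensorProduct.tmul_add, TensorProduct.tmul_smul, smul_add, smul_smul, hr, pow_add]
      congr 1
      rw [← Module.End.mul_apply, ← Module.End.mul_apply, ← pow_succ', ← pow_succ, mul_comm]

theorem dl_mul (f g : OSC C) :
    dl C (mul C f g) = mul C (dl C f) g + mul C (sgnTot C f) (dl C g) := by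
  funext s
  rw [Pi.add_apply, dl_apply]
  simp only [mul_apply, map_sum, Finset.smul_sum, ← Finset.sum_add_distrib]
  exact Finset.sum_congr rfl fun p _ => Finset.sum_congr rfl fun q _ =>
    dl_mulComp C p q s (f p) (g q)

end OSC

end DoubleComplex

/-! ## Differential algebras and the spectral sequence of a filtered differential graded algebra -/

section Spectral

/-- A differential algebra: an algebra (not assumed associative or unital) with an involutive sign
operator `sgn` and a differential `d`, subject to `d (x y) = (d x) y + (sgn x) (d y)`. -/
structure DiffAlg (R : Type v) [CommRing R] where
  carrier : Type w
  [addCommGroup : AddCommGroup carrier]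
  [module : Module R carrier]
  mul : carrier →ₗ[R] carrier →ₗ[R] carrier
  sgn : carrier →ₗ[R] carrier
  d : carrier →ₗ[R] carrier
  sgn_sgn : ∀ x, sgn (sgn x) = x
  sgn_d : ∀ x, sgn (d x) = - d (sgn x)
  d_d : ∀ x, d (d x) = 0
  d_mul : ∀ x y, d (mul x y) = mul (d x) y + mul (sgn x) (d y)

attribute [instance] DiffAlg.addCommGroup DiffAlg.module

namespace DiffAlg

variable {R : Type v} [CommRing R] (D : DiffAlg.{v, w} R)

/-- The cohomology `ker d / im d` of a differential algebra. -/
def Coh : Type w := SubQ (LinearMap.ker D.d) (LinearMap.range D.d)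

instance : AddCommGroup D.Coh :=
  inferInstanceAs (AddCommGroup (SubQ (LinearMap.ker D.d) (LinearMap.range D.d)))

instance : Module R D.Coh :=
  inferInstanceAs (Module R (SubQ (LinearMap.ker D.d) (LinearMap.range D.d)))

/-- The class of a cocycle. -/
def cls : LinearMap.ker D.d →ₗ[R] D.Coh :=
  ((LinearMap.range D.d).submoduleOf (LinearMap.ker D.d)).mkQ

/-- The product of the cohomology. -/
def cohMul : D.Coh →ₗ[R] D.Coh →ₗ[R] D.Coh :=
  SubQ.map₂ D.mul
    (fun x hx y hy => by
      rw [LinearMap.mem_ker] at hx hy ⊢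
      rw [D.d_mul, hx, hy]
      simp)
    (fun _ _ hx y hy => by
      obtain ⟨z, rfl⟩ := hx
      rw [LinearMap.mem_ker] at hy
      exact ⟨D.mul z y, by rw [D.d_mul, hy, map_zero, add_zero]⟩)
    (fun x hx _ _ hy => by
      obtain ⟨z, rfl⟩ := hy
      rw [LinearMap.mem_ker] at hx
      refine ⟨D.mul (D.sgn x) z, ?_⟩
      have h0 : D.d (D.sgn x) = 0 := by rw [← neg_eq_zero, ← D.sgn_d, hx, map_zero]
      rw [D.d_mul, h0, D.sgn_sgn]
      simp)

instance : NonUnitalNonAssocRing D.Coh where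
  mul α β := D.cohMul α β
  left_distrib α β γ := map_add (D.cohMul α) β γ
  right_distrib α β γ := LinearMap.congr_fun (map_add D.cohMul α β) γ
  zero_mul α := LinearMap.congr_fun (map_zero D.cohMul) α
  mul_zero α := map_zero (D.cohMul α)

theorem coh_mul_def (α β : D.Coh) : α * β = D.cohMul α β := rfl

instance : IsScalarTower R D.Coh D.Coh where
  smul_assoc r α β := LinearMap.congr_fun (map_smul D.cohMul r α) β

instance : SMulCommClass R D.Coh D.Coh where
  smul_comm r α β := (map_smul (D.cohMul α) r β).symm

/-- The classes of the cocycles that lie in a given submodule. -/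
def classes (N : Submodule R D.carrier) : Submodule R D.Coh :=
  (N.submoduleOf (LinearMap.ker D.d)).map D.cls

theorem mul_mem_classes {N N' N'' : Submodule R D.carrier}
    (h : ∀ x ∈ N, ∀ y ∈ N', D.mul x y ∈ N'') {α β : D.Coh} (hα : α ∈ D.classes N)
    (hβ : β ∈ D.classes N') : α * β ∈ D.classes N'' := by
  obtain ⟨⟨x, hx⟩, hxN, rfl⟩ := hα
  obtain ⟨⟨y, hy⟩, hyN, rfl⟩ := hβ
  refine ⟨⟨D.mul x y, ?_⟩, h x hxN y hyN, rfl⟩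
  rw [LinearMap.mem_ker] at hx hy ⊢
  rw [D.d_mul, hx, hy]
  simp

theorem classes_mono {N N' : Submodule R D.carrier} (h : N ≤ N') : D.classes N ≤ D.classes N' :=
  Submodule.map_mono (fun _ hx => h hx)

end DiffAlg

/-- A filtered differential graded algebra: a differential algebra with homogeneous parts `deg n`
and a decreasing multiplicative filtration `fil k` by subcomplexes. -/
structure FilteredDGA (R : Type v) [CommRing R] extends DiffAlg.{v, w} R where
  deg : ℤ → Submodule R carrier
  fil : ℤ → Submodule R carrier
  sgn_of_deg : ∀ n, ∀ x ∈ deg n, sgn x = (n.negOnePow : ℤ) • x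
  d_deg : ∀ n, ∀ x ∈ deg n, d x ∈ deg (n + 1)
  mul_deg : ∀ m n, ∀ x ∈ deg m, ∀ y ∈ deg n, mul x y ∈ deg (m + n)
  fil_anti : Antitone fil
  d_fil : ∀ k, ∀ x ∈ fil k, d x ∈ fil k
  mul_fil : ∀ k l, ∀ x ∈ fil k, ∀ y ∈ fil l, mul x y ∈ fil (k + l)

namespace FilteredDGA

variable {R : Type v} [CommRing R] (D : FilteredDGA.{v, w} R)

/-- `Z_r^{k,j}`: the elements of filtration `k` and degree `k + j` with differential in filtration
`k + r`. -/
def Z (r k j : ℤ) : Submodule R D.carrier :=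
  D.fil k ⊓ D.deg (k + j) ⊓ (D.fil (k + r)).comap D.d

/-- `B_r^{k,j}`: the elements of filtration `k` and degree `k + j` that are differentials of
elements of filtration `k - r`. -/
def B (r k j : ℤ) : Submodule R D.carrier :=
  D.fil k ⊓ D.deg (k + j) ⊓ (D.fil (k - r) ⊓ D.deg (k + j - 1)).map D.d

/-- The entry `E_r^{k,j} = Z_r^{k,j} / (Z_{r-1}^{k+1,j-1} + B_{r-1}^{k,j})` of the spectral sequence
of the filtration. -/
abbrev Page (r k j : ℤ) : Type w :=
  SubQ (D.Z r k j) (D.Z (r - 1) (k + 1) (j - 1) ⊔ D.B (r - 1) k j)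

variable {D}

theorem mem_Z {r k j : ℤ} {x : D.carrier} :
    x ∈ D.Z r k j ↔ x ∈ D.fil k ∧ x ∈ D.deg (k + j) ∧ D.d x ∈ D.fil (k + r) := by
  simp [Z, and_assoc]

theorem mem_B {r k j : ℤ} {x : D.carrier} :
    x ∈ D.B r k j ↔ x ∈ D.fil k ∧ x ∈ D.deg (k + j) ∧
      ∃ y ∈ D.fil (k - r), y ∈ D.deg (k + j - 1) ∧ D.d y = x := by
  simp [B, and_assoc]

theorem deg_congr {m n : ℤ} (h : m = n) {x : D.carrier} (hx : x ∈ D.deg m) : x ∈ D.deg n := h ▸ hx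

theorem fil_of_le {k l : ℤ} (h : l ≤ k) {x : D.carrier} (hx : x ∈ D.fil k) : x ∈ D.fil l :=
  D.fil_anti h hx

theorem sgn_mem {n : ℤ} {N : Submodule R D.carrier} {x : D.carrier} (hn : x ∈ D.deg n)
    (hx : x ∈ N) : D.sgn x ∈ N := by
  rw [D.sgn_of_deg n x hn]
  exact zsmul_mem hx _

theorem d_mem_Z {r k j : ℤ} {x : D.carrier} (hx : x ∈ D.Z r k j) :
    D.d x ∈ D.Z r (k + r) (j - r + 1) := by
  rw [mem_Z] at hx ⊢
  refine ⟨hx.2.2, deg_congr (by ring) (D.d_deg _ _ hx.2.1), ?_⟩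
  rw [D.d_d]
  exact zero_mem _

theorem d_mem_den {r k j : ℤ} {x : D.carrier} (hx : x ∈ D.Z r k j)
    (hx' : x ∈ D.Z (r - 1) (k + 1) (j - 1) ⊔ D.B (r - 1) k j) :
    D.d x ∈ D.Z (r - 1) (k + r + 1) (j - r + 1 - 1) ⊔ D.B (r - 1) (k + r) (j - r + 1) := by
  obtain ⟨z, hz, b, hb, rfl⟩ := Submodule.mem_sup.1 hx'
  obtain ⟨-, -, c, -, -, rfl⟩ := mem_B.1 hb
  refine Submodule.mem_sup_right (mem_B.2 ?_)
  rw [mem_Z] at hz hx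
  rw [map_add, D.d_d, add_zero]
  refine ⟨fil_of_le (by omega) hz.2.2, deg_congr (by ring) (D.d_deg _ _ hz.2.1), z,
    fil_of_le (by omega) hz.1, deg_congr (by ring) hz.2.1, rfl⟩

theorem mul_mem_Z {r k j l m : ℤ} {x y : D.carrier} (hx : x ∈ D.Z r k j) (hy : y ∈ D.Z r l m) :
    D.mul x y ∈ D.Z r (k + l) (j + m) := by
  rw [mem_Z] at hx hy ⊢
  refine ⟨D.mul_fil _ _ _ hx.1 _ hy.1, deg_congr (by ring) (D.mul_deg _ _ _ hx.2.1 _ hy.2.1), ?_⟩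
  rw [D.d_mul]
  exact add_mem (fil_of_le (by omega) (D.mul_fil _ _ _ hx.2.2 _ hy.1))
    (fil_of_le (by omega) (D.mul_fil _ _ _ (sgn_mem hx.2.1 hx.1) _ hy.2.2))

theorem mul_mem_den_left {r k j l m : ℤ} {x y : D.carrier}
    (hx : x ∈ D.Z (r - 1) (k + 1) (j - 1) ⊔ D.B (r - 1) k j) (hy : y ∈ D.Z r l m) :
    D.mul x y ∈ D.Z (r - 1) (k + l + 1) (j + m - 1) ⊔ D.B (r - 1) (k + l) (j + m) := by
  obtain ⟨z, hz, b, hb, rfl⟩ := Submodule.mem_sup.1 hx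
  rw [map_add, LinearMap.add_apply]
  rw [mem_Z] at hz hy
  refine add_mem (Submodule.mem_sup_left (mem_Z.2 ⟨fil_of_le (by omega)
    (D.mul_fil _ _ _ hz.1 _ hy.1), deg_congr (by ring) (D.mul_deg _ _ _ hz.2.1 _ hy.2.1), ?_⟩)) ?_
  · rw [D.d_mul]
    exact add_mem (fil_of_le (by omega) (D.mul_fil _ _ _ hz.2.2 _ hy.1))
      (fil_of_le (by omega) (D.mul_fil _ _ _ (sgn_mem hz.2.1 hz.1) _ hy.2.2))
  · obtain ⟨hb1, hb2, c, hc1, hc2, rfl⟩ := mem_B.1 hb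
    have h1 : D.mul (D.sgn c) (D.d y) ∈ D.Z (r - 1) (k + l + 1) (j + m - 1) := by
      refine mem_Z.2 ⟨fil_of_le (by omega) (D.mul_fil _ _ _ (sgn_mem hc2 hc1) _ hy.2.2),
        deg_congr (by ring) (D.mul_deg _ _ _ (sgn_mem hc2 hc2) _ (D.d_deg _ _ hy.2.1)), ?_⟩
      rw [D.d_mul, D.d_d, map_zero, add_zero]
      have h2 : D.d (D.sgn c) = - D.sgn (D.d c) := by rw [D.sgn_d, neg_neg]
      rw [h2, map_neg, LinearMap.neg_apply]
      exact neg_mem (fil_of_le (by omega) (D.mul_fil _ _ _ (sgn_mem hb2 hb1) _ hy.2.2))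
    have h2 : D.mul (D.d c) y = D.d (D.mul c y) + - D.mul (D.sgn c) (D.d y) := by
      rw [D.d_mul]; abel
    have h3 : D.mul (D.d c) y ∈ D.fil (k + l) := D.mul_fil _ _ _ hb1 _ hy.1
    have h4 : D.d (D.mul c y) ∈ D.fil (k + l) := by
      rw [D.d_mul]
      exact add_mem h3 (fil_of_le (by omega) (mem_Z.1 h1).1)
    rw [h2]
    refine add_mem (Submodule.mem_sup_right (mem_B.2 ⟨h4, ?_, D.mul c y, ?_, ?_, rfl⟩))
      (Submodule.mem_sup_left (neg_mem h1))
    · exact deg_congr (by ring) (D.d_deg _ _ (D.mul_deg _ _ _ hc2 _ hy.2.1))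
    · exact fil_of_le (by omega) (D.mul_fil _ _ _ hc1 _ hy.1)
    · exact deg_congr (by ring) (D.mul_deg _ _ _ hc2 _ hy.2.1)

theorem mul_mem_den_right {r k j l m : ℤ} {x y : D.carrier} (hx : x ∈ D.Z r k j)
    (hy : y ∈ D.Z (r - 1) (l + 1) (m - 1) ⊔ D.B (r - 1) l m) :
    D.mul x y ∈ D.Z (r - 1) (k + l + 1) (j + m - 1) ⊔ D.B (r - 1) (k + l) (j + m) := by
  obtain ⟨z, hz, b, hb, rfl⟩ := Submodule.mem_sup.1 hy
  rw [map_add]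
  rw [mem_Z] at hz hx
  refine add_mem (Submodule.mem_sup_left (mem_Z.2 ⟨fil_of_le (by omega)
    (D.mul_fil _ _ _ hx.1 _ hz.1), deg_congr (by ring) (D.mul_deg _ _ _ hx.2.1 _ hz.2.1), ?_⟩)) ?_
  · rw [D.d_mul]
    exact add_mem (fil_of_le (by omega) (D.mul_fil _ _ _ hx.2.2 _ hz.1))
      (fil_of_le (by omega) (D.mul_fil _ _ _ (sgn_mem hx.2.1 hx.1) _ hz.2.2))
  · obtain ⟨hb1, hb2, c, hc1, hc2, rfl⟩ := mem_B.1 hb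
    have hs : D.d (D.sgn x) = - D.sgn (D.d x) := by rw [D.sgn_d, neg_neg]
    have hds : D.d (D.sgn x) ∈ D.fil (k + r) := by
      rw [hs]
      exact neg_mem (sgn_mem (D.d_deg _ _ hx.2.1) hx.2.2)
    have hdd : D.d (D.sgn x) ∈ D.deg (k + j + 1) := D.d_deg _ _ (sgn_mem hx.2.1 hx.2.1)
    have h1 : D.mul (D.d (D.sgn x)) c ∈ D.Z (r - 1) (k + l + 1) (j + m - 1) := by
      refine mem_Z.2 ⟨fil_of_le (by omega) (D.mul_fil _ _ _ hds _ hc1),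
        deg_congr (by ring) (D.mul_deg _ _ _ hdd _ hc2), ?_⟩
      rw [D.d_mul, D.d_d, map_zero, LinearMap.zero_apply, zero_add]
      exact fil_of_le (by omega) (D.mul_fil _ _ _ (sgn_mem hdd hds) _ hb1)
    have h2 : D.mul x (D.d c) = D.d (D.mul (D.sgn x) c) + - D.mul (D.d (D.sgn x)) c := by
      rw [D.d_mul, D.sgn_sgn]; abel
    have h3 : D.mul x (D.d c) ∈ D.fil (k + l) := D.mul_fil _ _ _ hx.1 _ hb1
    have h4 : D.d (D.mul (D.sgn x) c) ∈ D.fil (k + l) := by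
      rw [D.d_mul, D.sgn_sgn]
      exact add_mem (fil_of_le (by omega) (mem_Z.1 h1).1) h3
    rw [h2]
    refine add_mem (Submodule.mem_sup_right (mem_B.2 ⟨h4, ?_, D.mul (D.sgn x) c, ?_, ?_, rfl⟩))
      (Submodule.mem_sup_left (neg_mem h1))
    · exact deg_congr (by ring) (D.d_deg _ _ (D.mul_deg _ _ _ (sgn_mem hx.2.1 hx.2.1) _ hc2))
    · exact fil_of_le (by omega) (D.mul_fil _ _ _ (sgn_mem hx.2.1 hx.1) _ hc1)
    · exact deg_congr (by ring) (D.mul_deg _ _ _ (sgn_mem hx.2.1 hx.2.1) _ hc2)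

variable (D)

/-- The differential `d_r : E_r^{k,j} → E_r^{k+r,j-r+1}`, induced by `d`. -/
def dPage (r k j : ℤ) : D.Page r k j →ₗ[R] D.Page r (k + r) (j - r + 1) :=
  SubQ.map D.d (fun _ hx => d_mem_Z hx) (fun _ hx hx' => d_mem_den hx hx')

/-- The product `E_r^{k,j} × E_r^{l,m} → E_r^{k+l,j+m}`, induced by the product. -/
def mulPage (r k j l m : ℤ) :
    D.Page r k j →ₗ[R] D.Page r l m →ₗ[R] D.Page r (k + l) (j + m) :=
  SubQ.map₂ D.mul (fun _ hx _ hy => mul_mem_Z hx hy) (fun _ _ hx _ hy => mul_mem_den_left hx hy)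
    (fun _ hx _ _ hy => mul_mem_den_right hx hy)

/-- The part of filtration `k` of the cohomology in degree `n`: the image of `H^n(fil k)`. -/
def filCoh (k n : ℤ) : Submodule R D.Coh := D.classes (D.fil k ⊓ D.deg n)

/-- The associated graded `Gr^{k,j} = F^k H^{k+j} / F^{k+1} H^{k+j}` of the cohomology. -/
abbrev Gr (k j : ℤ) : Type w := SubQ (D.filCoh k (k + j)) (D.filCoh (k + 1) (k + j))

theorem mul_mem_filCoh {k l m n m' : ℤ} (hm : m + n = m') {α β : D.Coh} (hα : α ∈ D.filCoh k m)
    (hβ : β ∈ D.filCoh l n) : α * β ∈ D.filCoh (k + l) m' :=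
  D.mul_mem_classes (N := D.fil k ⊓ D.deg m) (N' := D.fil l ⊓ D.deg n)
    (N'' := D.fil (k + l) ⊓ D.deg m') (fun x hx y hy =>
    Submodule.mem_inf.2 ⟨D.mul_fil _ _ x hx.1 y hy.1,
      deg_congr hm (D.mul_deg _ _ x hx.2 y hy.2)⟩) hα hβ

/-- The product `Gr^{k,j} × Gr^{l,m} → Gr^{k+l,j+m}` induced by the product of the cohomology. -/
def mulGr (k j l m : ℤ) : D.Gr k j →ₗ[R] D.Gr l m →ₗ[R] D.Gr (k + l) (j + m) :=
  SubQ.map₂ D.cohMul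
    (fun _ hα _ hβ => D.mul_mem_filCoh (by ring) hα hβ)
    (fun α _ hα β hβ => by
      have h := D.mul_mem_filCoh (m' := k + l + (j + m)) (by ring) hα hβ
      rwa [show k + 1 + l = k + l + 1 by ring] at h)
    (fun α hα β _ hβ => by
      have h := D.mul_mem_filCoh (m' := k + l + (j + m)) (by ring) hα hβ
      rwa [show k + (l + 1) = k + l + 1 by ring] at h)

end FilteredDGA

end Spectral

/-! ## The algebras `(A*(P, C), ∂)` and `Tot A*(P, C)` -/

section Total

variable {R : Type v} [CommRing R] {P : Type u} [PartialOrder P] [OrderBot P] [Fintype P]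
  [LocallyGeometric P] (C : MonoidalDGAPresheaf.{u, v, w} R P)

namespace OSC

set_option linter.unusedSectionVars false

/-- The submodule `A*([⊥,p])_p ⊗ C_p^j`. -/
def part (p : P) (j : ℤ) : Submodule R (TopMod R p ⊗[R] C.obj p) :=
  LinearMap.range ((C.gr p j).subtype.lTensor (TopMod R p))

@[elab_as_elim]
theorem part_induction {p : P} {j : ℤ} {motive : TopMod R p ⊗[R] C.obj p → Prop}
    {X : TopMod R p ⊗[R] C.obj p} (hX : X ∈ part C p j) (zero : motive 0)
    (add : ∀ X Y, motive X → motive Y → motive (X + Y))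
    (tmul : ∀ x, ∀ c ∈ C.gr p j, motive (x ⊗ₜ c)) : motive X := by
  obtain ⟨Y, rfl⟩ := hX
  induction Y using TensorProduct.induction_on with
  | zero => rw [map_zero]; exact zero
  | add X Y hX hY => rw [map_add]; exact add _ _ hX hY
  | tmul x c => exact tmul x c c.2

theorem tmul_mem_part {p : P} {j : ℤ} (x : TopMod R p) {c : C.obj p} (hc : c ∈ C.gr p j) :
    x ⊗ₜ c ∈ part C p j := ⟨x ⊗ₜ ⟨c, hc⟩, rfl⟩

theorem pdComp_mem {p t : P} {j : ℤ} {X : TopMod R p ⊗[R] C.obj p} (hX : X ∈ part C p j) :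
    pdComp C p t X ∈ part C t j := by
  refine part_induction C hX ?_ ?_ ?_
  · rw [map_zero]; exact zero_mem _
  · intro X Y hX hY
    rw [map_add]; exact add_mem hX hY
  · intro x c hc
    rw [pdComp, TensorProduct.map_tmul]
    exact tmul_mem_part C _ (C.resTo_mem p t hc)

theorem sgn_pow_mem {p : P} {j : ℤ} {c : C.obj p} (hc : c ∈ C.gr p j) (n : ℕ) :
    ((C.sgn p) ^ n) c ∈ C.gr p j := by
  induction n with
  | zero => simpa using hc
  | succ n ih =>
    rw [pow_succ', Module.End.mul_apply]
    exact C.sgn_mem ih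

theorem mulComp_mem {p q s : P} {i j : ℤ} {X : TopMod R p ⊗[R] C.obj p} (hX : X ∈ part C p i)
    {Y : TopMod R q ⊗[R] C.obj q} (hY : Y ∈ part C q j) :
    mulComp C p q s X Y ∈ part C s (i + j) := by
  refine part_induction C hX ?_ ?_ ?_
  · rw [map_zero]; exact zero_mem _
  · intro X Y hX hY
    rw [map_add]; exact add_mem hX hY
  · intro x c hc
    refine part_induction C hY ?_ ?_ ?_
    · rw [map_zero]; exact zero_mem _
    · intro X Y hX hY
      rw [map_add]; exact add_mem hX hY
    · intro y b hb
      rw [mulComp_tmul]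
      exact tmul_mem_part C _ (C.mul_mem p q s i j _ _ (sgn_pow_mem C hc _) hb)

theorem lTensor_δ_mem {p : P} {j : ℤ} {X : TopMod R p ⊗[R] C.obj p} (hX : X ∈ part C p j) :
    (C.δ p).lTensor (TopMod R p) X ∈ part C p (j + 1) := by
  refine part_induction C hX ?_ ?_ ?_
  · rw [map_zero]; exact zero_mem _
  · intro X Y hX hY
    rw [map_add]; exact add_mem hX hY
  · intro x c hc
    rw [LinearMap.lTensor_tmul]
    exact tmul_mem_part C _ (C.δ_mem p j c hc)

theorem lTensor_sgn {p : P} {j : ℤ} {X : TopMod R p ⊗[R] C.obj p} (hX : X ∈ part C p j) :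
    (C.sgn p).lTensor (TopMod R p) X = (j.negOnePow : ℤ) • X := by
  refine part_induction C hX ?_ ?_ ?_
  · rw [map_zero, smul_zero]
  · intro X Y hX hY
    rw [map_add, hX, hY, smul_add]
  · intro x c hc
    rw [LinearMap.lTensor_tmul, C.sgn_of_mem hc]
    exact map_zsmul (TensorProduct.mk R (TopMod R p) (C.obj p) x) _ c

/-- The bigraded part of `A*(P, C)` of degree `k = -i` in the Orlik–Solomon direction and `j` in the
direction of `C`: `⨁_{r(p) = i} A*([⊥,p])_p ⊗ C_p^j`. -/
def bi (k j : ℤ) : Submodule R (OSC C) where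
  carrier := {f | ∀ p, f p ∈ part C p j ∧ ((rk p : ℤ) ≠ -k → f p = 0)}
  zero_mem' _ := ⟨zero_mem _, fun _ => rfl⟩
  add_mem' hf hg p := ⟨add_mem (hf p).1 (hg p).1, fun h => by
    rw [Pi.add_apply, (hf p).2 h, (hg p).2 h, add_zero]⟩
  smul_mem' r _ hf p := ⟨Submodule.smul_mem _ r (hf p).1, fun h => by
    rw [Pi.smul_apply, (hf p).2 h, smul_zero]⟩

/-- The column `⨁_{r(p) = -k} A*([⊥,p])_p ⊗ C_p` of `A*(P, C)`. -/
def col (k : ℤ) : Submodule R (OSC C) where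
  carrier := {f | ∀ p : P, (rk p : ℤ) ≠ -k → f p = 0}
  zero_mem' _ _ := rfl
  add_mem' hf hg p h := by rw [Pi.add_apply, hf p h, hg p h, add_zero]
  smul_mem' r _ hf p h := by rw [Pi.smul_apply, hf p h, smul_zero]

/-- The part of total degree `n` of `A*(P, C)`: `⨁ₚ A*([⊥,p])_p ⊗ C_p^(n + r(p))`. -/
def deg (n : ℤ) : Submodule R (OSC C) where
  carrier := {f | ∀ p, f p ∈ part C p (n + rk p)}
  zero_mem' _ := zero_mem _
  add_mem' hf hg p := add_mem (hf p) (hg p)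
  smul_mem' r _ hf p := Submodule.smul_mem _ r (hf p)

/-- The column-wise filtration `τ^k = ⨁_{r(p) ≤ -k} A*([⊥,p])_p ⊗ C_p`. -/
def fil (k : ℤ) : Submodule R (OSC C) where
  carrier := {f | ∀ p : P, -k < (rk p : ℤ) → f p = 0}
  zero_mem' _ _ := rfl
  add_mem' hf hg p h := by rw [Pi.add_apply, hf p h, hg p h, add_zero]
  smul_mem' r _ hf p h := by rw [Pi.smul_apply, hf p h, smul_zero]

theorem bi_mul {k j l m : ℤ} {f g : OSC C} (hf : f ∈ bi C k j) (hg : g ∈ bi C l m) :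
    mul C f g ∈ bi C (k + l) (j + m) := by
  intro s
  refine ⟨?_, fun hs => ?_⟩
  · rw [mul_apply]
    exact sum_mem fun p _ => sum_mem fun q _ => mulComp_mem C (hf p).1 (hg q).1
  · rw [mul_apply]
    refine Finset.sum_eq_zero fun p _ => Finset.sum_eq_zero fun q _ => ?_
    by_cases hp : (rk p : ℤ) = -k
    · by_cases hq : (rk q : ℤ) = -l
      · rw [mulComp_of_rk C (by omega)]
        rfl
      · rw [(hg q).2 hq, map_zero]
    · rw [(hf p).2 hp, map_zero, LinearMap.zero_apply]

theorem fil_mul {k l : ℤ} {f g : OSC C} (hf : f ∈ fil C k) (hg : g ∈ fil C l) :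
    mul C f g ∈ fil C (k + l) := by
  intro s hs
  rw [mul_apply]
  refine Finset.sum_eq_zero fun p _ => Finset.sum_eq_zero fun q _ => ?_
  by_cases hp : -k < (rk p : ℤ)
  · rw [hf p hp, map_zero, LinearMap.zero_apply]
  · by_cases hq : -l < (rk q : ℤ)
    · rw [hg q hq, map_zero]
    · rw [mulComp_of_rk C (by omega)]
      rfl

theorem deg_mul {m n : ℤ} {f g : OSC C} (hf : f ∈ deg C m) (hg : g ∈ deg C n) :
    mul C f g ∈ deg C (m + n) := by
  intro s
  rw [mul_apply]
  refine sum_mem fun p _ => sum_mem fun q _ => ?_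
  by_cases h : rk s = rk p + rk q
  · have h1 := mulComp_mem C (s := s) (hf p) (hg q)
    rwa [show m + (rk p : ℤ) + (n + rk q) = m + n + rk s by rw [h]; push_cast; ring] at h1
  · rw [mulComp_of_rk C h]
    exact zero_mem _

theorem pd_deg {n : ℤ} {f : OSC C} (hf : f ∈ deg C n) : pd C f ∈ deg C (n + 1) := by
  intro t
  rw [pd_apply]
  refine sum_mem fun p _ => ?_
  by_cases h : t ⋖ p
  · have h1 := pdComp_mem C (t := t) (hf p)
    rwa [show n + (rk p : ℤ) = n + 1 + rk t by rw [rk_covBy h]; push_cast; ring] at h1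
  · rw [pdComp_of_not C h]
    exact zero_mem _

theorem dl_deg {n : ℤ} {f : OSC C} (hf : f ∈ deg C n) : dl C f ∈ deg C (n + 1) := by
  intro p
  rw [dl_apply, show n + 1 + (rk p : ℤ) = n + rk p + 1 by ring]
  exact Submodule.smul_mem _ _ (lTensor_δ_mem C (hf p))

theorem pd_fil {k : ℤ} {f : OSC C} (hf : f ∈ fil C k) : pd C f ∈ fil C k := by
  intro t ht
  rw [pd_apply]
  refine Finset.sum_eq_zero fun p _ => ?_
  by_cases h : t ⋖ p
  · have := rk_covBy h
    rw [hf p (by omega), map_zero]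
  · rw [pdComp_of_not C h]
    rfl

theorem dl_fil {k : ℤ} {f : OSC C} (hf : f ∈ fil C k) : dl C f ∈ fil C k := by
  intro p hp
  rw [dl_apply, hf p hp, map_zero, smul_zero]

theorem sgnTot_of_deg {n : ℤ} {f : OSC C} (hf : f ∈ deg C n) :
    sgnTot C f = (n.negOnePow : ℤ) • f := by
  funext p
  rw [sgnTot_apply, lTensor_sgn C (hf p), Pi.smul_apply, Int.negOnePow_add, Units.val_mul,
    mul_smul, smul_comm ((-1 : R) ^ rk p)]
  congr 1
  have h1 : (((rk p : ℤ).negOnePow : ℤˣ) : ℤ) = (-1) ^ rk p := by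
    rw [Int.negOnePow_def]; simp
  have h2 : ((-1 : ℤ) ^ rk p) • f p = (-1 : R) ^ rk p • f p := by
    rw [← Int.cast_smul_eq_zsmul R]; simp
  rw [h1, h2, neg_one_pow_smul_smul]

/-- The differential algebra `(A*(P, C), ∂)`. -/
def pdAlg : DiffAlg.{v, max u v w} R where
  carrier := OSC C
  mul := mul C
  sgn := sgnTot C
  d := pd C
  sgn_sgn := sgnTot_sgnTot C
  sgn_d := sgnTot_pd C
  d_d := pd_pd C
  d_mul := pd_mul C

/-- The part `H^k` of `H^*(A*(P, C), ∂)`: the classes of the cycles in the column `k`. -/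
def colCoh (k : ℤ) : Submodule R (pdAlg C).Coh := (pdAlg C).classes (col C k)

/-- The part of `H^k(A*(P, C), ∂)` of degree `j` in the direction of `C`: the classes of the cycles
in `⨁_{r(p) = -k} A*([⊥,p])_p ⊗ C_p^j`, i.e. `H^k(A*(P, C^j), ∂)` if `C` has zero differential. -/
def biCoh (k j : ℤ) : Submodule R (pdAlg C).Coh := (pdAlg C).classes (bi C k j)

theorem mul_mem_biCoh {k j l m : ℤ} {α β : (pdAlg C).Coh} (hα : α ∈ biCoh C k j)
    (hβ : β ∈ biCoh C l m) : α * β ∈ biCoh C (k + l) (j + m) :=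
  (pdAlg C).mul_mem_classes (N'' := bi C (k + l) (j + m)) (fun _ hx _ hy => bi_mul C hx hy) hα hβ

/-- The total complex `Tot A*(P, C)` with differential `∂ + δ` and the column-wise filtration. -/
def tot : FilteredDGA.{v, max u v w} R where
  carrier := OSC C
  mul := mul C
  sgn := sgnTot C
  d := pd C + dl C
  sgn_sgn := sgnTot_sgnTot C
  sgn_d f := by
    simp only [LinearMap.add_apply, map_add, sgnTot_pd, sgnTot_dl, neg_add]
  d_d f := by
    simp only [LinearMap.add_apply, map_add, pd_pd, dl_dl, dl_pd]
    abel
  d_mul f g := by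
    simp only [LinearMap.add_apply, map_add, pd_mul, dl_mul]
    abel
  deg := deg C
  fil := fil C
  sgn_of_deg _ _ hf := sgnTot_of_deg C hf
  d_deg _ _ hf := add_mem (pd_deg C hf) (dl_deg C hf)
  mul_deg _ _ _ hf _ hg := deg_mul C hf hg
  fil_anti _ _ hkl _ hf p hp := hf p (by omega)
  d_fil _ _ hf := add_mem (pd_fil C hf) (dl_fil C hf)
  mul_fil _ _ _ hf _ hg := fil_mul C hf hg

end OSC

instance (p : P) : Fintype (Set.Ici p) := Fintype.ofFinite _

end Total

end OrlikSolomon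

end

/-!
The total complex `Tot A*(P, C)` (here `P = [p, ∞)`) carries the differential `∂ + δ`, where `δ`
preserves the column `-r(q)` and `∂` raises it by one. So `d₀ = δ` and `d₁` is induced by `∂`.

*The second page.* The part `A*([⊥,q])_q` is flat (`flat_topMod`): multiplication by `e_a`, `a` an
atom below `q ≠ ⊥`, contracts the complex `(A*([⊥,q]), ∂)`, and in top degree this exhibits
`A*([⊥,q])_q` as a direct summand of the sum of the `A*([⊥,t])_t`, `t` covered by `q`, so that one
can go down to `A*([⊥,⊥]) = R`. Hence the `δ`-cohomology of `A*(P, C)` is `A*(P, H^*(C))`. The relation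
`IsRep` expresses this identification; it respects `∂`, products and bidegrees. Sending a cycle of the second page to the class of the
element represented by its leading column then gives a correspondence `leadCorr`, which is the graph
of a multiplicative isomorphism `H^k(A*(P, H^j(C)), ∂) ≅ E_2^{k,j}` (`exists_mul_leadEquiv`).

*Collapse.* The filtration vanishes in positive degrees, so an element of `Z_2` in the columns `0`
and `-1` is a cycle of the total differential. Products of cycles are cycles, so if the algebra
`H(A*(P, H^*(C)), ∂)` is generated by these two columns, each of its classes comes from cycles of the
total complex (`permanent_eq_top`), that is, every class of the second page is represented by such a
cycle (`representedByCycles`). For an arbitrary filtered differential graded algebra with this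
property all `d_r`, `r ≥ 2`, vanish (`FilteredDGA.RepresentedByCycles.dPage_eq_zero`), and if
moreover the filtration is bounded and every homogeneous boundary bounds a homogeneous element,
sending a cycle to its two classes identifies the second page with the graded algebra of the
cohomology (`FilteredDGA.RepresentedByCycles.exists_mul_cycleEquiv`).
-/

noncomputable section

namespace OrlikSolomon

/-! ### Linear correspondences -/

section Correspondence

variable {R M N : Type*} [CommRing R] [AddCommGroup M] [Module R M] [AddCommGroup N] [Module R N]

/-- A submodule of `M × N` whose two projections are bijective is the graph of an isomorphism. -/
theorem exists_linearEquiv_of_correspondence (Γ : Submodule R (M × N))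
    (h₁ : ∀ m, ∃ n, (m, n) ∈ Γ) (h₂ : ∀ n, ∃ m, (m, n) ∈ Γ) (h₃ : ∀ n, (0, n) ∈ Γ → n = 0)
    (h₄ : ∀ m, (m, 0) ∈ Γ → m = 0) : ∃ e : M ≃ₗ[R] N, ∀ m n, (m, n) ∈ Γ → e m = n := by
  let f : Γ →ₗ[R] M := LinearMap.fst R M N ∘ₗ Γ.subtype
  let g : Γ →ₗ[R] N := LinearMap.snd R M N ∘ₗ Γ.subtype
  have hf : Function.Bijective f := by
    refine ⟨(injective_iff_map_eq_zero f).2 ?_, fun m => ?_⟩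
    · rintro ⟨⟨m, n⟩, h⟩ (rfl : m = 0)
      exact Subtype.ext (Prod.ext rfl (h₃ n h))
    · obtain ⟨n, h⟩ := h₁ m
      exact ⟨⟨(m, n), h⟩, rfl⟩
  have hg : Function.Bijective g := by
    refine ⟨(injective_iff_map_eq_zero g).2 ?_, fun n => ?_⟩
    · rintro ⟨⟨m, n⟩, h⟩ (rfl : n = 0)
      exact Subtype.ext (Prod.ext (h₄ m h) rfl)
    · obtain ⟨m, h⟩ := h₂ n
      exact ⟨⟨(m, n), h⟩, rfl⟩
  refine ⟨(LinearEquiv.ofBijective f hf).symm ≪≫ₗ LinearEquiv.ofBijective g hg, fun m n h => ?_⟩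
  have h5 : (LinearEquiv.ofBijective f hf).symm m = ⟨(m, n), h⟩ := by
    rw [LinearEquiv.symm_apply_eq]; rfl
  rw [LinearEquiv.trans_apply, h5]
  rfl

end Correspondence

/-! ### Flatness of the top parts of the Orlik–Solomon algebras -/

section Flat

variable {R : Type v} [CommRing R] {P : Type u} [PartialOrder P] [OrderBot P]

theorem osIdeal_bot [Finite P] : osIdeal R (⊥ : P) = ⊥ := by
  rw [osIdeal, Ideal.span_eq_bot]
  rintro z ⟨l, ⟨-, hl, s, -, hr⟩, y, rfl⟩
  cases l with
  | nil => simp at hr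
  | cons a l =>
    have ha := hl a (by simp)
    exact absurd (le_bot_iff.1 ha.2) ha.1.1

theorem one_mem_top_bot : (1 : OS R (⊥ : P)) ∈ top R (⊥ : P) :=
  Submodule.subset_span ⟨[], by simp, ⟨⟨le_rfl, by simp⟩, fun _ _ => bot_le⟩, by
    simp [osMon, extMon]⟩

theorem osGen_mem_top {a : P} (ha : IsAtom a) : osGen R a a ∈ top R a :=
  Submodule.subset_span ⟨[a], by simpa using ha, ⟨⟨le_rfl, by simp⟩, fun u hu => hu.2 a (by simp)⟩,
    by simp [osMon, osGen, extMon]⟩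

theorem flat_topMod_bot [Finite P] : Module.Flat R (TopMod R (⊥ : P)) := by
  let f : R →ₗ[R] top R (⊥ : P) := LinearMap.toSpanSingleton R _ ⟨1, one_mem_top_bot⟩
  have hf : Function.Bijective f := by
    refine ⟨(injective_iff_map_eq_zero f).2 fun r hr => ?_, ?_⟩
    · have h1 : osMk R (⊥ : P) (algebraMap R _ r) = osMk R (⊥ : P) 0 := by
        rw [AlgHom.commutes, map_zero, Algebra.algebraMap_eq_smul_one]
        exact congrArg Subtype.val hr
      rw [osMk_eq_iff, osIdeal_bot, Ideal.mem_bot, sub_zero] at h1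
      exact (ExteriorAlgebra.algebraMap_eq_zero_iff _ r).1 h1
    · rintro ⟨x, hx⟩
      have h1 : top R (⊥ : P) ≤ (LinearMap.toSpanSingleton R (OS R (⊥ : P)) 1).range := by
        refine Submodule.span_le.2 ?_
        rintro _ ⟨l, hl, -, rfl⟩
        cases l with
        | nil => exact ⟨1, by simp [osMon, extMon]⟩
        | cons a l =>
          have ha := hl a (by simp)
          exact absurd (le_bot_iff.1 ha.2) ha.1.1
      obtain ⟨r, hr⟩ := h1 hx
      exact ⟨r, Subtype.ext hr⟩
  exact Module.Flat.of_linearEquiv (LinearEquiv.ofBijective f hf).symm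

/-- The generator `e_a` of an atom `a`, as an element of the part of order `a`. -/
def topGen {a : P} (ha : IsAtom a) : TopMod R a :=
  (⟨osGen R a a, osGen_mem_top ha⟩ : top R a)

variable (R P) in
/-- The unit of the Orlik–Solomon algebra, as an element of the part of order `⊥`. -/
def topOne : TopMod R (⊥ : P) := (⟨1, one_mem_top_bot⟩ : top R (⊥ : P))

variable [LocallyGeometric P] [Fintype P]

theorem tBdry_osGen {a : P} (ha : IsAtom a) :
    tBdry R a ⊥ (topGen ha) = topOne R P := by
  have h1 : osBdry R a (osGen R a a) = 1 := by
    rw [osGen, osBdry_mk, ← mul_one (extGen R a a), extBdry_gen_mul ⟨ha, le_rfl⟩]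
    have h2 : extBdry R a (1 : Ext R a) = 0 := by simpa [extMon] using extBdry_nil (R := R) a
    rw [h2, mul_zero, sub_zero, map_one]
  have h2 : osTo R a ⊥ (osBdry R a (osGen R a a)) = 1 := by
    rw [h1, osTo_apply (Or.inr bot_le), map_one]
  exact Subtype.ext ((topBdry_coe ha.bot_lt _).trans h2)

theorem tMul_one {p : P} (x : TopMod R p) :
    tMul R ⊥ p p (topOne R P) x = x := by
  have hp : p ∈ joins ⊥ p := ⟨⟨bot_le, le_rfl⟩, fun u hu _ => hu.2⟩
  refine Subtype.ext ((topMul_coe hp _ x).trans ?_)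
  rw [topOne, osTo_apply (Or.inl bot_le), map_one, one_mul]
  exact osTo_self (Subtype.prop x)

/-- Since `e_a x = 0` in top degree, `∂ (e_a x) = x - e_a ∂ x` shows that `x = e_a ∂ x` for `x` of
order `p` and every atom `a ≤ p`. -/
theorem eq_sum_tMul_tBdry {a p : P} (ha : IsAtom a) (hap : a ≤ p) (x : TopMod R p) :
    ∑ v, tMul R a v p (topGen ha) (tBdry R p v x) = x := by
  have hp : p ∈ joins a p := ⟨⟨hap, le_rfl⟩, fun u hu _ => hu.2⟩
  have h := tBdry_tMul hp le_rfl (topGen ha) x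
  have hr : rk a = 1 := by
    rw [rk_covBy (bot_covBy_iff.2 ha), rk_bot]
  rw [tBdry_of_not (p := p) (q := p) (fun h => lt_irrefl _ h.lt), LinearMap.zero_apply, hr, pow_one,
    Finset.sum_eq_single (⊥ : P)] at h
  · rw [tBdry_osGen ha, tMul_one, neg_one_smul] at h
    exact (eq_of_sub_eq_zero ((sub_eq_add_neg _ _).trans h.symm)).symm
  · intro u _ hu
    rw [tBdry_of_not (p := a) (q := u) (fun h => hu (ha.2 u h.lt)), LinearMap.zero_apply, map_zero,
      LinearMap.zero_apply]
  · simp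

variable (R) in
/-- By `eq_sum_tMul_tBdry`, `∂` embeds the part of order `p ≠ ⊥` as a direct summand into the sum of
the parts of order covered by `p`. -/
theorem flat_topMod (p : P) : Module.Flat R (TopMod R p) := by
  classical
  induction hn : rk p using Nat.strong_induction_on generalizing p with
  | _ n ih =>
    subst hn
    rcases eq_bot_or_exists_atom_le p with rfl | ⟨a, ha, hap⟩
    · exact flat_topMod_bot
    · have hflat : ∀ v : {v : P // v ⋖ p}, Module.Flat R (TopMod R v.1) := fun v =>
        ih _ (rk_lt v.2.lt) v.1 rfl
      have : Module.Flat R (∀ v : {v : P // v ⋖ p}, TopMod R v.1) :=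
        Module.Flat.of_linearEquiv
          (DirectSum.linearEquivFunOnFintype R {v : P // v ⋖ p} (fun v => TopMod R v.1)).symm
      refine Module.Flat.of_retract (LinearMap.pi fun v : {v : P // v ⋖ p} => tBdry R p v.1)
        (∑ v : {v : P // v ⋖ p},
          tMul R a v.1 p (topGen ha) ∘ₗ LinearMap.proj v)
        (LinearMap.ext fun x => ?_)
      refine Eq.trans ?_ (eq_sum_tMul_tBdry ha hap x)
      rw [LinearMap.comp_apply, LinearMap.sum_apply]
      simp only [LinearMap.comp_apply, LinearMap.proj_apply, LinearMap.pi_apply]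
      rw [← Finset.sum_subtype (Finset.univ.filter (· ⋖ p)) (by simp)
        (fun v => tMul R a v p (topGen ha) (tBdry R p v x))]
      refine Finset.sum_subset (Finset.subset_univ _) fun v _ hv => ?_
      rw [tBdry_of_not (by simpa using hv), LinearMap.zero_apply, map_zero]

end Flat

/-! ### Homogeneous components and cohomology classes of cochains -/

namespace CochainPresheaf

variable {R : Type v} [CommRing R] {P : Type u} [PartialOrder P] (C : CochainPresheaf.{u, v, w} R P)

/-- The component of degree `i` of a cochain. -/
def pr (p : P) (i : ℤ) : C.obj p →ₗ[R] C.obj p :=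
  (C.gr p i).subtype ∘ₗ DirectSum.component R ℤ (fun i => C.gr p i) i ∘ₗ
    (LinearEquiv.ofBijective (DirectSum.coeLinearMap (C.gr p)) (C.isInternal p)).symm.toLinearMap

theorem pr_mem (p : P) (i : ℤ) (c : C.obj p) : C.pr p i c ∈ C.gr p i := Subtype.prop _

theorem decompose_of_mem {p : P} {i : ℤ} {c : C.obj p} (hc : c ∈ C.gr p i) :
    (LinearEquiv.ofBijective (DirectSum.coeLinearMap (C.gr p)) (C.isInternal p)).symm c =
      DirectSum.lof R ℤ (fun i => C.gr p i) i ⟨c, hc⟩ := by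
  rw [LinearEquiv.symm_apply_eq]
  exact (DirectSum.coeLinearMap_lof (C.gr p) i ⟨c, hc⟩).symm

theorem pr_of_mem {p : P} {i : ℤ} {c : C.obj p} (hc : c ∈ C.gr p i) : C.pr p i c = c := by
  simp only [pr, LinearMap.comp_apply, LinearEquiv.coe_coe, C.decompose_of_mem hc,
    DirectSum.component.lof_self, Submodule.subtype_apply]

theorem pr_of_mem_of_ne {p : P} {i j : ℤ} {c : C.obj p} (hc : c ∈ C.gr p j) (h : i ≠ j) :
    C.pr p i c = 0 := by
  simp only [pr, LinearMap.comp_apply, LinearEquiv.coe_coe, C.decompose_of_mem hc,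
    DirectSum.component.of, dif_neg h.symm, map_zero]

theorem pr_δ (p : P) (i : ℤ) (c : C.obj p) : C.pr p (i + 1) (C.δ p c) = C.δ p (C.pr p i c) := by
  refine C.gr_induction c (fun j c hc => ?_) (by simp) (fun c c' h h' => by simp [h, h'])
  by_cases hij : i = j
  · subst hij
    rw [C.pr_of_mem hc, C.pr_of_mem (C.δ_mem p i c hc)]
  · rw [C.pr_of_mem_of_ne hc hij, C.pr_of_mem_of_ne (C.δ_mem p j c hc) (by omega), map_zero]

theorem pr_resTo (p q : P) (i : ℤ) (c : C.obj p) :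
    C.pr q i (C.resTo p q c) = C.resTo p q (C.pr p i c) := by
  refine C.gr_induction c (fun j c hc => ?_) (by simp) (fun c c' h h' => by simp [h, h'])
  by_cases hij : i = j
  · subst hij
    rw [C.pr_of_mem hc, C.pr_of_mem (C.resTo_mem p q hc)]
  · rw [C.pr_of_mem_of_ne hc hij, C.pr_of_mem_of_ne (C.resTo_mem p q hc) hij, map_zero]

theorem exists_sum_pr {p : P} (c : C.obj p) :
    ∃ S : Finset ℤ, ∀ T, S ⊆ T → ∑ i ∈ T, C.pr p i c = c := by
  refine C.gr_induction c (fun j c hc => ⟨{j}, fun T hT => ?_⟩) ⟨∅, by simp⟩ ?_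
  · rw [Finset.sum_eq_single j (fun i _ hi => C.pr_of_mem_of_ne hc hi), C.pr_of_mem hc]
    exact fun h => absurd (hT (Finset.mem_singleton_self j)) h
  · rintro c c' ⟨S, hS⟩ ⟨S', hS'⟩
    refine ⟨S ∪ S', fun T hT => ?_⟩
    simp only [map_add, Finset.sum_add_distrib]
    rw [hS T (Finset.union_subset_left hT), hS' T (Finset.union_subset_right hT)]

theorem pr_mem_ker {p : P} (i : ℤ) {c : C.obj p} (hc : c ∈ LinearMap.ker (C.δ p)) :
    C.pr p i c ∈ LinearMap.ker (C.δ p) := by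
  rw [LinearMap.mem_ker] at hc ⊢
  rw [← C.pr_δ, hc, map_zero]

/-- Cocycles are sums of homogeneous cocycles. -/
@[elab_as_elim]
theorem ker_induction {p : P} {motive : LinearMap.ker (C.δ p) → Prop} (c : LinearMap.ker (C.δ p))
    (mem : ∀ i, ∀ c : LinearMap.ker (C.δ p), (c : C.obj p) ∈ C.gr p i → motive c)
    (zero : motive 0) (add : ∀ c c', motive c → motive c' → motive (c + c')) : motive c := by
  obtain ⟨S, hS⟩ := C.exists_sum_pr (c : C.obj p)
  have h : c = ∑ i ∈ S, (⟨C.pr p i c, C.pr_mem_ker i c.2⟩ : LinearMap.ker (C.δ p)) :=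
    Subtype.ext (by rw [AddSubmonoidClass.coe_finsetSum]; exact (hS S subset_rfl).symm)
  rw [h]
  exact Finset.sum_induction _ _ add zero fun i _ => mem i _ (C.pr_mem p i c)

theorem sgn_mem_ker {p : P} {c : C.obj p} (hc : c ∈ LinearMap.ker (C.δ p)) :
    C.sgn p c ∈ LinearMap.ker (C.δ p) := by
  rw [LinearMap.mem_ker] at hc ⊢
  rw [← neg_eq_zero, ← C.sgn_δ, hc, map_zero]

end CochainPresheaf

namespace MonoidalDGAPresheaf

variable {R : Type v} [CommRing R] {P : Type u} [PartialOrder P] [Fintype P]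
  (C : MonoidalDGAPresheaf.{u, v, w} R P)

/-- The cohomology class of a cocycle, as an element of the cohomology presheaf. -/
def cocls (p : P) : LinearMap.ker (C.δ p) →ₗ[R] C.cohomology.obj p :=
  ((LinearMap.range (C.δ p)).submoduleOf (LinearMap.ker (C.δ p))).mkQ

theorem cocls_surjective (p : P) : Function.Surjective (C.cocls p) := Submodule.mkQ_surjective _

theorem cocls_eq_zero_iff {p : P} {c : LinearMap.ker (C.δ p)} :
    C.cocls p c = 0 ↔ (c : C.obj p) ∈ LinearMap.range (C.δ p) := Submodule.Quotient.mk_eq_zero _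

theorem cocls_mem {p : P} {i : ℤ} {c : LinearMap.ker (C.δ p)} (hc : (c : C.obj p) ∈ C.gr p i) :
    C.cocls p c ∈ C.cohomology.gr p i := C.mem_cohGr.2 ⟨c, c.2, hc, rfl⟩

theorem resTo_cocls (p q : P) (c : LinearMap.ker (C.δ p)) :
    C.cohomology.resTo p q (C.cocls p c) = C.cocls q ⟨C.resTo p q c, C.resTo_mem_ker c.2⟩ :=
  C.cohPresheaf_resTo p q c c.2

theorem mul_cocls (p q s : P) (a : LinearMap.ker (C.δ p)) (b : LinearMap.ker (C.δ q)) :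
    C.cohomology.mul p q s (C.cocls p a) (C.cocls q b) =
      C.cocls s ⟨C.mul p q s a b, C.mul_mem_ker a.2 b.2⟩ := rfl

theorem pr_cocls (p : P) (i : ℤ) (c : LinearMap.ker (C.δ p)) :
    C.cohomology.pr p i (C.cocls p c) = C.cocls p ⟨C.pr p i c, C.pr_mem_ker i c.2⟩ := by
  refine C.ker_induction c (fun j c hc => ?_) ?_ (fun c c' h h' => ?_)
  · by_cases hij : i = j
    · subst hij
      rw [C.cohomology.pr_of_mem (C.cocls_mem hc)]
      exact congrArg (C.cocls p) (Subtype.ext (C.pr_of_mem hc).symm)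
    · rw [C.cohomology.pr_of_mem_of_ne (C.cocls_mem hc) hij]
      symm
      rw [cocls_eq_zero_iff]
      exact ⟨0, (map_zero _).trans (C.pr_of_mem_of_ne hc hij).symm⟩
  · rw [map_zero, map_zero]
    symm
    rw [cocls_eq_zero_iff]
    exact ⟨0, by simp⟩
  · rw [map_add, map_add, h, h', ← map_add]
    exact congrArg (C.cocls p) (Subtype.ext (map_add _ _ _).symm)

theorem sgn_cocls (p : P) (c : LinearMap.ker (C.δ p)) :
    C.cohomology.sgn p (C.cocls p c) = C.cocls p ⟨C.sgn p c, C.sgn_mem_ker c.2⟩ := by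
  refine C.ker_induction c (fun j c hc => ?_) ?_ (fun c c' h h' => ?_)
  · rw [C.cohomology.sgn_of_mem (C.cocls_mem hc), ← map_zsmul]
    exact congrArg (C.cocls p) (Subtype.ext (C.sgn_of_mem hc).symm)
  · rw [map_zero, map_zero]
    symm
    rw [cocls_eq_zero_iff]
    exact ⟨0, by simp⟩
  · rw [map_add, map_add, h, h', ← map_add]
    exact congrArg (C.cocls p) (Subtype.ext (map_add _ _ _).symm)

theorem sgn_pow_mem_ker {p : P} (n : ℕ) {c : C.obj p} (hc : c ∈ LinearMap.ker (C.δ p)) :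
    ((C.sgn p) ^ n) c ∈ LinearMap.ker (C.δ p) := by
  induction n with
  | zero => simpa using hc
  | succ n ih =>
    rw [pow_succ', Module.End.mul_apply]
    exact C.sgn_mem_ker ih

theorem sgn_pow_cocls (p : P) (n : ℕ) (c : LinearMap.ker (C.δ p)) :
    ((C.cohomology.sgn p) ^ n) (C.cocls p c) =
      C.cocls p ⟨((C.sgn p) ^ n) c, C.sgn_pow_mem_ker n c.2⟩ := by
  induction n with
  | zero => simp
  | succ n ih =>
    rw [pow_succ', Module.End.mul_apply, ih, sgn_cocls]
    exact congrArg (C.cocls p) (Subtype.ext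
      (LinearMap.congr_fun (pow_succ' (C.sgn p) n) (c : C.obj p)).symm)

end MonoidalDGAPresheaf

/-! ### Bihomogeneous components of `A*(P, C)` -/

namespace OSC

set_option linter.unusedSectionVars false

variable {R : Type v} [CommRing R] {P : Type u} [PartialOrder P] [OrderBot P] [Fintype P]
  [LocallyGeometric P] (C : MonoidalDGAPresheaf.{u, v, w} R P)

/-- The projection of `A*([⊥,p])_p ⊗ C_p` onto the part of degree `j` in the direction of `C`. -/
def prAt (p : P) (j : ℤ) : TopMod R p ⊗[R] C.obj p →ₗ[R] TopMod R p ⊗[R] C.obj p :=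
  (C.pr p j).lTensor (TopMod R p)

theorem prAt_mem (p : P) (j : ℤ) (X : TopMod R p ⊗[R] C.obj p) : prAt C p j X ∈ part C p j := by
  induction X using TensorProduct.induction_on with
  | zero => rw [map_zero]; exact zero_mem _
  | add X Y hX hY => rw [map_add]; exact add_mem hX hY
  | tmul x c =>
    rw [prAt, LinearMap.lTensor_tmul]
    exact tmul_mem_part C _ (C.pr_mem p j c)

theorem prAt_of_mem {p : P} {j : ℤ} {X : TopMod R p ⊗[R] C.obj p} (hX : X ∈ part C p j) :
    prAt C p j X = X := by
  refine part_induction C hX (map_zero _) (fun X Y hX hY => by rw [map_add, hX, hY]) ?_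
  intro x c hc
  rw [prAt, LinearMap.lTensor_tmul, C.pr_of_mem hc]

theorem prAt_of_mem_of_ne {p : P} {i j : ℤ} {X : TopMod R p ⊗[R] C.obj p} (hX : X ∈ part C p j)
    (h : i ≠ j) : prAt C p i X = 0 := by
  refine part_induction C hX (map_zero _) (fun X Y hX hY => by rw [map_add, hX, hY, add_zero]) ?_
  intro x c hc
  rw [prAt, LinearMap.lTensor_tmul, C.pr_of_mem_of_ne hc h, TensorProduct.tmul_zero]

theorem prAt_lTensor_δ (p : P) (j : ℤ) (X : TopMod R p ⊗[R] C.obj p) :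
    prAt C p (j + 1) ((C.δ p).lTensor (TopMod R p) X) =
      (C.δ p).lTensor (TopMod R p) (prAt C p j X) := by
  induction X using TensorProduct.induction_on with
  | zero => simp
  | add X Y hX hY => simp only [map_add, hX, hY]
  | tmul x c => simp only [prAt, LinearMap.lTensor_tmul, C.pr_δ]

theorem prAt_pdComp (p t : P) (j : ℤ) (X : TopMod R p ⊗[R] C.obj p) :
    prAt C t j (pdComp C p t X) = pdComp C p t (prAt C p j X) := by
  induction X using TensorProduct.induction_on with
  | zero => simp
  | add X Y hX hY => simp only [map_add, hX, hY]
  | tmul x c => simp only [prAt, pdComp, TensorProduct.map_tmul, LinearMap.lTensor_tmul, C.pr_resTo]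

theorem exists_sum_prAt {p : P} (X : TopMod R p ⊗[R] C.obj p) :
    ∃ S : Finset ℤ, ∀ T, S ⊆ T → ∑ j ∈ T, prAt C p j X = X := by
  induction X using TensorProduct.induction_on with
  | zero => exact ⟨∅, by simp⟩
  | add X Y hX hY =>
    obtain ⟨S, hS⟩ := hX
    obtain ⟨S', hS'⟩ := hY
    refine ⟨S ∪ S', fun T hT => ?_⟩
    simp only [map_add, Finset.sum_add_distrib]
    rw [hS T (Finset.union_subset_left hT), hS' T (Finset.union_subset_right hT)]
  | tmul x c =>
    obtain ⟨S, hS⟩ := C.exists_sum_pr c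
    refine ⟨S, fun T hT => ?_⟩
    simp only [prAt, LinearMap.lTensor_tmul]
    rw [← TensorProduct.tmul_sum, hS T hT]

open Classical in
/-- The projection of `A*(P, C)` onto the column `col C k`. -/
def colPr (k : ℤ) : OSC C →ₗ[R] OSC C :=
  LinearMap.pi fun p => if (rk p : ℤ) = -k then LinearMap.proj p else 0

/-- The projection of `A*(P, C)` onto the part of degree `j` in the direction of `C`. -/
def rowPr (j : ℤ) : OSC C →ₗ[R] OSC C :=
  LinearMap.pi fun p => prAt C p j ∘ₗ LinearMap.proj p

/-- The projection of `A*(P, C)` onto the part of total degree `n`. -/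
def degPr (n : ℤ) : OSC C →ₗ[R] OSC C :=
  LinearMap.pi fun p => prAt C p (n + rk p) ∘ₗ LinearMap.proj p

theorem colPr_apply_of {k : ℤ} (f : OSC C) {p : P} (h : (rk p : ℤ) = -k) :
    colPr C k f p = f p := by
  simp [colPr, h]

theorem colPr_apply_of_ne {k : ℤ} (f : OSC C) {p : P} (h : (rk p : ℤ) ≠ -k) :
    colPr C k f p = 0 := by
  simp [colPr, h]

theorem rowPr_apply (j : ℤ) (f : OSC C) (p : P) : rowPr C j f p = prAt C p j (f p) := rfl

theorem degPr_apply (n : ℤ) (f : OSC C) (p : P) : degPr C n f p = prAt C p (n + rk p) (f p) := rfl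

theorem bi_le_fil (k j : ℤ) : bi C k j ≤ fil C k := fun _ hf p hp => (hf p).2 (by omega)

theorem bi_le_deg {k j n : ℤ} (h : k + j = n) : bi C k j ≤ deg C n := by
  subst h
  intro f hf p
  by_cases hp : (rk p : ℤ) = -k
  · have h1 := (hf p).1
    rwa [show j = k + j + rk p by omega] at h1
  · rw [(hf p).2 hp]
    exact zero_mem _

theorem fil_eq_bot {k : ℤ} (hk : 0 < k) {f : OSC C} (hf : f ∈ fil C k) : f = 0 :=
  funext fun p => hf p (by omega)

theorem exists_fil_eq_top : ∃ m : ℤ, ∀ f : OSC C, f ∈ fil C m := by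
  refine ⟨-((Finset.univ.sup fun p : P => rk p : ℕ) : ℤ), fun f p hp => ?_⟩
  have := Finset.le_sup (f := fun p : P => rk p) (Finset.mem_univ p)
  omega

theorem colPr_of_mem_bi {k j : ℤ} {f : OSC C} (hf : f ∈ bi C k j) : colPr C k f = f := by
  funext p
  by_cases hp : (rk p : ℤ) = -k
  · exact colPr_apply_of C f hp
  · rw [colPr_apply_of_ne C f hp, (hf p).2 hp]

theorem colPr_of_mem_fil {k l : ℤ} (h : l < k) {f : OSC C} (hf : f ∈ fil C k) :
    colPr C l f = 0 := by
  funext p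
  by_cases hp : (rk p : ℤ) = -l
  · rw [colPr_apply_of C f hp, hf p (by omega)]; rfl
  · exact colPr_apply_of_ne C f hp

theorem mem_fil_succ {k : ℤ} {f : OSC C} (hf : f ∈ fil C k) (h : colPr C k f = 0) :
    f ∈ fil C (k + 1) := by
  intro p hp
  by_cases hp' : (rk p : ℤ) = -k
  · rw [← colPr_apply_of C f hp', h]; rfl
  · exact hf p (by omega)

theorem colPr_mem_bi {k j n : ℤ} (h : k + j = n) {f : OSC C} (hf : f ∈ deg C n) :
    colPr C k f ∈ bi C k j := by
  intro p
  by_cases hp : (rk p : ℤ) = -k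
  · refine ⟨?_, fun h => absurd hp h⟩
    rw [colPr_apply_of C f hp]
    have h1 := hf p
    rwa [show n + (rk p : ℤ) = j by omega] at h1
  · rw [colPr_apply_of_ne C f hp]
    exact ⟨zero_mem _, fun _ => rfl⟩

theorem rowPr_colPr_mem_bi (k j : ℤ) (f : OSC C) : rowPr C j (colPr C k f) ∈ bi C k j := by
  intro p
  refine ⟨prAt_mem C p j _, fun hp => ?_⟩
  rw [rowPr_apply, colPr_apply_of_ne C f hp, map_zero]

theorem rowPr_of_mem_bi {k j : ℤ} {f : OSC C} (hf : f ∈ bi C k j) : rowPr C j f = f :=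
  funext fun p => prAt_of_mem C (hf p).1

theorem rowPr_of_mem_bi_of_ne {k i j : ℤ} {f : OSC C} (hf : f ∈ bi C k j) (h : i ≠ j) :
    rowPr C i f = 0 :=
  funext fun p => prAt_of_mem_of_ne C (hf p).1 h

theorem colPr_of_mem_bi_of_ne {k l j : ℤ} {f : OSC C} (hf : f ∈ bi C k j) (h : l ≠ k) :
    colPr C l f = 0 := by
  funext p
  by_cases hp : (rk p : ℤ) = -l
  · rw [colPr_apply_of C f hp, (hf p).2 (by omega)]; rfl
  · exact colPr_apply_of_ne C f hp

theorem colPr_pd (k : ℤ) (f : OSC C) : colPr C (k + 1) (pd C f) = pd C (colPr C k f) := by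
  funext t
  rw [pd_apply]
  by_cases ht : (rk t : ℤ) = -(k + 1)
  · rw [colPr_apply_of C _ ht, pd_apply]
    refine Finset.sum_congr rfl fun p _ => ?_
    by_cases hp : t ⋖ p
    · rw [colPr_apply_of C f (by have := rk_covBy hp; omega)]
    · rw [pdComp_of_not C hp]; rfl
  · rw [colPr_apply_of_ne C _ ht]
    symm
    refine Finset.sum_eq_zero fun p _ => ?_
    by_cases hp : t ⋖ p
    · rw [colPr_apply_of_ne C f (by have := rk_covBy hp; omega), map_zero]
    · rw [pdComp_of_not C hp]; rfl

theorem colPr_dl (k : ℤ) (f : OSC C) : colPr C k (dl C f) = dl C (colPr C k f) := by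
  funext p
  rw [dl_apply]
  by_cases hp : (rk p : ℤ) = -k
  · rw [colPr_apply_of C _ hp, colPr_apply_of C _ hp, dl_apply]
  · rw [colPr_apply_of_ne C _ hp, colPr_apply_of_ne C _ hp, map_zero, smul_zero]

theorem rowPr_pd (j : ℤ) (f : OSC C) : rowPr C j (pd C f) = pd C (rowPr C j f) := by
  funext t
  rw [rowPr_apply, pd_apply, pd_apply, map_sum]
  exact Finset.sum_congr rfl fun p _ => prAt_pdComp C p t j (f p)

theorem rowPr_dl (j : ℤ) (f : OSC C) : rowPr C (j + 1) (dl C f) = dl C (rowPr C j f) := by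
  funext p
  rw [rowPr_apply, dl_apply, dl_apply, map_smul, prAt_lTensor_δ]
  rfl

theorem degPr_mem (n : ℤ) (f : OSC C) : degPr C n f ∈ deg C n := fun p => prAt_mem C p _ _

theorem degPr_of_mem {n : ℤ} {f : OSC C} (hf : f ∈ deg C n) : degPr C n f = f :=
  funext fun p => prAt_of_mem C (hf p)

theorem degPr_pd (n : ℤ) (f : OSC C) : degPr C (n + 1) (pd C f) = pd C (degPr C n f) := by
  funext t
  rw [degPr_apply, pd_apply, pd_apply, map_sum]
  refine Finset.sum_congr rfl fun p _ => ?_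
  by_cases hp : t ⋖ p
  · rw [prAt_pdComp, degPr_apply, show n + 1 + (rk t : ℤ) = n + rk p by
      rw [rk_covBy hp]; push_cast; ring]
  · rw [pdComp_of_not C hp]; simp

theorem degPr_dl (n : ℤ) (f : OSC C) : degPr C (n + 1) (dl C f) = dl C (degPr C n f) := by
  funext p
  rw [degPr_apply, dl_apply, dl_apply, map_smul, show n + 1 + (rk p : ℤ) = n + rk p + 1 by ring,
    prAt_lTensor_δ]
  rfl

theorem exists_sum_rowPr (f : OSC C) : ∃ S : Finset ℤ, ∑ j ∈ S, rowPr C j f = f := by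
  classical
  choose S hS using fun p => exists_sum_prAt C (f p)
  refine ⟨Finset.univ.biUnion S, funext fun p => ?_⟩
  rw [Finset.sum_apply]
  exact hS p _ (Finset.subset_biUnion_of_mem S (Finset.mem_univ p))

theorem pd_mem_bi {k l j : ℤ} (h : k + 1 = l) {f : OSC C} (hf : f ∈ bi C k j) :
    pd C f ∈ bi C l j := by
  subst h
  have h1 : pd C f = rowPr C j (colPr C (k + 1) (pd C f)) := by
    rw [colPr_pd, rowPr_pd, colPr_of_mem_bi C hf, rowPr_of_mem_bi C hf]
  rw [h1]
  exact rowPr_colPr_mem_bi C _ _ _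

/-- The leading column of a product is the product of the leading columns. -/
theorem colPr_mul {k l : ℤ} {f g : OSC C} (hf : f ∈ fil C k) (hg : g ∈ fil C l) :
    colPr C (k + l) (mul C f g) = mul C (colPr C k f) (colPr C l g) := by
  funext s
  rw [mul_apply]
  by_cases hs : (rk s : ℤ) = -(k + l)
  · rw [colPr_apply_of C _ hs, mul_apply]
    refine Finset.sum_congr rfl fun p _ => Finset.sum_congr rfl fun q _ => ?_
    by_cases hr : rk s = rk p + rk q
    · by_cases hp : (rk p : ℤ) = -k
      · rw [colPr_apply_of C f hp, colPr_apply_of C g (by omega)]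
      · rw [colPr_apply_of_ne C f hp, map_zero, LinearMap.zero_apply]
        by_cases hp' : -k < (rk p : ℤ)
        · rw [hf p hp', map_zero, LinearMap.zero_apply]
        · rw [hg q (by omega), map_zero]
    · rw [mulComp_of_rk C hr]; rfl
  · rw [colPr_apply_of_ne C _ hs]
    symm
    refine Finset.sum_eq_zero fun p _ => Finset.sum_eq_zero fun q _ => ?_
    by_cases hr : rk s = rk p + rk q
    · by_cases hp : (rk p : ℤ) = -k
      · rw [colPr_apply_of_ne C g (by omega), map_zero]
      · rw [colPr_apply_of_ne C f hp, map_zero, LinearMap.zero_apply]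
    · rw [mulComp_of_rk C hr]; rfl

end OSC

/-! ### Representatives of elements of `A*(P, H^*(C))` -/

namespace OSC

set_option linter.unusedSectionVars false

variable {R : Type v} [CommRing R] {P : Type u} [PartialOrder P] [OrderBot P] [Fintype P]
  [LocallyGeometric P] (C : MonoidalDGAPresheaf.{u, v, w} R P)

/-- `X ∈ A*([⊥,p])_p ⊗ C_p` represents `h ∈ A*([⊥,p])_p ⊗ H^*(C_p)` if both are images of one
element of `A*([⊥,p])_p ⊗ ker δ`. -/
def IsRepAt (p : P) (X : TopMod R p ⊗[R] C.obj p) (h : TopMod R p ⊗[R] C.cohomology.obj p) : Prop :=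
  ∃ y : TopMod R p ⊗[R] LinearMap.ker (C.δ p),
    (LinearMap.ker (C.δ p)).subtype.lTensor (TopMod R p) y = X ∧
      (C.cocls p).lTensor (TopMod R p) y = h

variable {C}

namespace IsRepAt

variable {p : P} {X Y : TopMod R p ⊗[R] C.obj p} {h g : TopMod R p ⊗[R] C.cohomology.obj p}

theorem add (hX : IsRepAt C p X h) (hY : IsRepAt C p Y g) : IsRepAt C p (X + Y) (h + g) := by
  obtain ⟨x, rfl, rfl⟩ := hX
  obtain ⟨y, rfl, rfl⟩ := hY
  exact ⟨x + y, map_add _ _ _, map_add _ _ _⟩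

theorem smul (r : R) (hX : IsRepAt C p X h) : IsRepAt C p (r • X) (r • h) := by
  obtain ⟨x, rfl, rfl⟩ := hX
  exact ⟨r • x, map_smul _ _ _, map_smul _ _ _⟩

theorem zero : IsRepAt C p 0 0 := ⟨0, map_zero _, map_zero _⟩

theorem sum {ι : Type*} (s : Finset ι) {x : ι → TopMod R p ⊗[R] C.obj p}
    {y : ι → TopMod R p ⊗[R] C.cohomology.obj p} (hxy : ∀ i ∈ s, IsRepAt C p (x i) (y i)) :
    IsRepAt C p (∑ i ∈ s, x i) (∑ i ∈ s, y i) := by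
  classical
  induction s using Finset.induction_on with
  | empty => exact zero
  | insert i s hi ih =>
    rw [Finset.sum_insert hi, Finset.sum_insert hi]
    exact (hxy i (by simp)).add (ih fun j hj => hxy j (by simp [hj]))

theorem lTensor_δ_eq_zero (hX : IsRepAt C p X h) : (C.δ p).lTensor (TopMod R p) X = 0 := by
  obtain ⟨x, rfl, rfl⟩ := hX
  rw [← LinearMap.comp_apply, ← LinearMap.lTensor_comp]
  have : C.δ p ∘ₗ (LinearMap.ker (C.δ p)).subtype = 0 := LinearMap.ext fun c => c.2
  rw [this, LinearMap.lTensor_zero, LinearMap.zero_apply]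

/-- By flatness of `A*([⊥,p])_p`, an element represents at most one element. -/
theorem eq_zero (hX : IsRepAt C p 0 h) : h = 0 := by
  obtain ⟨x, hx, rfl⟩ := hX
  have := flat_topMod R p
  have hinj := Module.Flat.lTensor_preserves_injective_linearMap (M := TopMod R p)
    (LinearMap.ker (C.δ p)).subtype (Submodule.injective_subtype _)
  rw [hinj (hx.trans (map_zero _).symm), map_zero]

/-- By flatness of `A*([⊥,p])_p`, the kernel of `1 ⊗ δ` comes from `A*([⊥,p])_p ⊗ ker δ`. -/
theorem exists_of_cycle (hX : (C.δ p).lTensor (TopMod R p) X = 0) : ∃ h, IsRepAt C p X h := by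
  have := flat_topMod R p
  have hex := Module.Flat.lTensor_exact (TopMod R p) (LinearMap.exact_subtype_ker_map (C.δ p))
  obtain ⟨x, rfl⟩ := (hex X).1 hX
  exact ⟨_, x, rfl, rfl⟩

theorem exists_rep (h : TopMod R p ⊗[R] C.cohomology.obj p) : ∃ X, IsRepAt C p X h := by
  obtain ⟨x, rfl⟩ := LinearMap.lTensor_surjective (TopMod R p) (C.cocls_surjective p) h
  exact ⟨_, x, rfl, rfl⟩

theorem lTensor_δ (X : TopMod R p ⊗[R] C.obj p) :
    IsRepAt C p ((C.δ p).lTensor (TopMod R p) X) 0 := by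
  let δ' : C.obj p →ₗ[R] LinearMap.ker (C.δ p) := (C.δ p).codRestrict _ (C.δ_δ p)
  refine ⟨δ'.lTensor (TopMod R p) X, ?_, ?_⟩
  · rw [← LinearMap.comp_apply, ← LinearMap.lTensor_comp]
    rfl
  · have : C.cocls p ∘ₗ δ' = 0 :=
      LinearMap.ext fun c => C.cocls_eq_zero_iff.2 ⟨c, rfl⟩
    rw [← LinearMap.comp_apply, ← LinearMap.lTensor_comp, this, LinearMap.lTensor_zero,
      LinearMap.zero_apply]

/-- The kernel of `A*([⊥,p])_p ⊗ ker δ → A*([⊥,p])_p ⊗ H^*(C_p)` comes from `A*([⊥,p])_p ⊗ C_p`, by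
right exactness of the tensor product. -/
theorem exists_eq_lTensor_δ (hX : IsRepAt C p X 0) :
    ∃ Y, X = (C.δ p).lTensor (TopMod R p) Y := by
  obtain ⟨x, rfl, hx⟩ := hX
  let δ' : C.obj p →ₗ[R] LinearMap.ker (C.δ p) := (C.δ p).codRestrict _ (C.δ_δ p)
  have hex : Function.Exact δ' (C.cocls p) := fun c => by
    rw [C.cocls_eq_zero_iff]
    exact ⟨fun ⟨b, hb⟩ => ⟨b, Subtype.ext hb⟩, fun ⟨b, hb⟩ => ⟨b, congrArg Subtype.val hb⟩⟩
  obtain ⟨y, rfl⟩ := (_root_.lTensor_exact (TopMod R p) hex (C.cocls_surjective p) x).1 hx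
  refine ⟨y, ?_⟩
  rw [← LinearMap.comp_apply, ← LinearMap.lTensor_comp]
  rfl

theorem map {q : P} (α : TopMod R p →ₗ[R] TopMod R q) (φ : C.obj p →ₗ[R] C.obj q)
    (ψ : C.cohomology.obj p →ₗ[R] C.cohomology.obj q)
    (hφ : ∀ c : LinearMap.ker (C.δ p), ∃ hc : φ c ∈ LinearMap.ker (C.δ q),
      ψ (C.cocls p c) = C.cocls q ⟨φ c, hc⟩) (hX : IsRepAt C p X h) :
    IsRepAt C q (TensorProduct.map α φ X) (TensorProduct.map α ψ h) := by
  obtain ⟨x, rfl, rfl⟩ := hX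
  induction x using TensorProduct.induction_on with
  | zero => simpa using zero
  | add x y hx hy => simpa only [map_add] using hx.add hy
  | tmul x c =>
    obtain ⟨hc, hψ⟩ := hφ c
    exact ⟨α x ⊗ₜ ⟨φ c, hc⟩, by simp, by simp [hψ]⟩

theorem pdComp (q : P) (hX : IsRepAt C p X h) :
    IsRepAt C q (pdComp C p q X) (pdComp C.cohomology p q h) :=
  hX.map _ _ _ fun c => ⟨_, C.resTo_cocls p q c⟩

theorem prAt (j : ℤ) (hX : IsRepAt C p X h) : IsRepAt C p (prAt C p j X) (prAt C.cohomology p j h) :=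
  hX.map _ _ _ fun c => ⟨_, C.pr_cocls p j c⟩

theorem mulComp {q s : P} {Y : TopMod R q ⊗[R] C.obj q} {g : TopMod R q ⊗[R] C.cohomology.obj q}
    (hX : IsRepAt C p X h) (hY : IsRepAt C q Y g) :
    IsRepAt C s (mulComp C p q s X Y) (mulComp C.cohomology p q s h g) := by
  obtain ⟨x, rfl, rfl⟩ := hX
  obtain ⟨y, rfl, rfl⟩ := hY
  induction x using TensorProduct.induction_on with
  | zero => simpa using zero
  | add x y hx hy => simpa only [map_add, LinearMap.add_apply] using hx.add hy
  | tmul x c =>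
    induction y using TensorProduct.induction_on with
    | zero => simpa using zero
    | add x y hx hy => simpa only [map_add] using hx.add hy
    | tmul y b =>
      refine ⟨tMul R p q s x y ⊗ₜ ⟨C.mul p q s (((C.sgn p) ^ rk q) c) b,
        C.mul_mem_ker (C.sgn_pow_mem_ker _ c.2) b.2⟩, ?_, ?_⟩
      · simp only [LinearMap.lTensor_tmul, mulComp_tmul, Submodule.subtype_apply]
      · simp only [LinearMap.lTensor_tmul, mulComp_tmul]
        rw [C.sgn_pow_cocls, C.mul_cocls]

end IsRepAt

variable (C) in
/-- `x ∈ A*(P, C)` represents `h ∈ A*(P, H^*(C))` if it does so in every component. This relation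
identifies `A*(P, H^*(C))` with the `δ`-cohomology of `A*(P, C)`. -/
def IsRep (x : OSC C) (h : OSC C.cohomology) : Prop := ∀ p, IsRepAt C p (x p) (h p)

namespace IsRep

variable {x y : OSC C} {h g : OSC C.cohomology}

theorem add (hx : IsRep C x h) (hy : IsRep C y g) : IsRep C (x + y) (h + g) :=
  fun p => (hx p).add (hy p)

theorem smul (r : R) (hx : IsRep C x h) : IsRep C (r • x) (r • h) := fun p => (hx p).smul r

theorem neg (hx : IsRep C x h) : IsRep C (-x) (-h) := by
  simpa using hx.smul (-1)

theorem sub (hx : IsRep C x h) (hy : IsRep C y g) : IsRep C (x - y) (h - g) := by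
  simpa only [sub_eq_add_neg] using hx.add hy.neg

variable (C) in
theorem zero : IsRep C 0 0 := fun _ => IsRepAt.zero

theorem dl_eq_zero (hx : IsRep C x h) : dl C x = 0 := by
  funext p
  rw [dl_apply, (hx p).lTensor_δ_eq_zero, smul_zero]; rfl

theorem exists_of_cycle (hx : dl C x = 0) : ∃ h, IsRep C x h := by
  have h1 : ∀ p, (C.δ p).lTensor (TopMod R p) (x p) = 0 := fun p => by
    rw [← neg_one_pow_smul_smul (R := R) (rk p) ((C.δ p).lTensor (TopMod R p) (x p)), ← dl_apply, hx]
    exact smul_zero _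
  choose h hh using fun p => IsRepAt.exists_of_cycle (h1 p)
  exact ⟨h, hh⟩

variable (C) in
theorem dl (y : OSC C) : IsRep C (dl C y) 0 := fun p => by
  rw [dl_apply]
  simpa using (IsRepAt.lTensor_δ (y p)).smul ((-1 : R) ^ rk p)

theorem unique (hx : IsRep C x h) (hx' : IsRep C x g) : h = g := by
  have h1 := hx.sub hx'
  rw [sub_self] at h1
  exact sub_eq_zero.1 (funext fun p => (h1 p).eq_zero)

theorem exists_eq_dl (hx : IsRep C x 0) : ∃ y, x = OSC.dl C y := by
  choose y hy using fun p => (hx p).exists_eq_lTensor_δ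
  refine ⟨fun p => (-1 : R) ^ rk p • y p, funext fun p => ?_⟩
  rw [dl_apply, map_smul, neg_one_pow_smul_smul, hy]

theorem pd (hx : IsRep C x h) : IsRep C (pd C x) (pd C.cohomology h) := fun t => by
  rw [pd_apply, pd_apply]
  exact IsRepAt.sum _ fun p _ => (hx p).pdComp t

theorem rowPr (j : ℤ) (hx : IsRep C x h) : IsRep C (rowPr C j x) (rowPr C.cohomology j h) :=
  fun p => (hx p).prAt j

theorem colPr (k : ℤ) (hx : IsRep C x h) : IsRep C (colPr C k x) (colPr C.cohomology k h) :=
  fun p => by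
    by_cases hp : (rk p : ℤ) = -k
    · rw [colPr_apply_of C _ hp, colPr_apply_of _ _ hp]
      exact hx p
    · rw [colPr_apply_of_ne C _ hp, colPr_apply_of_ne _ _ hp]
      exact IsRepAt.zero

theorem mul (hx : IsRep C x h) (hy : IsRep C y g) :
    IsRep C (mul C x y) (mul C.cohomology h g) := fun s => by
  rw [mul_apply, mul_apply]
  exact IsRepAt.sum _ fun p _ => IsRepAt.sum _ fun q _ => (hx p).mulComp (hy q)

theorem mem_bi {k j : ℤ} (hx : IsRep C x h) (hxb : x ∈ bi C k j) : h ∈ bi C.cohomology k j := by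
  have h1 := (hx.colPr k).rowPr j
  rw [colPr_of_mem_bi C hxb, rowPr_of_mem_bi C hxb] at h1
  rw [hx.unique h1]
  exact rowPr_colPr_mem_bi _ _ _ _

theorem exists_rep {k j : ℤ} (hh : h ∈ bi C.cohomology k j) : ∃ x ∈ bi C k j, IsRep C x h := by
  -- projecting an arbitrary representative gives a bihomogeneous one
  choose x hx using fun p => IsRepAt.exists_rep (h p)
  have h1 : IsRep C x h := hx
  have h2 := (h1.colPr k).rowPr j
  rw [colPr_of_mem_bi _ hh, rowPr_of_mem_bi _ hh] at h2
  exact ⟨_, rowPr_colPr_mem_bi _ _ _ _, h2⟩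

theorem exists_eq_dl_of_mem_bi {k i j : ℤ} (hij : i + 1 = j) (hxb : x ∈ bi C k j)
    (hx : IsRep C x 0) : ∃ y ∈ bi C k i, x = OSC.dl C y := by
  subst hij
  obtain ⟨y, rfl⟩ := hx.exists_eq_dl
  refine ⟨_, rowPr_colPr_mem_bi C k i y, ?_⟩
  rw [← rowPr_dl, ← colPr_dl, colPr_of_mem_bi C hxb, rowPr_of_mem_bi C hxb]

end IsRep

end OSC

/-! ### The second page of the spectral sequence -/

namespace OSC

set_option linter.unusedSectionVars false

variable {R : Type v} [CommRing R] {P : Type u} [PartialOrder P] [OrderBot P] [Fintype P]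
  [LocallyGeometric P] {C : MonoidalDGAPresheaf.{u, v, w} R P}

theorem mem_Z_tot {r k j : ℤ} {x : OSC C} : x ∈ (tot C).Z r k j ↔
    x ∈ fil C k ∧ x ∈ deg C (k + j) ∧ pd C x + dl C x ∈ fil C (k + r) :=
  FilteredDGA.mem_Z (D := tot C)

theorem mem_B_tot {r k j : ℤ} {x : OSC C} : x ∈ (tot C).B r k j ↔
    x ∈ fil C k ∧ x ∈ deg C (k + j) ∧
      ∃ y ∈ fil C (k - r), y ∈ deg C (k + j - 1) ∧ pd C y + dl C y = x :=
  FilteredDGA.mem_B (D := tot C)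

theorem colPr_pd_add_dl (k : ℤ) (x : OSC C) :
    colPr C k (pd C x + dl C x) = pd C (colPr C (k - 1) x) + dl C (colPr C k x) := by
  have h := colPr_pd C (k - 1) x
  rw [sub_add_cancel] at h
  rw [map_add, h, colPr_dl]

section Leading

variable {k j : ℤ} {x : OSC C} {h : OSC C.cohomology}

theorem colPr_mem_bi_of_mem_Z {r : ℤ} (hx : x ∈ (tot C).Z r k j) : colPr C k x ∈ bi C k j :=
  colPr_mem_bi C rfl (mem_Z_tot.1 hx).2.1

/-- The leading column of a cycle of the second page represents an element of `A*(P, H^*(C))`. -/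
theorem exists_isRep_colPr (hx : x ∈ (tot C).Z 2 k j) : ∃ h, IsRep C (colPr C k x) h := by
  obtain ⟨h1, -, h3⟩ := mem_Z_tot.1 hx
  apply IsRep.exists_of_cycle
  have h4 := colPr_pd_add_dl k x
  rw [colPr_of_mem_fil C (by omega) h3, colPr_of_mem_fil C (by omega) h1, map_zero, zero_add] at h4
  exact h4.symm

theorem IsRep.mem_bi_of_mem_Z (hx : x ∈ (tot C).Z 2 k j) (hh : IsRep C (OSC.colPr C k x) h) :
    h ∈ bi C.cohomology k j := hh.mem_bi (colPr_mem_bi_of_mem_Z hx)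

theorem IsRep.pd_eq_zero_of_mem_Z (hx : x ∈ (tot C).Z 2 k j) (hh : IsRep C (OSC.colPr C k x) h) :
    OSC.pd C.cohomology h = 0 := by
  obtain ⟨-, -, h3⟩ := mem_Z_tot.1 hx
  have h4 := colPr_pd_add_dl (k + 1) x
  rw [colPr_of_mem_fil C (by omega) h3, add_sub_cancel_right] at h4
  have h5 := hh.pd.add (IsRep.dl C (OSC.colPr C (k + 1) x))
  rw [← h4, add_zero] at h5
  exact h5.unique (IsRep.zero C)

/-- A `∂`-cycle of `A*(P, H^*(C))` is the leading column of a cycle of the second page: a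
representative `c` satisfies `∂ c = -δ y`, and `c + y` is the desired element. -/
theorem exists_mem_Z_of_cycle (hh : h ∈ bi C.cohomology k j) (hd : pd C.cohomology h = 0) :
    ∃ x ∈ (tot C).Z 2 k j, IsRep C (colPr C k x) h := by
  obtain ⟨c, hc, hch⟩ := IsRep.exists_rep hh
  have h1 := hch.pd
  rw [hd] at h1
  obtain ⟨y, hy, hcy⟩ := h1.exists_eq_dl_of_mem_bi (sub_add_cancel j 1) (pd_mem_bi C rfl hc)
  refine ⟨c - y, mem_Z_tot.2 ⟨sub_mem (bi_le_fil C _ _ hc) ?_, sub_mem (bi_le_deg C rfl hc)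
    (bi_le_deg C (by ring) hy), ?_⟩, ?_⟩
  · exact FilteredDGA.fil_of_le (D := tot C) (by omega) (bi_le_fil C _ _ hy)
  · have h2 : pd C (c - y) + dl C (c - y) = -pd C y := by
      rw [map_sub, map_sub, hch.dl_eq_zero, hcy]
      abel
    rw [h2]
    exact neg_mem (bi_le_fil C _ _ (pd_mem_bi C (by ring) hy))
  · rw [map_sub, colPr_of_mem_bi C hc, colPr_of_mem_bi_of_ne C hy (by omega), sub_zero]
    exact hch

/-- A bihomogeneous `∂`-boundary is the boundary of a bihomogeneous element. -/
theorem exists_mem_bi_of_pd_eq {h : OSC C} (hh : h ∈ bi C k j) {g : OSC C} (hg : pd C g = h) :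
    ∃ g ∈ bi C (k - 1) j, pd C g = h := by
  refine ⟨_, rowPr_colPr_mem_bi C (k - 1) j g, ?_⟩
  rw [← rowPr_pd, ← colPr_pd, hg, sub_add_cancel, colPr_of_mem_bi C hh, rowPr_of_mem_bi C hh]

/-- A cycle of the second page is a boundary if and only if the element represented by its leading
column is a `∂`-boundary. -/
theorem mem_den_iff (hx : x ∈ (tot C).Z 2 k j) (hh : IsRep C (colPr C k x) h) :
    x ∈ (tot C).Z (2 - 1) (k + 1) (j - 1) ⊔ (tot C).B (2 - 1) k j ↔
      ∃ g, pd C.cohomology g = h := by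
  obtain ⟨hx1, hx2, hx3⟩ := mem_Z_tot.1 hx
  constructor
  · intro hx'
    obtain ⟨y, b, hy, hb, hyb⟩ : ∃ y b : OSC C, y ∈ (tot C).Z (2 - 1) (k + 1) (j - 1) ∧
        b ∈ (tot C).B (2 - 1) k j ∧ y + b = x := by
      obtain ⟨y, hy, b, hb, hyb⟩ := (Submodule.mem_sup (M := (tot C).carrier)).1 hx'
      exact ⟨y, b, hy, hb, hyb⟩
    obtain ⟨hb1, -, c, hc1, -, hcb⟩ := mem_B_tot.1 hb
    -- column `k - 1` of `(∂ + δ) c = b`: the leading column of `c` is a `δ`-cycle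
    have hc : dl C (colPr C (k - 1) c) = 0 := by
      have h1 := colPr_pd_add_dl (k - 1) c
      rw [hcb, colPr_of_mem_fil C (by omega) hb1, colPr_of_mem_fil C (by omega) hc1, map_zero,
        zero_add] at h1
      exact h1.symm
    obtain ⟨g, hg⟩ := IsRep.exists_of_cycle hc
    -- column `k`: up to a `δ`-boundary, the leading column of `x` is `∂` of that of `c`
    have h2 : colPr C k x = pd C (colPr C (k - 1) c) + dl C (colPr C k c) := by
      rw [← colPr_pd_add_dl, hcb, ← hyb, map_add,
        colPr_of_mem_fil C (by omega) (mem_Z_tot.1 hy).1, zero_add]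
    have h3 := hg.pd.add (IsRep.dl C (colPr C k c))
    rw [← h2, add_zero] at h3
    exact ⟨g, h3.unique hh⟩
  · rintro ⟨g, hg⟩
    obtain ⟨g, hgb, hg⟩ := exists_mem_bi_of_pd_eq (hh.mem_bi_of_mem_Z hx) hg
    obtain ⟨e, he, heg⟩ := IsRep.exists_rep hgb
    have h1 := hh.sub heg.pd
    rw [hg, sub_self] at h1
    obtain ⟨f, hf, hef⟩ := h1.exists_eq_dl_of_mem_bi (sub_add_cancel j 1)
      (sub_mem (colPr_mem_bi_of_mem_Z hx) (pd_mem_bi C (sub_add_cancel k 1) he))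
    -- `(∂ + δ) (e + f)` has the same leading column as `x`
    have h2 : pd C (e + f) + dl C (e + f) = pd C e + dl C f + pd C f := by
      rw [map_add, map_add, heg.dl_eq_zero]
      abel
    have h3 : pd C e + dl C f = colPr C k x := by rw [← hef]; abel
    have hpf : pd C f ∈ fil C (k + 1) := bi_le_fil C _ _ (pd_mem_bi C rfl hf)
    have hef1 : pd C (e + f) + dl C (e + f) ∈ fil C k := by
      rw [h2, h3]
      exact add_mem (bi_le_fil C _ _ (colPr_mem_bi_of_mem_Z hx))
        (FilteredDGA.fil_of_le (D := tot C) (by omega) hpf)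
    have hef2 : e + f ∈ deg C (k + j - 1) :=
      add_mem (bi_le_deg C (by ring) he) (bi_le_deg C (by ring) hf)
    have hef3 : pd C (e + f) + dl C (e + f) ∈ deg C (k + j) :=
      FilteredDGA.deg_congr (D := tot C) (by ring) ((tot C).d_deg _ _ hef2)
    have hdd : pd C (pd C (e + f) + dl C (e + f)) + dl C (pd C (e + f) + dl C (e + f)) = 0 :=
      (tot C).d_d (e + f)
    rw [← sub_add_cancel x (pd C (e + f) + dl C (e + f))]
    refine Submodule.add_mem_sup (M := (tot C).carrier)
      (mem_Z_tot.2 ⟨mem_fil_succ C (sub_mem hx1 hef1) ?_,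
      FilteredDGA.deg_congr (D := tot C) (by ring) (sub_mem hx2 hef3), ?_⟩) (mem_B_tot.2
        ⟨hef1, hef3, e + f, add_mem (FilteredDGA.fil_of_le (D := tot C) (by omega)
          (bi_le_fil C _ _ he)) (FilteredDGA.fil_of_le (D := tot C) (by omega)
            (bi_le_fil C _ _ hf)), hef2, rfl⟩)
    · rw [map_sub, h2, h3, map_add, colPr_of_mem_bi C (colPr_mem_bi_of_mem_Z hx),
        colPr_of_mem_fil C (by omega) hpf, add_zero, sub_self]
    · have h4 : pd C (x - (pd C (e + f) + dl C (e + f))) + dl C (x - (pd C (e + f) + dl C (e + f))) =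
          pd C x + dl C x := by
        rw [map_sub (pd C), map_sub (dl C), ← sub_zero (pd C x + dl C x), ← hdd]
        abel
      rw [h4]
      exact FilteredDGA.fil_of_le (D := tot C) (by omega) hx3

end Leading

/-- The class of a `∂`-cycle. -/
def pdCls (h : OSC C) (hh : pd C h = 0) : (pdAlg C).Coh := (pdAlg C).cls ⟨h, hh⟩

theorem pdCls_eq_iff {h h' : OSC C} (hh : pd C h = 0) (hh' : pd C h' = 0) :
    pdCls h hh = pdCls h' hh' ↔ ∃ g, pd C g = h - h' :=
  SubQ.mk_eq_mk (N := LinearMap.ker (pd C)) (D := LinearMap.range (pd C))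

theorem pdCls_eq_zero_iff {h : OSC C} (hh : pd C h = 0) : pdCls h hh = 0 ↔ ∃ g, pd C g = h :=
  SubQ.mk_eq_zero (N := LinearMap.ker (pd C)) (D := LinearMap.range (pd C))

theorem mem_biCoh {k j : ℤ} {α : (pdAlg C).Coh} :
    α ∈ biCoh C k j ↔ ∃ h ∈ bi C k j, ∃ hh : pd C h = 0, pdCls h hh = α :=
  ⟨fun ⟨⟨h, hh⟩, hb, hα⟩ => ⟨h, hb, hh, hα⟩, fun ⟨h, hb, hh, hα⟩ => ⟨⟨h, hh⟩, hb, hα⟩⟩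

theorem pd_mul_eq_zero {h g : OSC C} (hh : pd C h = 0) (hg : pd C g = 0) :
    pd C (mul C h g) = 0 := by
  rw [pd_mul, hh, hg]; simp

variable (C) in
/-- The correspondence between `H^k(A*(P, H^j(C)), ∂)` and `E_2^{k,j}`: a cycle of the second page
corresponds to the class of the element represented by its leading column. -/
def leadCorr (k j : ℤ) : Submodule R (biCoh C.cohomology k j × (tot C).Page 2 k j) where
  carrier := {z | ∃ (x : OSC C) (h : OSC C.cohomology) (hx : x ∈ (tot C).Z 2 k j)
    (hh : pd C.cohomology h = 0), IsRep C (colPr C k x) h ∧ pdCls h hh = z.1 ∧ SubQ.mk x hx = z.2}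
  zero_mem' := ⟨0, 0, zero_mem _, map_zero _, by simpa using IsRep.zero C, rfl, rfl⟩
  add_mem' := by
    rintro ⟨_, _⟩ ⟨_, _⟩ ⟨x, h, hx, hh, hr, h1, h2⟩ ⟨x', h', hx', hh', hr', h1', h2'⟩
    refine ⟨x + x', h + h', add_mem hx hx', by rw [map_add, hh, hh', add_zero], ?_,
      (congrArg₂ (· + ·) h1 h1' :), (congrArg₂ (· + ·) h2 h2' :)⟩
    rw [map_add]
    exact hr.add hr'
  smul_mem' := by
    rintro r ⟨_, _⟩ ⟨x, h, hx, hh, hr, h1, h2⟩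
    refine ⟨r • x, r • h, Submodule.smul_mem _ r hx, by rw [map_smul, hh, smul_zero], ?_,
      (congrArg (r • ·) h1 :), (congrArg (r • ·) h2 :)⟩
    rw [map_smul]
    exact hr.smul r

variable (C) in
/-- `leadCorr` is the graph of an isomorphism. -/
theorem exists_leadEquiv (k j : ℤ) : ∃ e : biCoh C.cohomology k j ≃ₗ[R] (tot C).Page 2 k j,
    ∀ m n, (m, n) ∈ leadCorr C k j → e m = n := by
  refine exists_linearEquiv_of_correspondence _ ?_ ?_ ?_ ?_
  · rintro ⟨α, hα⟩
    obtain ⟨h, hb, hh, rfl⟩ := mem_biCoh.1 hα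
    obtain ⟨x, hx, hr⟩ := exists_mem_Z_of_cycle hb hh
    exact ⟨SubQ.mk x hx, x, h, hx, hh, hr, rfl, rfl⟩
  · intro ξ
    induction ξ using SubQ.ind with
    | h x hx =>
      obtain ⟨h, hr⟩ := exists_isRep_colPr hx
      have hh := hr.pd_eq_zero_of_mem_Z hx
      exact ⟨⟨_, mem_biCoh.2 ⟨h, hr.mem_bi_of_mem_Z hx, hh, rfl⟩⟩, x, h, hx, hh, hr, rfl, rfl⟩
  · rintro _ ⟨x, h, hx, hh, hr, h1, rfl⟩
    exact SubQ.mk_eq_zero.2 ((mem_den_iff hx hr).2 ((pdCls_eq_zero_iff hh).1 h1))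
  · rintro ⟨α, hα⟩ ⟨x, h, hx, hh, hr, h1, h2⟩
    refine Subtype.ext (h1.symm.trans ((pdCls_eq_zero_iff hh).2 ?_))
    exact (mem_den_iff hx hr).1 (SubQ.mk_eq_zero.1 h2)

variable (C) in
/-- `H^k(A*(P, H^j(C)), ∂) ≅ E_2^{k,j}`, as bigraded algebras. -/
theorem exists_mul_leadEquiv :
    ∃ φ : ∀ k j : ℤ, biCoh C.cohomology k j ≃ₗ[R] (tot C).Page 2 k j,
      ∀ (k j l m : ℤ) (α : biCoh C.cohomology k j) (β : biCoh C.cohomology l m),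
        φ (k + l) (j + m) ⟨(α : (pdAlg C.cohomology).Coh) * β,
            mul_mem_biCoh C.cohomology α.2 β.2⟩ =
          (tot C).mulPage 2 k j l m (φ k j α) (φ l m β) := by
  choose φ hφ using exists_leadEquiv C
  refine ⟨φ, fun k j l m => ?_⟩
  rintro ⟨α, hα⟩ ⟨β, hβ⟩
  obtain ⟨h, hb, hh, rfl⟩ := mem_biCoh.1 hα
  obtain ⟨g, hgb, hg, rfl⟩ := mem_biCoh.1 hβ
  obtain ⟨x, hx, hxh⟩ := exists_mem_Z_of_cycle hb hh
  obtain ⟨y, hy, hyg⟩ := exists_mem_Z_of_cycle hgb hg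
  rw [hφ k j _ (SubQ.mk x hx) ⟨x, h, hx, hh, hxh, rfl, rfl⟩,
    hφ l m _ (SubQ.mk y hy) ⟨y, g, hy, hg, hyg, rfl, rfl⟩]
  refine hφ _ _ _ _ ⟨mul C x y, mul C.cohomology h g, FilteredDGA.mul_mem_Z hx hy,
    pd_mul_eq_zero hh hg, ?_, rfl, rfl⟩
  rw [colPr_mul C (mem_Z_tot.1 hx).1 (mem_Z_tot.1 hy).1]
  exact hxh.mul hyg

end OSC

/-! ### Collapse of the spectral sequence of a filtered differential graded algebra -/

namespace FilteredDGA

variable {R : Type v} [CommRing R] (D : FilteredDGA.{v, w} R)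

/-- Every class of the second page is represented by a cycle of the total differential. -/
def RepresentedByCycles : Prop :=
  ∀ k j : ℤ, ∀ x ∈ D.Z 2 k j, ∃ z, z ∈ D.fil k ∧ z ∈ D.deg (k + j) ∧ D.d z = 0 ∧
    x - z ∈ D.Z (2 - 1) (k + 1) (j - 1) ⊔ D.B (2 - 1) k j

variable {D}

theorem mem_den {r k j : ℤ} {x : D.carrier} :
    x ∈ D.Z (r - 1) (k + 1) (j - 1) ⊔ D.B (r - 1) k j ↔
      ∃ y c, y ∈ D.Z (r - 1) (k + 1) (j - 1) ∧ D.d c ∈ D.fil k ∧ D.d c ∈ D.deg (k + j) ∧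
        c ∈ D.fil (k - (r - 1)) ∧ c ∈ D.deg (k + j - 1) ∧ y + D.d c = x := by
  rw [Submodule.mem_sup]
  constructor
  · rintro ⟨y, hy, b, hb, rfl⟩
    obtain ⟨h1, h2, c, h3, h4, rfl⟩ := mem_B.1 hb
    exact ⟨y, c, hy, h1, h2, h3, h4, rfl⟩
  · rintro ⟨y, c, hy, h1, h2, h3, h4, rfl⟩
    exact ⟨y, hy, _, mem_B.2 ⟨h1, h2, c, h3, h4, rfl⟩, rfl⟩

/-- If classes of the second page are represented by cycles, the differential of `x ∈ Z_2^{k,j}` is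
also the differential of an element of higher filtration. -/
theorem RepresentedByCycles.exists_d_eq (hD : D.RepresentedByCycles) {k j : ℤ} {x : D.carrier}
    (hx : x ∈ D.Z 2 k j) : ∃ y, y ∈ D.fil (k + 1) ∧ y ∈ D.deg (k + j) ∧ D.d y = D.d x := by
  obtain ⟨z, -, -, hz, h⟩ := hD k j x hx
  obtain ⟨y, c, hy, -, -, -, -, h⟩ := mem_den.1 h
  refine ⟨y, (mem_Z.1 hy).1, deg_congr (by ring) (mem_Z.1 hy).2.1, ?_⟩
  have h1 := congrArg D.d h
  rwa [map_add, D.d_d, add_zero, map_sub, hz, sub_zero] at h1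

/-- If classes of the second page are represented by cycles, the spectral sequence collapses: `d_r x`
is the differential of an element of filtration `k + 1 = (k + r) - (r - 1)`, so it vanishes in
`E_r^{k+r,j-r+1}`. -/
theorem RepresentedByCycles.dPage_eq_zero (hD : D.RepresentedByCycles) {r : ℤ} (hr : 2 ≤ r)
    (k j : ℤ) : D.dPage r k j = 0 := by
  refine LinearMap.ext fun ξ => ?_
  induction ξ using SubQ.ind with
  | h x hx =>
    obtain ⟨hx1, hx2, hx3⟩ := mem_Z.1 hx
    obtain ⟨y, hy1, hy2, hyx⟩ := hD.exists_d_eq (mem_Z.2 ⟨hx1, hx2, fil_of_le (by omega) hx3⟩)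
    refine SubQ.mk_eq_zero.2 (Submodule.mem_sup_right (mem_B.2 ⟨hx3, ?_, y, ?_, ?_, hyx⟩))
    · exact deg_congr (by ring) (D.d_deg _ _ hx2)
    · exact fil_of_le (by omega) hy1
    · exact deg_congr (by ring) hy2

/-- If classes of the second page are represented by cycles, a boundary of filtration `k` is the
boundary of an element of filtration `k - 1`. -/
theorem RepresentedByCycles.exists_d_eq_of_mem_fil (hD : D.RepresentedByCycles) {k n m : ℤ}
    {w : D.carrier} (hm : w ∈ D.fil m) (hn : w ∈ D.deg n) (hd : D.d w ∈ D.fil k) :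
    ∃ c, c ∈ D.fil (k - 1) ∧ c ∈ D.deg n ∧ D.d c = D.d w := by
  -- as long as `m < k - 1`, `w` lies in `Z_2` and can be replaced by an element of filtration `m + 1`
  induction ha : (k - 1 - m).toNat generalizing m w with
  | zero => exact ⟨w, fil_of_le (by omega) hm, hn, rfl⟩
  | succ a ih =>
    obtain ⟨y, hy1, hy2, hyw⟩ := hD.exists_d_eq (k := m) (j := n - m)
      (mem_Z.2 ⟨hm, deg_congr (by ring) hn, fil_of_le (by omega) hd⟩)
    rw [← hyw] at hd ⊢
    exact ih hy1 (deg_congr (by ring) hy2) hd (by omega)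

theorem mem_filCoh {k n : ℤ} {α : D.Coh} : α ∈ D.filCoh k n ↔
    ∃ z, z ∈ D.fil k ∧ z ∈ D.deg n ∧ ∃ hz : D.d z = 0, D.cls ⟨z, hz⟩ = α :=
  ⟨fun ⟨⟨z, hz⟩, hb, hα⟩ => ⟨z, hb.1, hb.2, hz, hα⟩,
    fun ⟨z, h1, h2, hz, hα⟩ => ⟨⟨z, hz⟩, ⟨h1, h2⟩, hα⟩⟩

theorem cls_eq_iff {x y : D.carrier} (hx : D.d x = 0) (hy : D.d y = 0) :
    D.cls ⟨x, hx⟩ = D.cls ⟨y, hy⟩ ↔ ∃ c, D.d c = x - y :=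
  SubQ.mk_eq_mk (N := LinearMap.ker D.d) (D := LinearMap.range D.d)

theorem mem_Z_of_cycle {r k j : ℤ} {z : D.carrier} (h1 : z ∈ D.fil k) (h2 : z ∈ D.deg (k + j))
    (hz : D.d z = 0) : z ∈ D.Z r k j :=
  mem_Z.2 ⟨h1, h2, by rw [hz]; exact zero_mem _⟩

variable (D) in
/-- The correspondence between the second page and the associated graded of the cohomology given by
the two classes of a cycle. -/
def cycleCorr (k j : ℤ) : Submodule R (D.Page 2 k j × D.Gr k j) where
  carrier := {a | ∃ (z : D.carrier) (h1 : z ∈ D.fil k) (h2 : z ∈ D.deg (k + j)) (hz : D.d z = 0),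
    SubQ.mk z (mem_Z_of_cycle h1 h2 hz) = a.1 ∧
      SubQ.mk (D.cls ⟨z, hz⟩) (mem_filCoh.2 ⟨z, h1, h2, hz, rfl⟩) = a.2}
  zero_mem' := ⟨0, zero_mem _, zero_mem _, map_zero _, rfl, rfl⟩
  add_mem' := by
    rintro _ _ ⟨z, h1, h2, hz, e1, e2⟩ ⟨z', h1', h2', hz', e1', e2'⟩
    exact ⟨z + z', add_mem h1 h1', add_mem h2 h2', by rw [map_add, hz, hz', add_zero],
      (congrArg₂ (· + ·) e1 e1' :), (congrArg₂ (· + ·) e2 e2' :)⟩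
  smul_mem' := by
    rintro r _ ⟨z, h1, h2, hz, e1, e2⟩
    exact ⟨r • z, Submodule.smul_mem _ r h1, Submodule.smul_mem _ r h2,
      by rw [map_smul, hz, smul_zero], (congrArg (r • ·) e1 :), (congrArg (r • ·) e2 :)⟩

/-- The two classes of a cycle determine each other. That the class in the second page vanishes if
the one in the associated graded does uses `exists_d_eq_of_mem_fil`, for which the filtration has to
be bounded and boundaries have to be boundaries of homogeneous elements. -/
theorem RepresentedByCycles.exists_cycleEquiv (hD : D.RepresentedByCycles)
    (hdeg : ∀ n w, D.d w ∈ D.deg n → ∃ c ∈ D.deg (n - 1), D.d c = D.d w)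
    (hfil : ∃ m, ∀ x, x ∈ D.fil m) (k j : ℤ) :
    ∃ e : D.Page 2 k j ≃ₗ[R] D.Gr k j, ∀ a b, (a, b) ∈ D.cycleCorr k j → e a = b := by
  refine exists_linearEquiv_of_correspondence _ ?_ ?_ ?_ ?_
  · intro ξ
    induction ξ using SubQ.ind with
    | h x hx =>
      obtain ⟨z, h1, h2, hz, h⟩ := hD k j x hx
      exact ⟨_, z, h1, h2, hz, (SubQ.mk_eq_mk.2 h).symm, rfl⟩
  · intro γ
    induction γ using SubQ.ind with
    | h α hα =>
      obtain ⟨z, h1, h2, hz, rfl⟩ := mem_filCoh.1 hα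
      exact ⟨_, z, h1, h2, hz, rfl, rfl⟩
  · rintro _ ⟨z, h1, h2, hz, e, rfl⟩
    obtain ⟨y, c, hy, -, -, -, -, hyc⟩ := mem_den.1 (SubQ.mk_eq_zero.1 e)
    have hy0 : D.d y = 0 := by
      have h3 := congrArg D.d hyc
      rwa [map_add, D.d_d, add_zero, hz] at h3
    refine SubQ.mk_eq_zero.2 (mem_filCoh.2 ⟨y, (mem_Z.1 hy).1, deg_congr (by ring) (mem_Z.1 hy).2.1,
      hy0, (cls_eq_iff hy0 hz).2 ⟨-c, ?_⟩⟩)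
    rw [map_neg, ← hyc]
    abel
  · rintro _ ⟨z, h1, h2, hz, rfl, e⟩
    obtain ⟨z', h1', h2', hz', hzz⟩ := mem_filCoh.1 (SubQ.mk_eq_zero.1 e)
    obtain ⟨w, hw⟩ := (cls_eq_iff hz hz').1 hzz.symm
    obtain ⟨c, hc, hcw⟩ := hdeg (k + j) w (by rw [hw]; exact sub_mem h2 h2')
    obtain ⟨m, hm⟩ := hfil
    have hk : D.d c ∈ D.fil k := by
      rw [hcw, hw]
      exact sub_mem h1 (fil_of_le (by omega) h1')
    obtain ⟨b, hb1, hb2, hbc⟩ := hD.exists_d_eq_of_mem_fil (hm c) hc hk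
    have hbz : D.d b = z - z' := by rw [hbc, hcw, hw]
    refine SubQ.mk_eq_zero.2 (mem_den.2 ⟨z', b, mem_Z_of_cycle h1' (deg_congr (by ring) h2') hz',
      by rwa [hbc], ?_, hb1, hb2, ?_⟩)
    · rw [hbz]
      exact sub_mem h2 h2'
    · rw [hbz]
      abel

/-- If classes of the second page are represented by cycles, the second page is isomorphic to the
graded algebra of the cohomology. -/
theorem RepresentedByCycles.exists_mul_cycleEquiv (hD : D.RepresentedByCycles)
    (hdeg : ∀ n w, D.d w ∈ D.deg n → ∃ c ∈ D.deg (n - 1), D.d c = D.d w)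
    (hfil : ∃ m, ∀ x, x ∈ D.fil m) : ∃ ψ : ∀ k j : ℤ, D.Page 2 k j ≃ₗ[R] D.Gr k j,
      ∀ (k j l m : ℤ) (x : D.Page 2 k j) (y : D.Page 2 l m),
        ψ (k + l) (j + m) (D.mulPage 2 k j l m x y) = D.mulGr k j l m (ψ k j x) (ψ l m y) := by
  choose ψ hψ using hD.exists_cycleEquiv hdeg hfil
  refine ⟨ψ, fun k j l m ξ η => ?_⟩
  have key : ∀ {k j : ℤ} (ξ : D.Page 2 k j), ∃ (z : D.carrier) (h1 : z ∈ D.fil k)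
      (h2 : z ∈ D.deg (k + j)) (hz : D.d z = 0), SubQ.mk z (mem_Z_of_cycle h1 h2 hz) = ξ := by
    intro k j ξ
    induction ξ using SubQ.ind with
    | h x hx =>
      obtain ⟨z, h1, h2, hz, h⟩ := hD k j x hx
      exact ⟨z, h1, h2, hz, (SubQ.mk_eq_mk.2 h).symm⟩
  obtain ⟨z, h1, h2, hz, rfl⟩ := key ξ
  obtain ⟨z', h1', h2', hz', rfl⟩ := key η
  have e : ψ k j (SubQ.mk z (mem_Z_of_cycle h1 h2 hz)) = SubQ.mk (D.cls ⟨z, hz⟩) _ :=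
    hψ k j _ _ ⟨z, h1, h2, hz, rfl, rfl⟩
  have e' : ψ l m (SubQ.mk z' (mem_Z_of_cycle h1' h2' hz')) = SubQ.mk (D.cls ⟨z', hz'⟩) _ :=
    hψ l m _ _ ⟨z', h1', h2', hz', rfl, rfl⟩
  rw [e, e']
  refine hψ _ _ _ _ ⟨D.mul z z', D.mul_fil _ _ _ h1 _ h1',
    deg_congr (by ring) (D.mul_deg _ _ _ h2 _ h2'), ?_, rfl, rfl⟩
  rw [D.d_mul, hz, hz']
  simp

end FilteredDGA

/-! ### Classes represented by cycles of the total complex -/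

namespace OSC

set_option linter.unusedSectionVars false

variable {R : Type v} [CommRing R] {P : Type u} [PartialOrder P] [OrderBot P] [Fintype P]
  [LocallyGeometric P] (C : MonoidalDGAPresheaf.{u, v, w} R P)

/-- The submodule of `H^*(A*(P, H^*(C)), ∂)` spanned by the classes of the leading columns of cycles
of the total complex. -/
def permanent : Submodule R (pdAlg C.cohomology).Coh :=
  Submodule.span R {α | ∃ (k j : ℤ) (z : OSC C), z ∈ fil C k ∧ z ∈ deg C (k + j) ∧
    pd C z + dl C z = 0 ∧ ∃ (h : OSC C.cohomology) (hh : pd C.cohomology h = 0),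
      IsRep C (colPr C k z) h ∧ pdCls h hh = α}

variable {C}

/-- The product of two cycles is a cycle, and its leading column is the product of theirs. -/
theorem mul_mem_permanent {α β : (pdAlg C.cohomology).Coh} (hα : α ∈ permanent C)
    (hβ : β ∈ permanent C) : α * β ∈ permanent C := by
  induction hα using Submodule.span_induction with
  | zero => rw [zero_mul]; exact zero_mem _
  | add x y _ _ hx hy => rw [add_mul]; exact add_mem hx hy
  | smul r x _ hx => rw [smul_mul_assoc]; exact Submodule.smul_mem _ r hx
  | mem α hα =>
    obtain ⟨k, j, z, h1, h2, hz, h, hh, hr, rfl⟩ := hα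
    induction hβ using Submodule.span_induction with
    | zero => rw [mul_zero]; exact zero_mem _
    | add x y _ _ hx hy => rw [mul_add]; exact add_mem hx hy
    | smul r x _ hx => rw [mul_smul_comm]; exact Submodule.smul_mem _ r hx
    | mem β hβ =>
      obtain ⟨l, m, z', h1', h2', hz', h', hh', hr', rfl⟩ := hβ
      refine Submodule.subset_span ⟨k + l, j + m, mul C z z', fil_mul C h1 h1',
        FilteredDGA.deg_congr (D := tot C) (by ring) (deg_mul C h2 h2'), ?_, _,
        pd_mul_eq_zero hh hh', ?_, rfl⟩
      · refine ((tot C).d_mul z z').trans ?_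
        have e1 : (tot C).d z = 0 := hz
        have e2 : (tot C).d z' = 0 := hz'
        rw [e1, e2]
        exact (congrArg₂ (· + ·) (LinearMap.map_zero₂ (tot C).mul z')
          (map_zero ((tot C).mul _))).trans (add_zero _)
      · rw [colPr_mul C h1 h1']
        exact hr.mul hr'

/-- In the columns `0` and `-1` all cycles of the second page are cycles of the total complex, since
their differentials have positive filtration. -/
theorem colCoh_le_permanent {k : ℤ} (hk : -1 ≤ k) : colCoh C.cohomology k ≤ permanent C := by
  intro α hα
  obtain ⟨h, hh, hcol, rfl⟩ : ∃ (h : OSC C.cohomology) (hh : pd C.cohomology h = 0),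
      h ∈ col C.cohomology k ∧ pdCls h hh = α := by
    obtain ⟨⟨h, hh⟩, hcol, rfl⟩ := hα
    exact ⟨h, hh, hcol, rfl⟩
  obtain ⟨S, hS⟩ := exists_sum_rowPr C.cohomology h
  have hc : colPr C.cohomology k h = h := by
    funext p
    by_cases hp : (rk p : ℤ) = -k
    · exact colPr_apply_of _ h hp
    · rw [colPr_apply_of_ne _ h hp]
      exact (hcol p hp).symm
  have hrow : ∀ j, pd C.cohomology (rowPr C.cohomology j h) = 0 := fun j => by
    rw [← rowPr_pd, hh, map_zero]
  have hsum : (⟨h, hh⟩ : LinearMap.ker (pdAlg C.cohomology).d) =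
      ∑ j ∈ S, (⟨rowPr C.cohomology j h, hrow j⟩ : LinearMap.ker (pdAlg C.cohomology).d) :=
    Subtype.ext (by rw [AddSubmonoidClass.coe_finsetSum]; exact hS.symm)
  rw [pdCls, hsum, map_sum]
  refine sum_mem fun j _ => Submodule.subset_span ?_
  have hb : rowPr C.cohomology j h ∈ bi C.cohomology k j := by
    have := rowPr_colPr_mem_bi C.cohomology k j h
    rwa [hc] at this
  obtain ⟨z, hz, hr⟩ := exists_mem_Z_of_cycle hb (hrow j)
  obtain ⟨h1, h2, h3⟩ := mem_Z_tot.1 hz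
  exact ⟨k, j, z, h1, h2, fil_eq_bot C (by omega) h3, _, hrow j, hr, rfl⟩

/-- Each bihomogeneous component of an element of `permanent C` is the class of the leading column of
a cycle of the total complex. -/
theorem exists_cycle_of_mem_permanent {α : (pdAlg C.cohomology).Coh} (hα : α ∈ permanent C)
    (k j : ℤ) : ∃ (a : OSC C.cohomology) (ha : pd C.cohomology a = 0) (z : OSC C), pdCls a ha = α ∧
      z ∈ fil C k ∧ z ∈ deg C (k + j) ∧ pd C z + dl C z = 0 ∧
      IsRep C (colPr C k z) (rowPr C.cohomology j (colPr C.cohomology k a)) := by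
  induction hα using Submodule.span_induction with
  | zero =>
    exact ⟨0, map_zero _, 0, rfl, zero_mem _, zero_mem _, by simp, by simpa using IsRep.zero C⟩
  | add x y _ _ hx hy =>
    obtain ⟨a, ha, z, rfl, h1, h2, hz, hr⟩ := hx
    obtain ⟨a', ha', z', rfl, h1', h2', hz', hr'⟩ := hy
    refine ⟨a + a', by rw [map_add, ha, ha', add_zero], z + z', rfl, add_mem h1 h1',
      add_mem h2 h2', ?_, ?_⟩
    · rw [map_add, map_add, add_add_add_comm, hz, hz', add_zero]
    · simpa only [map_add] using hr.add hr'
  | smul r x _ hx =>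
    obtain ⟨a, ha, z, rfl, h1, h2, hz, hr⟩ := hx
    refine ⟨r • a, by rw [map_smul, ha, smul_zero], r • z, rfl, Submodule.smul_mem _ r h1,
      Submodule.smul_mem _ r h2, ?_, ?_⟩
    · rw [map_smul, map_smul, ← smul_add, hz, smul_zero]
    · simpa only [map_smul] using hr.smul r
  | mem α hα =>
    obtain ⟨k', j', z, h1, h2, hz, h, hh, hr, rfl⟩ := hα
    have hb : h ∈ bi C.cohomology k' j' :=
      hr.mem_bi_of_mem_Z (FilteredDGA.mem_Z_of_cycle (D := tot C) h1 h2 hz)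
    by_cases hkj : k = k' ∧ j = j'
    · obtain ⟨rfl, rfl⟩ := hkj
      refine ⟨h, hh, z, rfl, h1, h2, hz, ?_⟩
      rwa [colPr_of_mem_bi _ hb, rowPr_of_mem_bi _ hb]
    · refine ⟨h, hh, 0, rfl, zero_mem _, zero_mem _, by simp, ?_⟩
      have h0 : rowPr C.cohomology j (colPr C.cohomology k h) = 0 := by
        by_cases hk : k = k'
        · subst hk
          rw [colPr_of_mem_bi _ hb, rowPr_of_mem_bi_of_ne _ hb (fun h => hkj ⟨rfl, h⟩)]
        · rw [colPr_of_mem_bi_of_ne _ hb hk, map_zero]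
      rw [h0, map_zero]
      exact IsRep.zero C

/-- If `permanent C` is everything, the class of the leading column of `x ∈ Z_2^{k,j}` is also that of
the leading column of a cycle `z`, so `x - z` vanishes in the second page by `mem_den_iff`. -/
theorem representedByCycles (hC : permanent C = ⊤) : (tot C).RepresentedByCycles := by
  intro k j (x : OSC C) hx
  obtain ⟨h, hr⟩ := exists_isRep_colPr hx
  have hh := hr.pd_eq_zero_of_mem_Z hx
  have hb := hr.mem_bi_of_mem_Z hx
  obtain ⟨a, ha, z, hah, h1, h2, hz, hza⟩ :=
    exists_cycle_of_mem_permanent (hC ▸ Submodule.mem_top : pdCls h hh ∈ permanent C) k j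
  obtain ⟨g, hg⟩ := (pdCls_eq_iff hh ha).1 hah.symm
  refine ⟨z, h1, h2, hz, ?_⟩
  have hzZ : z ∈ (tot C).Z 2 k j := FilteredDGA.mem_Z_of_cycle (D := tot C) h1 h2 hz
  refine (mem_den_iff (h := h - rowPr C.cohomology j (colPr C.cohomology k a))
    (sub_mem hx hzZ) ?_).2 ⟨rowPr C.cohomology j (colPr C.cohomology (k - 1) g), ?_⟩
  · have h3 := hr.sub hza
    rwa [← map_sub] at h3
  · rw [← rowPr_pd, ← colPr_pd, hg, sub_add_cancel, map_sub, map_sub, colPr_of_mem_bi _ hb,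
      rowPr_of_mem_bi _ hb]

variable (C) in
theorem exists_d_eq_of_d_mem_deg (n : ℤ) (w : (tot C).carrier) (hw : (tot C).d w ∈ (tot C).deg n) :
    ∃ c ∈ (tot C).deg (n - 1), (tot C).d c = (tot C).d w := by
  -- the component of degree `n - 1` of `w`
  refine ⟨degPr C (n - 1) w, degPr_mem C _ _, ?_⟩
  have h1 := degPr_pd C (n - 1) w
  have h2 := degPr_dl C (n - 1) w
  rw [sub_add_cancel] at h1 h2
  have h3 : degPr C n (pd C w + dl C w) = pd C w + dl C w := degPr_of_mem C hw
  rw [map_add, h1, h2] at h3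
  exact h3

theorem permanent_eq_top (hgen : NonUnitalAlgebra.adjoin R
    ((colCoh C.cohomology 0 : Set (pdAlg C.cohomology).Coh) ∪
      (colCoh C.cohomology (-1) : Set (pdAlg C.cohomology).Coh)) = ⊤) : permanent C = ⊤ := by
  rw [eq_top_iff]
  intro α _
  have hα : α ∈ NonUnitalAlgebra.adjoin R
      ((colCoh C.cohomology 0 : Set (pdAlg C.cohomology).Coh) ∪
        (colCoh C.cohomology (-1) : Set (pdAlg C.cohomology).Coh)) := hgen ▸ trivial
  induction hα using NonUnitalAlgebra.adjoin_induction with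
  | mem x hx =>
    rcases hx with hx | hx
    · exact colCoh_le_permanent (by omega) hx
    · exact colCoh_le_permanent le_rfl hx
  | add x y _ _ hx hy => exact add_mem (hx trivial) (hy trivial)
  | zero => exact zero_mem _
  | mul x y _ _ hx hy => exact mul_mem_permanent (hx trivial) (hy trivial)
  | smul r x _ hx => exact Submodule.smul_mem _ r (hx trivial)

end OSC

end OrlikSolomon

end

theorem mainTheorem11 {R : Type v} [CommRing R] {L : Type u} [PartialOrder L] [OrderBot L]
    [Fintype L] [OrlikSolomon.LocallyGeometric L]
    (C : OrlikSolomon.MonoidalDGAPresheaf.{u, v, w} R L) (p : L)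
    (hgen : NonUnitalAlgebra.adjoin R
      ((OrlikSolomon.OSC.colCoh (C.restrict p).cohomology 0 :
          Set (OrlikSolomon.OSC.pdAlg (C.restrict p).cohomology).Coh) ∪
        (OrlikSolomon.OSC.colCoh (C.restrict p).cohomology (-1) :
          Set (OrlikSolomon.OSC.pdAlg (C.restrict p).cohomology).Coh)) = ⊤) :
    (∀ r k j : ℤ, 2 ≤ r → (OrlikSolomon.OSC.tot (C.restrict p)).dPage r k j = 0) ∧
    (∃ φ : ∀ k j : ℤ, OrlikSolomon.OSC.biCoh (C.restrict p).cohomology k j ≃ₗ[R]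
        (OrlikSolomon.OSC.tot (C.restrict p)).Page 2 k j,
      ∀ (k j l m : ℤ) (α : OrlikSolomon.OSC.biCoh (C.restrict p).cohomology k j)
        (β : OrlikSolomon.OSC.biCoh (C.restrict p).cohomology l m),
        φ (k + l) (j + m)
            ⟨(α : (OrlikSolomon.OSC.pdAlg (C.restrict p).cohomology).Coh) * β,
              OrlikSolomon.OSC.mul_mem_biCoh (C.restrict p).cohomology α.2 β.2⟩ =
          (OrlikSolomon.OSC.tot (C.restrict p)).mulPage 2 k j l m (φ k j α) (φ l m β)) ∧
    (∃ ψ : ∀ k j : ℤ, (OrlikSolomon.OSC.tot (C.restrict p)).Page 2 k j ≃ₗ[R]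
        (OrlikSolomon.OSC.tot (C.restrict p)).Gr k j,
      ∀ (k j l m : ℤ) (x : (OrlikSolomon.OSC.tot (C.restrict p)).Page 2 k j)
        (y : (OrlikSolomon.OSC.tot (C.restrict p)).Page 2 l m),
        ψ (k + l) (j + m) ((OrlikSolomon.OSC.tot (C.restrict p)).mulPage 2 k j l m x y) =
          (OrlikSolomon.OSC.tot (C.restrict p)).mulGr k j l m (ψ k j x) (ψ l m y)) := by
  obtain ⟨φ, hφ⟩ := OrlikSolomon.OSC.exists_mul_leadEquiv (C.restrict p)
  have hD := OrlikSolomon.OSC.representedByCycles (OrlikSolomon.OSC.permanent_eq_top hgen)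
  exact ⟨fun r k j hr => hD.dPage_eq_zero hr k j, ⟨φ, hφ⟩,
    hD.exists_mul_cycleEquiv (OrlikSolomon.OSC.exists_d_eq_of_d_mem_deg (C.restrict p))
      (OrlikSolomon.OSC.exists_fil_eq_top (C.restrict p))⟩
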